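/- Let $U$ be a finite-dimensional real vector space with a full lattice $U_{\mathbb Z}\subset U$, and let $C\subset U$ be a nonempty open convex cone whose closure $\overline C$ contains no line. Let $\Gamma\subset \mathrm{GL}(U)$ be a neat group (for every $\gamma\in\Gamma$ the subgroup of $\mathbb C^\times$ generated by the eigenvalues of $\gamma$ is torsion free) preserving $C$ and $U_{\mathbb Z}$. Let $C^*$ be the union of $C$ and its rational boundary components, i.e. the union of the relative interiors of all faces of $\overline C$ whose linear span is defined over $\mathbb Q$ with respect to $U_{\mathbb Z}$ (the faces $\overline C$ and $\{0\}$ included). (This applies in particular to $U=U(F)$, $U_{\mathbb Z}=U(F)_{\mathbb Z}$, $C=C(F)$, $C^*=C(F)^*$, $\Gamma=\Gamma_{F,\ell}$ for a cusp $F$ of a Hermitian symmetric domain with an action of a neat arithmetic group: $U(F)$ is the center of the unipotent radical of the stabilizer of $F$, $C(F)\subset U(F)$ the associated homogeneous self-adjoint cone, $U(F)_{\mathbb Z}$ the lattice of elements of $U(F)$ in the arithmetic group, and $\Gamma_{F,\ell}$ the image in $\mathrm{GL}(U(F))$ of the stabilizer of $F$ in the arithmetic group.) Let $\Sigma$ be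 a $\Gamma$-admissible decomposition of $C^*$: a $\Gamma$-invariant collection of rational polyhedral cones with union $C^*$, closed under taking faces, such that any two cones meet in a common face and there are only finitely many cones modulo $\Gamma$. Let $\partial\Sigma=\{\sigma\in\Sigma:\sigma\subset C^*\setminus C\}$. Assume that every $\sigma\in\Sigma$ is simplicial, i.e. generated by $\dim\sigma$ vectors, and that 1. two different rays of a cone of $\Sigma$ are never $\Gamma$-equivalent; 2. for every $\sigma\in\Sigma$ the set $\sigma\cap(C^*\setminus C)$ is contained in the linear span of a single face of $\overline C$ that is different from $\overline C$ and has rational span. Let $(\Delta,\partial\Delta)$ be the projectivization of $(\Sigma,\partial\Sigma)$: $\Delta$ is the simplicial complex whose vertices are the rays of $\Sigma$ and whose simplices are the sets of rays of the nonzero cones of $\Sigma$, and $\partial\Delta$ is the subcomplex coming from $\partial\Sigma$. For a subcomplex $L$ of a simplicial complex $K$, let $K-L$ denote the space underlying $K$ (with the weak topology) minus the space underlying $L$; if $K$ is locally finite outside $L$ (every simplex of $K$ not in $L$ is a face of only finitely many simplices), let $C_c^\bullet(K,L)$ be the complex of relative simplicial cochains that are nonzero on only finitely many simplices, with coefficients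 in a given commutative ring. Then $\Delta$ is locally finite outside $\partial\Delta$, and there exist a subcomplex $\Delta^+$ of the barycentric subdivision of $\Delta$ and a subcomplex $\partial\Delta^+$ of $\Delta^+$ such that (1) $\Delta^+$ is locally finite (every vertex lies in only finitely many simplices) and $\Gamma$-invariant; (2) $\Delta^+-\partial\Delta^+$ is homeomorphic to $\Delta-\partial\Delta$; (3) for every commutative ring of coefficients there is a quasi-isomorphism of cochain complexes $C_c^\bullet(\Delta^+,\partial\Delta^+)\to C_c^\bullet(\Delta,\partial\Delta)$. -/

import Mathlib

namespace ConeRetraction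

universe u w

section Simplicial

variable {V : Type u}

/-- The barycentric subdivision of a simplicial complex: the vertices are the simplices of `K`
(standing for their barycenters), the simplices are the nonempty finite flags of simplices. -/
def barycentric (K : PreAbstractSimplicialComplex V) :
    PreAbstractSimplicialComplex (Finset V) where
  faces := {c | c.Nonempty ∧ (∀ s ∈ c, s ∈ K.faces) ∧ IsChain (fun s t : Finset V => s ⊆ t) (c : Set (Finset V))}
  isRelLowerSet_faces := fun _ hc =>
    ⟨hc.1, fun _ hle hne =>
      ⟨hne, fun s hs => hc.2.1 s (hle hs), hc.2.2.mono (Finset.coe_subset.mpr hle)⟩⟩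

/-- `K` is locally finite: every vertex lies in only finitely many simplices. -/
def LocallyFinite (K : PreAbstractSimplicialComplex V) : Prop :=
  ∀ v : V, {s ∈ K.faces | v ∈ s}.Finite

/-- `K` is locally finite outside the subcomplex `L`: every simplex of `K` that is not in `L`
is a face of only finitely many simplices of `K`. -/
def LocallyFiniteOff (K L : PreAbstractSimplicialComplex V) : Prop :=
  ∀ s ∈ K.faces, s ∉ L.faces → {t ∈ K.faces | s ⊆ t}.Finite

theorem LocallyFinite.off {K : PreAbstractSimplicialComplex V} (h : LocallyFinite K)
    (L : PreAbstractSimplicialComplex V) : LocallyFiniteOff K L := by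
  intro s hs _
  obtain ⟨v, hv⟩ := (K.isRelLowerSet_faces hs).1
  exact (h v).subset fun t ht => ⟨ht.1, ht.2 hv⟩

/-- The points of the geometric realization of `K`, in barycentric coordinates. -/
def Realization (K : PreAbstractSimplicialComplex V) : Type u :=
  {x : V →₀ ℝ // (∀ v, 0 ≤ x v) ∧ x.support ∈ K.faces ∧ (x.sum fun _ a => a) = 1}

/-- The closed simplex of the realization spanned by the vertices in `s`. -/
def Cell (K : PreAbstractSimplicialComplex V) (s : Finset V) : Type u :=
  {x : Realization K // x.1.support ⊆ s}

/-- A closed simplex carries its Euclidean topology, given by the barycentric coordinates. -/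
instance (K : PreAbstractSimplicialComplex V) (s : Finset V) : TopologicalSpace (Cell K s) :=
  TopologicalSpace.induced (fun x (v : V) => x.1.1 v) inferInstance

/-- The weak topology: a set is open iff it meets each closed simplex in an open set. -/
instance (K : PreAbstractSimplicialComplex V) : TopologicalSpace (Realization K) :=
  ⨆ s : K.faces, TopologicalSpace.coinduced (fun x : Cell K s.1 => x.1) inferInstance

/-- The space underlying `K` minus the space underlying the subcomplex `L`, as a subspace of the
realization of `K`. -/
abbrev Complement (K L : PreAbstractSimplicialComplex V) : Type u :=
  {x : Realization K // x.1.support ∉ L.faces}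

variable (R : Type w) [CommRing R]

open Classical in
/-- Relative simplicial `k`-cochains of `(K, L)` with compact support. A cochain is a function of
oriented simplices, that is, a function of tuples `v` of distinct vertices spanning a simplex of
`K` which is multiplied by the sign under a permutation (it is extended by zero to all other
tuples); it vanishes on the simplices of `L` and is nonzero on only finitely many simplices. -/
def cochain (K L : PreAbstractSimplicialComplex V) (k : ℕ) :
    Submodule R ((Fin (k + 1) → V) → R) where
  carrier := {φ | (∀ (v : Fin (k + 1) → V) (π : Equiv.Perm (Fin (k + 1))),
        φ (v ∘ π) = ((Equiv.Perm.sign π : ℤ) : R) * φ v) ∧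
      (∀ v, φ v ≠ 0 → Function.Injective v ∧ Finset.univ.image v ∈ K.faces ∧
        Finset.univ.image v ∉ L.faces) ∧
      {v | φ v ≠ 0}.Finite}
  zero_mem' := by simp
  add_mem' := by
    rintro φ ψ ⟨h1, h2, h3⟩ ⟨h1', h2', h3'⟩
    have key : ∀ v, (φ + ψ) v ≠ 0 → φ v ≠ 0 ∨ ψ v ≠ 0 := by
      intro v hv
      by_contra! h
      exact hv (by simp [h.1, h.2])
    refine ⟨fun v π => by simp [h1, h1', mul_add], fun v hv => ?_, ?_⟩
    · exact (key v hv).elim (h2 v) (h2' v)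
    · exact (h3.union h3').subset key
  smul_mem' := by
    rintro c φ ⟨h1, h2, h3⟩
    have key : ∀ v, (c • φ) v ≠ 0 → φ v ≠ 0 := by
      intro v hv h
      exact hv (by simp [h])
    refine ⟨fun v π => by simp [h1, mul_left_comm], fun v hv => h2 v (key v hv), h3.subset key⟩

/-- The alternating sum of the values of a cochain on the codimension one faces. -/
def faceSum {k : ℕ} (φ : (Fin (k + 1) → V) → R) (v : Fin (k + 2) → V) : R :=
  ∑ i : Fin (k + 2), (-1 : R) ^ (i : ℕ) * φ (v ∘ i.succAbove)

open Classical in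
/-- The simplicial coboundary of a cochain on `K`, as a function on tuples. -/
noncomputable def coboundaryFun (K : PreAbstractSimplicialComplex V) {k : ℕ} (φ : (Fin (k + 1) → V) → R)
    (v : Fin (k + 2) → V) : R :=
  if Function.Injective v ∧ Finset.univ.image v ∈ K.faces then faceSum R φ v else 0

variable {R}

theorem exists_perm_succAbove {n : ℕ} (π : Equiv.Perm (Fin (n + 1))) (i : Fin (n + 1)) :
    ∃ e : Equiv.Perm (Fin n), (∀ j, π (i.succAbove j) = (π i).succAbove (e j)) ∧
      (-1 : ℤ) ^ (i : ℕ) * (Equiv.Perm.sign e : ℤ) =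
        (Equiv.Perm.sign π : ℤ) * (-1) ^ ((π i : Fin (n + 1)) : ℕ) := by
  set τ : Equiv.Perm (Fin (n + 1)) := (π i).cycleRange * π * (i.cycleRange)⁻¹ with hτ
  obtain ⟨⟨p, e⟩, hpe⟩ := Equiv.Perm.decomposeFin.symm.surjective τ
  have h0 : τ 0 = 0 := by
    have : (i.cycleRange)⁻¹ 0 = i := Fin.cycleRange_symm_zero i
    rw [hτ, Equiv.Perm.mul_apply, Equiv.Perm.mul_apply, this, Fin.cycleRange_self]
  have hp : p = 0 := by
    rw [← Equiv.Perm.decomposeFin_symm_apply_zero p e, hpe, h0]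
  subst hp
  refine ⟨e, fun j => ?_, ?_⟩
  · have h1 : τ j.succ = (e j).succ := by
      rw [← hpe, Equiv.Perm.decomposeFin_symm_apply_succ]
      simp
    have h2 : (i.cycleRange)⁻¹ j.succ = i.succAbove j := Fin.cycleRange_symm_succ i j
    have h3 : (π i).cycleRange (π (i.succAbove j)) = (e j).succ := by
      rw [← h1, hτ, Equiv.Perm.mul_apply, Equiv.Perm.mul_apply, h2]
    apply (π i).cycleRange.injective
    rw [h3, Fin.cycleRange_succAbove]
  · have hs : Equiv.Perm.sign τ = Equiv.Perm.sign e := by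
      rw [← hpe, Equiv.Perm.decomposeFin.symm_sign]
      simp
    rw [← hs, hτ]
    simp only [Equiv.Perm.sign_mul, Equiv.Perm.sign_inv, Fin.sign_cycleRange]
    push_cast
    have : (-1 : ℤ) ^ (i : ℕ) * (-1) ^ (i : ℕ) = 1 := by
      rw [← mul_pow]
      simp
    linear_combination ((-1 : ℤ) ^ ((π i : Fin (n + 1)) : ℕ) * (Equiv.Perm.sign π : ℤ)) * this

theorem faceSum_perm {k : ℕ} {φ : (Fin (k + 1) → V) → R}
    (h : ∀ (v : Fin (k + 1) → V) (π : Equiv.Perm (Fin (k + 1))),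
      φ (v ∘ π) = ((Equiv.Perm.sign π : ℤ) : R) * φ v)
    (v : Fin (k + 2) → V) (π : Equiv.Perm (Fin (k + 2))) :
    faceSum R φ (v ∘ π) = ((Equiv.Perm.sign π : ℤ) : R) * faceSum R φ v := by
  unfold faceSum
  rw [Finset.mul_sum, ← Equiv.sum_comp π (fun i => ((Equiv.Perm.sign π : ℤ) : R) *
    ((-1 : R) ^ (i : ℕ) * φ (v ∘ i.succAbove)))]
  refine Finset.sum_congr rfl fun i _ => ?_
  obtain ⟨e, he, hs⟩ := exists_perm_succAbove π i
  have h1 : (v ∘ π) ∘ i.succAbove = (v ∘ (π i).succAbove) ∘ e := by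
    funext j
    simp [he j]
  rw [h1, h, ← mul_assoc, ← mul_assoc]
  congr 1
  exact_mod_cast congrArg (Int.cast : ℤ → R) hs

theorem faceSum_faceSum {k : ℕ} (φ : (Fin (k + 1) → V) → R) (v : Fin (k + 3) → V) :
    faceSum R (faceSum R φ) v = 0 := by
  unfold faceSum
  simp only [Finset.mul_sum]
  rw [← Finset.sum_product', Finset.univ_product_univ]
  have sgn : ∀ x : Fin (k + 3) × Fin (k + 2),
      (-1 : R) ^ ((x.1.succAbove x.2 : Fin (k + 3)) : ℕ) *
        (-1) ^ ((x.2.predAbove x.1 : Fin (k + 2)) : ℕ) =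
      - ((-1) ^ (x.1 : ℕ) * (-1) ^ (x.2 : ℕ)) := by
    rintro ⟨i, j⟩
    rcases lt_or_ge j.castSucc i with hij | hij
    · have hi : i ≠ 0 := Fin.ne_zero_of_lt hij
      rw [Fin.succAbove_of_castSucc_lt _ _ hij, Fin.predAbove_of_castSucc_lt _ _ hij]
      obtain ⟨m, rfl⟩ := Fin.exists_succ_eq.mpr hi
      simp [pow_succ]
      ring
    · rw [Fin.succAbove_of_le_castSucc _ _ hij, Fin.predAbove_of_le_castSucc _ _ hij]
      simp [pow_succ]
      ring
  have comp : ∀ x : Fin (k + 3) × Fin (k + 2),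
      (v ∘ (x.1.succAbove x.2).succAbove) ∘ (x.2.predAbove x.1).succAbove =
        (v ∘ x.1.succAbove) ∘ x.2.succAbove := by
    rintro ⟨i, j⟩
    funext l
    simp [Fin.succAbove_succAbove_succAbove_predAbove]
  refine Finset.sum_involution
    (fun x _ => (x.1.succAbove x.2, x.2.predAbove x.1)) ?_ ?_ ?_ ?_
  · intro x _
    have h1 := sgn x
    have h2 := comp x
    simp only [] at h1 h2 ⊢
    rw [h2, ← mul_assoc, ← mul_assoc, h1]
    ring
  · intro x _ _ hx
    exact Fin.succAbove_ne x.1 x.2 (congrArg Prod.fst hx)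
  · intro x _
    exact Finset.mem_univ _
  · rintro ⟨i, j⟩ _
    simp [Fin.succAbove_succAbove_predAbove, Fin.predAbove_predAbove_succAbove]

open Classical in
theorem image_comp_succAbove_subset {k : ℕ} (v : Fin (k + 2) → V) (i : Fin (k + 2)) :
    Finset.univ.image (v ∘ i.succAbove) ⊆ Finset.univ.image v := by
  intro a ha
  obtain ⟨j, -, rfl⟩ := Finset.mem_image.mp ha
  exact Finset.mem_image_of_mem v (Finset.mem_univ _)

theorem coboundaryFun_perm (K : PreAbstractSimplicialComplex V) {k : ℕ}
    {φ : (Fin (k + 1) → V) → R}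
    (h : ∀ (v : Fin (k + 1) → V) (π : Equiv.Perm (Fin (k + 1))),
      φ (v ∘ π) = ((Equiv.Perm.sign π : ℤ) : R) * φ v)
    (v : Fin (k + 2) → V) (π : Equiv.Perm (Fin (k + 2))) :
    coboundaryFun R K φ (v ∘ π) = ((Equiv.Perm.sign π : ℤ) : R) * coboundaryFun R K φ v := by
  classical
  have h1 : Function.Injective (v ∘ π) ↔ Function.Injective v :=
    Function.Injective.of_comp_iff' v π.bijective
  have h2 : Finset.univ.image (v ∘ π) = Finset.univ.image v := by
    rw [← Finset.image_image, Finset.image_univ_of_surjective π.surjective]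
  unfold coboundaryFun
  simp only [h1, faceSum_perm h]
  split_ifs with h3 h4 h4
  · rfl
  · exact absurd ⟨h3.1, by convert h3.2 using 1; rw [← h2]⟩ h4
  · exact absurd ⟨h4.1, by convert h4.2 using 1⟩ h3
  · simp

theorem coboundaryFun_mem {K L : PreAbstractSimplicialComplex V} (hKL : LocallyFiniteOff K L)
    {k : ℕ} {φ : (Fin (k + 1) → V) → R} (hφ : φ ∈ cochain R K L k) :
    coboundaryFun R K φ ∈ cochain R K L (k + 1) := by
  classical
  obtain ⟨h1, h2, h3⟩ := hφ
  have key : ∀ v, coboundaryFun R K φ v ≠ 0 →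
      (Function.Injective v ∧ Finset.univ.image v ∈ K.faces) ∧
        ∃ i : Fin (k + 2), φ (v ∘ i.succAbove) ≠ 0 := by
    intro v hv
    unfold coboundaryFun at hv
    split_ifs at hv with hc
    · refine ⟨⟨hc.1, by convert hc.2⟩, ?_⟩
      by_contra! h
      exact hv (Finset.sum_eq_zero fun i _ => by rw [h i, mul_zero])
    · exact absurd rfl hv
  refine ⟨coboundaryFun_perm K h1, ?_, ?_⟩
  · intro v hv
    obtain ⟨⟨ha, hb⟩, i, hi⟩ := key v hv
    refine ⟨ha, by convert hb, fun hL => ?_⟩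
    refine (h2 _ hi).2.2 ?_
    have hsub : Finset.univ.image (v ∘ i.succAbove) ∈ L.faces :=
      (L.isRelLowerSet_faces hL).2 (by convert image_comp_succAbove_subset v i) (by simp)
    convert hsub
  · have hfin : (⋃ u ∈ {u | φ u ≠ 0}, ⋃ t ∈ {t ∈ K.faces | Finset.univ.image u ⊆ t},
        {v : Fin (k + 2) → V | ∀ j, v j ∈ t}).Finite := by
      refine h3.biUnion fun u hu => ?_
      refine Set.Finite.biUnion ?_ fun t _ => ?_
      · have := h2 u hu
        exact hKL _ (by convert this.2.1) (by convert this.2.2)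
      · exact Set.Finite.pi' fun _ => t.finite_toSet
    refine hfin.subset fun v hv => ?_
    obtain ⟨⟨ha, hb⟩, i, hi⟩ := key v hv
    simp only [Set.mem_iUnion]
    exact ⟨v ∘ i.succAbove, hi, Finset.univ.image v, ⟨hb, image_comp_succAbove_subset v i⟩,
      fun j => Finset.mem_image_of_mem v (Finset.mem_univ j)⟩

theorem coboundaryFun_coboundaryFun (K : PreAbstractSimplicialComplex V) {k : ℕ}
    (φ : (Fin (k + 1) → V) → R) : coboundaryFun R K (coboundaryFun R K φ) = 0 := by
  classical
  funext v
  by_cases hv : Function.Injective v ∧ Finset.univ.image v ∈ K.faces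
  · have h : ∀ i : Fin (k + 3),
        coboundaryFun R K φ (v ∘ i.succAbove) = faceSum R φ (v ∘ i.succAbove) := by
      intro i
      have hsub : Finset.univ.image (v ∘ i.succAbove) ∈ K.faces :=
        (K.isRelLowerSet_faces hv.2).2 (by convert image_comp_succAbove_subset v i) (by simp)
      exact if_pos ⟨hv.1.comp Fin.succAbove_right_injective, by convert hsub⟩
    have h1 : coboundaryFun R K (coboundaryFun R K φ) v = faceSum R (coboundaryFun R K φ) v :=
      if_pos ⟨hv.1, by convert hv.2⟩
    rw [h1, Pi.zero_apply, ← faceSum_faceSum φ v]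
    refine Finset.sum_congr rfl fun i _ => ?_
    rw [h i]
  · exact if_neg fun h => hv ⟨h.1, by convert h.2⟩

variable (R)

/-- The simplicial coboundary `δ : C_c^k(K, L) → C_c^{k+1}(K, L)`. -/
noncomputable def coboundary {K L : PreAbstractSimplicialComplex V} (hKL : LocallyFiniteOff K L)
    (k : ℕ) : cochain R K L k →ₗ[R] cochain R K L (k + 1) where
  toFun φ := ⟨coboundaryFun R K φ.1, coboundaryFun_mem hKL φ.2⟩
  map_add' φ ψ := by
    apply Subtype.ext
    funext v
    simp only [coboundaryFun, faceSum, Submodule.coe_add, Pi.add_apply]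
    split_ifs
    · simp [mul_add, Finset.sum_add_distrib]
    · simp
  map_smul' c φ := by
    apply Subtype.ext
    funext v
    simp only [coboundaryFun, faceSum, Submodule.coe_smul, Pi.smul_apply, RingHom.id_apply,
      smul_eq_mul]
    split_ifs
    · simp [Finset.mul_sum, mul_left_comm]
    · simp

open CategoryTheory in
/-- The complex `C_c^•(K, L)` of relative simplicial cochains with compact support, with
coefficients in `R`, for a pair that is locally finite outside `L`. -/
noncomputable def cochainComplex {K L : PreAbstractSimplicialComplex V}
    (hKL : LocallyFiniteOff K L) : CochainComplex (ModuleCat.{max u w} R) ℕ :=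
  CochainComplex.of (fun k => ModuleCat.of R (cochain R K L k))
    (fun k => ModuleCat.ofHom (coboundary R hKL k))
    (fun k => by
      apply ModuleCat.hom_ext
      apply LinearMap.ext
      intro φ
      apply Subtype.ext
      exact coboundaryFun_coboundaryFun K φ.1)

end Simplicial

section Fans

variable {U : Type u} [NormedAddCommGroup U] [NormedSpace ℝ U]

/-- The closure of the (nonempty) cone `C`. -/
def closedCone (C : ConvexCone ℝ U) : PointedCone ℝ U :=
  (PointedCone.hull ℝ (C : Set U)).closure

/-- `B` is a face of the closure of `C` whose linear span is defined over `ℚ`, where the rational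
structure of `U` is given by the lattice `Λ`. -/
def IsRationalFace (Λ : Submodule ℤ U) (C : ConvexCone ℝ U) (B : PointedCone ℝ U) : Prop :=
  B.IsFaceOf (closedCone C) ∧
    Submodule.span ℝ (B : Set U) =
      Submodule.span ℝ {x : U | x ∈ Λ ∧ x ∈ Submodule.span ℝ (B : Set U)}

/-- `C^*`, the union of `C` and its rational boundary components (including `{0}`): these are the
relative interiors of the rational faces of the closure of `C`. -/
def rationalClosure (Λ : Submodule ℤ U) (C : ConvexCone ℝ U) : Set U :=
  ⋃ B ∈ {B : PointedCone ℝ U | IsRationalFace Λ C B}, intrinsicInterior ℝ (B : Set U)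

/-- The image of a cone under a linear automorphism. -/
def act (γ : U ≃ₗ[ℝ] U) (σ : PointedCone ℝ U) : PointedCone ℝ U :=
  σ.map (γ : U →ₗ[ℝ] U)

/-- A group of linear automorphisms is neat if for each of its elements the subgroup of `ℂˣ`
generated by the complex eigenvalues is torsion free. -/
def IsNeat [FiniteDimensional ℝ U] (Γ : Subgroup (U ≃ₗ[ℝ] U)) : Prop :=
  ∀ γ ∈ Γ, ∀ z ∈ Subgroup.closure
      {w : ℂˣ | (w : ℂ) ∈ ((γ : U →ₗ[ℝ] U).charpoly.map (algebraMap ℝ ℂ)).roots},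
    IsOfFinOrder z → z = 1

/-- `S` is a `Γ`-admissible decomposition of `C^*` into rational polyhedral cones. -/
structure IsAdmissible (Λ : Submodule ℤ U) (C : ConvexCone ℝ U) (Γ : Subgroup (U ≃ₗ[ℝ] U))
    (S : Set (PointedCone ℝ U)) : Prop where
  polyhedral : ∀ σ ∈ S, ∃ s : Finset U, (∀ x ∈ s, x ∈ Λ) ∧ σ = PointedCone.hull ℝ (s : Set U)
  face_mem : ∀ σ ∈ S, ∀ τ : PointedCone ℝ U, τ.IsFaceOf σ → τ ∈ S
  inf_isFaceOf : ∀ σ ∈ S, ∀ τ ∈ S, (σ ⊓ τ).IsFaceOf σ ∧ (σ ⊓ τ).IsFaceOf τ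
  act_mem : ∀ γ ∈ Γ, ∀ σ ∈ S, act γ σ ∈ S
  finite_orbits : ∃ T : Set (PointedCone ℝ U), T.Finite ∧ T ⊆ S ∧
    ∀ σ ∈ S, ∃ τ ∈ T, ∃ γ ∈ Γ, σ = act γ τ
  union_eq : ⋃ σ ∈ S, (σ : Set U) = rationalClosure Λ C

/-- A ray, i.e. a one-dimensional pointed cone `ℝ_{≥ 0} v`. -/
def IsRay (ρ : PointedCone ℝ U) : Prop :=
  ∃ v : U, v ≠ 0 ∧ ρ = PointedCone.hull ℝ {v}

/-- The subfan of cones contained in the boundary, i.e. disjoint from `C`. -/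
def boundaryFan (C : ConvexCone ℝ U) (S : Set (PointedCone ℝ U)) : Set (PointedCone ℝ U) :=
  {σ ∈ S | Disjoint (σ : Set U) (C : Set U)}

/-- The projectivization of a fan of simplicial cones. The vertices are the rays of the fan, and
finitely many rays span a simplex iff they lie in a common cone of the fan (for a fan of simplicial
cones, this says that they are the rays of a cone of the fan). -/
def projectivization (S : Set (PointedCone ℝ U)) :
    PreAbstractSimplicialComplex (PointedCone ℝ U) where
  faces := {s | s.Nonempty ∧ (∀ ρ ∈ s, ρ ∈ S ∧ IsRay ρ) ∧ ∃ σ ∈ S, ∀ ρ ∈ s, ρ ≤ σ}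
  isRelLowerSet_faces := fun _ hs =>
    ⟨hs.1, fun _ hle hne =>
      ⟨hne, fun ρ hρ => hs.2.1 ρ (hle hρ),
        hs.2.2.imp fun _ hσ => ⟨hσ.1, fun ρ hρ => hσ.2 ρ (hle hρ)⟩⟩⟩

open Classical in
/-- The action of `Γ` on simplices, i.e. on vertices of the barycentric subdivision. -/
noncomputable def actSimplex (γ : U ≃ₗ[ℝ] U) (s : Finset (PointedCone ℝ U)) :
    Finset (PointedCone ℝ U) :=
  s.image (act γ)

open Classical in
/-- A subcomplex of the barycentric subdivision is `Γ`-invariant. -/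
def IsInvariant (Γ : Subgroup (U ≃ₗ[ℝ] U))
    (K : PreAbstractSimplicialComplex (Finset (PointedCone ℝ U))) : Prop :=
  ∀ γ ∈ Γ, K.map (actSimplex γ) = K

end Fans

end ConeRetraction

/-! Write `Δ` for the complex and `Δ₀` for its boundary. Everything rests on two facts about this
pair. First, `Δ₀` is a full subcomplex: boundary rays lying in one cone `σ` lie in a proper rational
face `B` by condition 2, hence in the face `σ ⊓ B` of `σ`, which misses the open cone `C`
(`IsAdmissible.mem_boundary_of_vertices`). Second, `Δ` is locally finite outside `Δ₀`. By fullness a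
simplex not in `Δ₀` has a vertex whose ray meets `C`. Condition 1 shows that two cones of the same
`Γ`-orbit containing this ray differ by an element stabilizing it. Such an element fixes a lattice
generator of the ray, so it fixes a point of `C`, and only finitely many lattice automorphisms of
`C` do that (`finite_stabilizer`, `IsAdmissible.finite_cones_ge`).

The rest is combinatorial topology of a pair `(K, L)` with `L` full and `K` locally finite off `L`.
`retract K L` consists of the flags of simplices outside `L`, and `retractBoundary K L` of those
flags all of whose members have a vertex in `L`. Local finiteness and invariance are direct.

Homeomorphism. A point of the subdivision is sent to `∑ y_s e_s`, where `e_s` is the sum, not the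
average, of the vertices of `s`. With this scaling the total weight is the largest coordinate, and
the weights are recovered as gaps between consecutive coordinate values
(`IsFlagPoint.levels_expand`, `exists_expand_eq`). On `retract K L` the largest coordinate off `L`
is 1 and the largest on `L` is `1 - q`, with `q` the weight of the flag members having no vertex in
`L`; `q > 0` says exactly that the point is off `retractBoundary K L`. Dividing the `L`-coordinates
by `q` stretches `[0, 1)` to `[0, ∞)` through `(1 - q) / q` and thus fills out the complement of
`L`. Radial rescaling gives `complementHomeomorph`.

Quasi-isomorphism. The dual of barycentric subdivision maps cochains of `(retract K L,
retractBoundary K L)` to cochains of `(K, L)`. Its homotopy inverse is pullback along a vertex map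
`g` that sends a simplex to one of its vertices, chosen in `L` whenever possible. Both composites
are homotopic to the identity by the acyclic carrier method: the homotopy is written down by coning
(`coneHomotopy`) on arbitrary functions of tuples, where the identities are formal. `IsCarried`
collects the support conditions ensuring that these homotopies respect vanishing on the subcomplex
and finiteness of support (`isCarried_retract`, `isCarried_original`, `exists_quasiIso_retract`). -/

namespace ConeRetraction

/-! ### Rays and faces of pointed cones. -/

section Rays

variable {U : Type*} [AddCommGroup U] [Module ℝ U]

theorem mem_hull_singleton {v x : U} :
    x ∈ PointedCone.hull ℝ {v} ↔ ∃ c : ℝ, 0 ≤ c ∧ c • v = x := by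
  rw [Submodule.mem_span_singleton]
  exact ⟨fun ⟨a, h⟩ => ⟨a, a.2, h⟩, fun ⟨c, hc, h⟩ => ⟨⟨c, hc⟩, h⟩⟩

theorem hull_singleton_eq_of_mem {v x : U} (hx : x ∈ PointedCone.hull ℝ {v}) (hx0 : x ≠ 0) :
    PointedCone.hull ℝ {v} = PointedCone.hull ℝ {x} := by
  obtain ⟨c, hc, rfl⟩ := mem_hull_singleton.mp hx
  have hc0 : c ≠ 0 := fun h => hx0 (by rw [h, zero_smul])
  apply le_antisymm <;> rw [Submodule.span_le, Set.singleton_subset_iff]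
  · exact mem_hull_singleton.mpr ⟨c⁻¹, inv_nonneg.mpr hc, inv_smul_smul₀ hc0 v⟩
  · exact hx

/-- In an expression of `v` as a nonnegative combination of the generators, a face contains every
summand of each of its elements; any nonzero summand spans the ray. -/
theorem exists_generator_of_isFaceOf_hull {v : U} (hv : v ≠ 0) {s : Finset U}
    (h : (PointedCone.hull ℝ {v}).IsFaceOf (PointedCone.hull ℝ (s : Set U))) :
    ∃ w ∈ s, w ≠ 0 ∧ PointedCone.hull ℝ {v} = PointedCone.hull ℝ {w} := by
  classical
  have hvs : v ∈ PointedCone.hull ℝ (s : Set U) := h.le (PointedCone.subset_hull rfl)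
  obtain ⟨c, hcs, hc0, hcv⟩ := PointedCone.mem_hull_set.mp hvs
  have hex : ∃ m ∈ c.support, c m • m ≠ 0 := by
    by_contra! hcon
    exact hv (by rw [← hcv]; exact Finset.sum_eq_zero hcon)
  obtain ⟨m, hm, hm0⟩ := hex
  have hcm : 0 < c m := lt_of_le_of_ne (hc0 m) fun h => hm0 (by rw [← h, zero_smul])
  have hm1 : m ≠ 0 := fun h => hm0 (by rw [h, smul_zero])
  refine ⟨m, hcs hm, hm1, hull_singleton_eq_of_mem ?_ hm1⟩
  refine h.mem_of_smul_add_mem (y := ∑ x ∈ c.support.erase m, c x • x)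
    (PointedCone.subset_hull (hcs hm)) ?_ hcm ?_
  · exact Submodule.sum_mem _ fun x hx => PointedCone.smul_mem _ (hc0 x)
      (PointedCone.subset_hull (hcs (Finset.mem_of_mem_erase hx)))
  · rw [Finset.add_sum_erase _ (fun x => c x • x) hm]
    exact hcv ▸ PointedCone.subset_hull rfl

/-- An element of the span is a difference `a - b` of elements of `F`, so `x + b = a` is a
decomposition inside `K` of a point of the face. -/
theorem IsFaceOf.mem_of_mem_span {F K : PointedCone ℝ U} (h : F.IsFaceOf K) {x : U} (hx : x ∈ K)
    (hs : x ∈ Submodule.span ℝ (F : Set U)) : x ∈ F := by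
  have key : ∀ y ∈ Submodule.span ℝ (F : Set U), ∃ a ∈ F, ∃ b ∈ F, y + b = a := by
    intro y hy
    induction hy using Submodule.span_induction with
    | mem y hy => exact ⟨y, hy, 0, F.zero_mem, add_zero y⟩
    | zero => exact ⟨0, F.zero_mem, 0, F.zero_mem, add_zero 0⟩
    | add y z _ _ hy hz =>
      obtain ⟨a, ha, b, hb, hab⟩ := hy
      obtain ⟨a', ha', b', hb', hab'⟩ := hz
      exact ⟨a + a', F.add_mem ha ha', b + b', F.add_mem hb hb', by
        rw [← hab, ← hab']; abel⟩
    | smul c y _ hy =>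
      obtain ⟨a, ha, b, hb, hab⟩ := hy
      rcases le_total 0 c with hc | hc
      · exact ⟨c • a, F.smul_mem hc ha, c • b, F.smul_mem hc hb, by rw [← hab, smul_add]⟩
      · have hc' : 0 ≤ -c := neg_nonneg.mpr hc
        exact ⟨(-c) • b, F.smul_mem hc' hb, (-c) • a, F.smul_mem hc' ha, by
          rw [← hab, smul_add]; module⟩
  obtain ⟨a, ha, b, hb, hab⟩ := key x hs
  exact h.mem_of_add_mem_left hx (h.le hb) (hab ▸ ha)

end Rays

/-! ### Lattice automorphisms of an open salient cone. -/

section Stabilizer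

variable {U : Type*} [NormedAddCommGroup U] [NormedSpace ℝ U]

/-- Along an unbounded sequence `z n`, the vectors `(w ± z n) / ‖z n‖` accumulate at `u` and `-u`
with `‖u‖ = 1`, which a salient closure forbids. -/
theorem isBounded_order_interval [FiniteDimensional ℝ U] (C : ConvexCone ℝ U)
    (hCsal : ∀ x ∈ closure (C : Set U), -x ∈ closure (C : Set U) → x = 0) (w : U) :
    Bornology.IsBounded {z : U | w + z ∈ closure (C : Set U) ∧ w - z ∈ closure (C : Set U)} := by
  by_contra hb
  have h1 : ∀ n : ℕ, ∃ z : U, (w + z ∈ closure (C : Set U) ∧ w - z ∈ closure (C : Set U)) ∧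
      (n : ℝ) + 1 < ‖z‖ := by
    intro n
    by_contra! hcon
    exact hb (isBounded_iff_forall_norm_le.mpr ⟨(n : ℝ) + 1, fun z hz => hcon z hz⟩)
  choose z hz hzn using h1
  have hz0 : ∀ n, 0 < ‖z n‖ := fun n => lt_trans (by positivity) (hzn n)
  have hsph : ∀ n, ‖z n‖⁻¹ • z n ∈ Metric.sphere (0 : U) 1 := by
    intro n
    rw [mem_sphere_zero_iff_norm, norm_smul, norm_inv, norm_norm, inv_mul_cancel₀ (hz0 n).ne']
  have hprop : ProperSpace U := FiniteDimensional.proper ℝ U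
  obtain ⟨u, hu, φ, hφ, hlim⟩ := (isCompact_sphere (0 : U) 1).tendsto_subseq hsph
  have hinv : Filter.Tendsto (fun n => ‖z (φ n)‖⁻¹ • w) Filter.atTop (nhds (0 : U)) := by
    have h2 : Filter.Tendsto (fun n => ‖z n‖) Filter.atTop Filter.atTop :=
      Filter.tendsto_atTop_mono (fun n => (le_of_lt (lt_trans (lt_add_one _) (hzn n))))
        tendsto_natCast_atTop_atTop
    have h3 := (tendsto_inv_atTop_zero.comp (h2.comp hφ.tendsto_atTop)).smul_const w
    simpa using h3
  have hmem : ∀ (x : U) (c : ℝ), 0 < c → x ∈ closure (C : Set U) → c • x ∈ closure (C : Set U) :=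
    fun x c hc hx => (C.closure).smul_mem hc hx
  have hpos : u ∈ closure (C : Set U) := by
    have h4 := hinv.add hlim
    rw [zero_add] at h4
    refine isClosed_closure.mem_of_tendsto h4 (Filter.Eventually.of_forall fun n => ?_)
    have := hmem _ _ (inv_pos.mpr (hz0 (φ n))) (hz (φ n)).1
    simpa [smul_add] using this
  have hneg : -u ∈ closure (C : Set U) := by
    have h4 := hinv.sub hlim
    rw [zero_sub] at h4
    refine isClosed_closure.mem_of_tendsto h4 (Filter.Eventually.of_forall fun n => ?_)
    have := hmem _ _ (inv_pos.mpr (hz0 (φ n))) (hz (φ n)).2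
    simpa [smul_sub] using this
  have := hCsal u hpos hneg
  simp [this] at hu

theorem finite_lattice_inter [FiniteDimensional ℝ U] (Λ : Submodule ℤ U) [DiscreteTopology Λ]
    {Q : Set U} (hQ : Bornology.IsBounded Q) : (Q ∩ (Λ : Set U)).Finite := by
  have hprop : ProperSpace U := FiniteDimensional.proper ℝ U
  have : DiscreteTopology (Λ.toAddSubgroup : Set U) := ‹DiscreteTopology Λ›
  have hcl : IsClosed (Λ.toAddSubgroup : Set U) := AddSubgroup.isClosed_of_discrete
  exact Metric.finite_isBounded_inter_isClosed this.isDiscrete hQ hcl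

-- For a lattice basis vector `b` and small `c > 0`, both `w ± c b` lie in `C`. Hence `γ (c b)` lies
-- in the bounded order interval around `w`, so `γ b` takes finitely many lattice values, and `γ` is
-- determined by its values on the basis.
open scoped Pointwise in
theorem finite_stabilizer [FiniteDimensional ℝ U] (Λ : Submodule ℤ U) [DiscreteTopology Λ]
    [IsZLattice ℝ Λ] (C : ConvexCone ℝ U) (hCopen : IsOpen (C : Set U))
    (hCsal : ∀ x ∈ closure (C : Set U), -x ∈ closure (C : Set U) → x = 0) {w : U} (hw : w ∈ C) :
    {γ : U ≃ₗ[ℝ] U | γ '' (C : Set U) = C ∧ γ '' (Λ : Set U) = Λ ∧ γ w = w}.Finite := by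
  classical
  set Q := {z : U | w + z ∈ closure (C : Set U) ∧ w - z ∈ closure (C : Set U)} with hQ
  obtain ⟨ε, hε, hball⟩ := Metric.isOpen_iff.mp hCopen w hw
  have hfree : Module.Free ℤ Λ := ZLattice.module_free ℝ Λ
  have hfin : Module.Finite ℤ Λ := ZLattice.module_finite ℝ Λ
  let b := Module.Free.chooseBasis ℤ Λ
  let B := b.ofZLatticeBasis ℝ Λ
  have hB : ∀ i, B i = (b i : U) := fun i => b.ofZLatticeBasis_apply ℝ Λ i
  have hc : ∀ x : U, ∃ c : ℝ, 0 < c ∧ ‖c • x‖ < ε := fun x =>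
    ⟨ε / (‖x‖ + 1), by positivity, by
      rw [norm_smul, Real.norm_of_nonneg (by positivity), div_mul_eq_mul_div,
        div_lt_iff₀ (by positivity)]
      exact mul_lt_mul_of_pos_left (lt_add_one _) hε⟩
  choose c hc0 hcε using hc
  have hfinset : ∀ i, (((c (B i))⁻¹ • Q) ∩ (Λ : Set U)).Finite := fun i =>
    finite_lattice_inter Λ ((isBounded_order_interval C hCsal w).smul₀ _)
  have hinj : Function.Injective
      (fun (γ : U ≃ₗ[ℝ] U) (i : Module.Free.ChooseBasisIndex ℤ Λ) => γ (B i)) := by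
    intro γ γ' h
    exact LinearEquiv.toLinearMap_injective (B.ext fun i => congrFun h i)
  refine Set.Finite.of_finite_image (f := fun γ i => γ (B i)) ?_ hinj.injOn
  refine (Set.Finite.pi' hfinset).subset ?_
  rintro _ ⟨γ, ⟨hγC, hγΛ, hγw⟩, rfl⟩ i
  have hC : ∀ x ∈ C, γ x ∈ C := fun x hx => by
    have : γ x ∈ γ '' (C : Set U) := ⟨x, hx, rfl⟩
    rwa [hγC] at this
  refine ⟨?_, ?_⟩
  · refine ⟨γ (c (B i) • B i), ⟨?_, ?_⟩, ?_⟩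
    · refine subset_closure ?_
      have := hC (w + c (B i) • B i) (hball (by simpa using hcε (B i)))
      rwa [map_add, hγw] at this
    · refine subset_closure ?_
      have := hC (w - c (B i) • B i) (hball (by simpa using hcε (B i)))
      rwa [map_sub, hγw] at this
    · simp [inv_smul_smul₀ (hc0 (B i)).ne']
  · have : γ (B i) ∈ γ '' (Λ : Set U) := ⟨B i, by rw [hB]; exact (b i).2, rfl⟩
    rwa [hγΛ] at this

/-- If `c ≠ 1`, the iterates of `γ` or of its inverse shrink `w` through infinitely many distinct
lattice points of one ball. -/
theorem eq_one_of_lattice_smul [FiniteDimensional ℝ U] (Λ : Submodule ℤ U) [DiscreteTopology Λ]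
    {γ : U ≃ₗ[ℝ] U} (hγ : γ '' (Λ : Set U) = Λ) {w : U} (hw : w ∈ Λ) (hw0 : w ≠ 0) {c : ℝ}
    (hc : 0 < c) (h : γ w = c • w) : c = 1 := by
  have key : ∀ d : ℝ, 0 < d → d < 1 → ¬ ∀ n : ℕ, d ^ n • w ∈ Λ := by
    intro d hd hd1 hcon
    have hfin := finite_lattice_inter Λ (Metric.isBounded_closedBall (x := (0 : U)) (r := ‖w‖))
    refine Set.infinite_of_injective_forall_mem (f := fun n : ℕ => d ^ n • w) ?_ ?_ hfin
    · intro m n hmn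
      exact (pow_right_strictAnti₀ hd hd1).injective (smul_left_injective ℝ hw0 hmn)
    · refine fun n => ⟨?_, hcon n⟩
      rw [mem_closedBall_zero_iff, norm_smul, norm_pow, Real.norm_of_nonneg hd.le]
      exact mul_le_of_le_one_left (norm_nonneg _) (pow_le_one₀ hd.le hd1.le)
  have h1 : ∀ x ∈ Λ, γ x ∈ Λ := fun x hx => by
    have : γ x ∈ γ '' (Λ : Set U) := ⟨x, hx, rfl⟩
    rwa [hγ] at this
  have h2 : ∀ x ∈ Λ, γ.symm x ∈ Λ := fun x hx => by
    have : x ∈ γ '' (Λ : Set U) := by rwa [hγ]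
    obtain ⟨y, hy, rfl⟩ := this
    rwa [LinearEquiv.symm_apply_apply]
  have h' : γ.symm w = c⁻¹ • w := by
    rw [LinearEquiv.symm_apply_eq, map_smul, h, inv_smul_smul₀ hc.ne']
  rcases lt_trichotomy c 1 with hlt | heq | hgt
  · refine absurd (fun n => ?_) (key c hc hlt)
    induction n with
    | zero => simpa using hw
    | succ n ih =>
      have := h1 _ ih
      rwa [map_smul, h, smul_smul, ← pow_succ] at this
  · exact heq
  · refine absurd (fun n => ?_) (key c⁻¹ (inv_pos.mpr hc) (inv_lt_one_of_one_lt₀ hgt))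
    induction n with
    | zero => simpa using hw
    | succ n ih =>
      have := h2 _ ih
      rwa [map_smul, h', smul_smul, ← pow_succ] at this

end Stabilizer

/-! ### The fan, its boundary, and local finiteness. -/

section FanComplex

variable {U : Type*} [NormedAddCommGroup U] [NormedSpace ℝ U]

theorem mem_act {γ : U ≃ₗ[ℝ] U} {σ : PointedCone ℝ U} {x : U} : x ∈ act γ σ ↔ ∃ y ∈ σ, γ y = x :=
  Iff.rfl

theorem act_mul (γ δ : U ≃ₗ[ℝ] U) (σ : PointedCone ℝ U) : act (γ * δ) σ = act γ (act δ σ) :=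
  (PointedCone.map_map _ _ _).symm

theorem act_one (σ : PointedCone ℝ U) : act 1 σ = σ := PointedCone.map_id σ

theorem act_inv_act (γ : U ≃ₗ[ℝ] U) (σ : PointedCone ℝ U) : act γ⁻¹ (act γ σ) = σ := by
  rw [← act_mul, inv_mul_cancel, act_one]

theorem act_act_inv (γ : U ≃ₗ[ℝ] U) (σ : PointedCone ℝ U) : act γ (act γ⁻¹ σ) = σ := by
  rw [← act_mul, mul_inv_cancel, act_one]

theorem act_mono (γ : U ≃ₗ[ℝ] U) {σ τ : PointedCone ℝ U} (h : σ ≤ τ) : act γ σ ≤ act γ τ :=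
  Submodule.map_mono h

theorem act_hull_singleton (γ : U ≃ₗ[ℝ] U) (v : U) :
    act γ (PointedCone.hull ℝ {v}) = PointedCone.hull ℝ {γ v} := by
  change Submodule.map _ (Submodule.span _ _) = _
  rw [Submodule.map_span, Set.image_singleton]
  rfl

theorem IsRay.act {ρ : PointedCone ℝ U} (h : IsRay ρ) (γ : U ≃ₗ[ℝ] U) :
    IsRay (ConeRetraction.act γ ρ) := by
  obtain ⟨v, hv, rfl⟩ := h
  exact ⟨γ v, by simpa using hv, act_hull_singleton γ v⟩

theorem rationalClosure_subset_closedCone (Λ : Submodule ℤ U) (C : ConvexCone ℝ U) :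
    rationalClosure Λ C ⊆ closedCone C := by
  intro x hx
  simp only [rationalClosure, Set.mem_iUnion] at hx
  obtain ⟨B, hB, hx⟩ := hx
  exact hB.1.le (intrinsicInterior_subset hx)

theorem subset_closedCone (C : ConvexCone ℝ U) : (C : Set U) ⊆ closedCone C :=
  fun _ hx => subset_closure (PointedCone.subset_hull hx)

/-- Openness lets a small multiple of any `y` in the closed cone be split off from `x` without
leaving `C`; the face then contains `y`. -/
theorem eq_closedCone_of_mem {C : ConvexCone ℝ U} (hC : IsOpen (C : Set U)) {B : PointedCone ℝ U}
    (hB : B.IsFaceOf (closedCone C)) {x : U} (hxB : x ∈ B) (hxC : x ∈ C) : B = closedCone C := by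
  refine le_antisymm hB.le fun y hy => ?_
  have hcont : Filter.Tendsto (fun t : ℝ => x - t • y) (nhds 0) (nhds x) := by
    have : Continuous fun t : ℝ => x - t • y := by fun_prop
    simpa using this.tendsto 0
  have hev := hcont.eventually (hC.mem_nhds hxC)
  obtain ⟨ε, hε, hball⟩ := Metric.eventually_nhds_iff.mp hev
  have hmem : x - (ε / 2) • y ∈ C := hball (by
    rw [Real.dist_eq, sub_zero, abs_of_pos (half_pos hε)]; exact half_lt_self hε)
  refine hB.mem_of_smul_add_mem hy (subset_closedCone C hmem) (half_pos hε) ?_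
  rwa [add_sub_cancel]

variable {Λ : Submodule ℤ U} {C : ConvexCone ℝ U} {Γ : Subgroup (U ≃ₗ[ℝ] U)}
  {S : Set (PointedCone ℝ U)}

theorem IsAdmissible.le_closedCone (hS : IsAdmissible Λ C Γ S) {σ : PointedCone ℝ U}
    (hσ : σ ∈ S) : σ ≤ closedCone C := fun _ hx =>
  rationalClosure_subset_closedCone Λ C
    (hS.union_eq ▸ Set.mem_biUnion (t := fun σ : PointedCone ℝ U => (σ : Set U)) hσ hx)

theorem IsAdmissible.isFaceOf (hS : IsAdmissible Λ C Γ S) {ρ σ : PointedCone ℝ U} (hρ : ρ ∈ S)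
    (hσ : σ ∈ S) (h : ρ ≤ σ) : ρ.IsFaceOf σ := by
  have := (hS.inf_isFaceOf ρ hρ σ hσ).2
  rwa [inf_eq_left.mpr h] at this

theorem IsAdmissible.finite_rays_le (hS : IsAdmissible Λ C Γ S) {σ : PointedCone ℝ U}
    (hσ : σ ∈ S) : {ρ | ρ ∈ S ∧ IsRay ρ ∧ ρ ≤ σ}.Finite := by
  obtain ⟨s, -, hs⟩ := hS.polyhedral σ hσ
  refine (s.finite_toSet.image fun w => PointedCone.hull ℝ {w}).subset ?_
  rintro _ ⟨hρS, ⟨v, hv, rfl⟩, hle⟩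
  have hface := hS.isFaceOf hρS hσ hle
  rw [hs] at hface
  obtain ⟨w, hw, -, hvw⟩ := exists_generator_of_isFaceOf_hull hv hface
  exact ⟨w, hw, hvw.symm⟩

theorem IsAdmissible.exists_lattice_generator (hS : IsAdmissible Λ C Γ S) {ρ : PointedCone ℝ U}
    (hρ : ρ ∈ S) (hray : IsRay ρ) : ∃ w ∈ Λ, w ≠ 0 ∧ ρ = PointedCone.hull ℝ {w} := by
  obtain ⟨s, hsΛ, hs⟩ := hS.polyhedral ρ hρ
  obtain ⟨v, hv, rfl⟩ := hray
  have hface := PointedCone.IsFaceOf.refl (PointedCone.hull ℝ {v})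
  nth_rw 2 [hs] at hface
  obtain ⟨w, hw, hw0, hvw⟩ := exists_generator_of_isFaceOf_hull hv hface
  exact ⟨w, hsΛ w hw, hw0, hvw⟩

/-- It suffices to treat one orbit representative `τ`. If `γ₀ τ` and `γ τ` both contain `ρ`, then
`γ₀⁻¹ ρ` and `γ⁻¹ ρ` are equivalent rays of `τ`, hence equal. Thus `γ γ₀⁻¹` stabilizes `ρ`, fixes it
pointwise by discreteness of the lattice, and belongs to the finite stabilizer of a point of `C`. -/
theorem IsAdmissible.finite_cones_ge [FiniteDimensional ℝ U] [DiscreteTopology Λ] [IsZLattice ℝ Λ]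
    (hCopen : IsOpen (C : Set U))
    (hCsal : ∀ x ∈ closure (C : Set U), -x ∈ closure (C : Set U) → x = 0)
    (hΓC : ∀ γ ∈ Γ, γ '' (C : Set U) = C) (hΓΛ : ∀ γ ∈ Γ, γ '' (Λ : Set U) = Λ)
    (hS : IsAdmissible Λ C Γ S)
    (hSrays : ∀ σ ∈ S, ∀ ρ₁ ∈ S, ∀ ρ₂ ∈ S, IsRay ρ₁ → IsRay ρ₂ →
      ρ₁ ≤ σ → ρ₂ ≤ σ → ∀ γ ∈ Γ, act γ ρ₁ = ρ₂ → ρ₁ = ρ₂)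
    {ρ : PointedCone ℝ U} (hρ : ρ ∈ S) (hray : IsRay ρ)
    (hmeet : ¬ Disjoint (ρ : Set U) (C : Set U)) : {σ ∈ S | ρ ≤ σ}.Finite := by
  obtain ⟨w, hwΛ, hw0, hρw⟩ := hS.exists_lattice_generator hρ hray
  obtain ⟨y, hyρ, hyC⟩ := Set.not_disjoint_iff.mp hmeet
  rw [hρw] at hyρ
  obtain ⟨c, hc, rfl⟩ := mem_hull_singleton.mp hyρ
  have hfix : ∀ δ ∈ Γ, act δ ρ = ρ → δ w = w := by
    intro δ hδ h
    have h1 : δ w ∈ ρ := h ▸ mem_act.mpr ⟨w, hρw ▸ PointedCone.subset_hull rfl, rfl⟩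
    rw [hρw] at h1
    obtain ⟨a, ha, hδw⟩ := mem_hull_singleton.mp h1
    have ha0 : a ≠ 0 := by
      rintro rfl
      rw [zero_smul, eq_comm, LinearEquiv.map_eq_zero_iff] at hδw
      exact hw0 hδw
    rw [← hδw, eq_one_of_lattice_smul Λ (hΓΛ δ hδ) hwΛ hw0 (lt_of_le_of_ne ha ha0.symm) hδw.symm,
      one_smul]
  have hG := finite_stabilizer Λ C hCopen hCsal hyC
  obtain ⟨T, hT, hTS, hTcov⟩ := hS.finite_orbits
  have hτ : ∀ τ ∈ T, {σ | ρ ≤ σ ∧ ∃ γ ∈ Γ, σ = act γ τ}.Finite := by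
    intro τ hτT
    by_cases hne : ∃ γ₀ ∈ Γ, ρ ≤ act γ₀ τ
    · obtain ⟨γ₀, hγ₀, hle₀⟩ := hne
      refine (hG.image fun δ => act δ (act γ₀ τ)).subset ?_
      rintro _ ⟨hle, γ, hγ, rfl⟩
      have hmem : ∀ γ' ∈ Γ, ρ ≤ act γ' τ → act γ'⁻¹ ρ ≤ τ := fun γ' _ h => by
        have := act_mono γ'⁻¹ h
        rwa [act_inv_act] at this
      have heq : act γ₀⁻¹ ρ = act γ⁻¹ ρ := by
        refine hSrays τ (hTS hτT) _ (hS.act_mem _ (Γ.inv_mem hγ₀) ρ hρ) _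
          (hS.act_mem _ (Γ.inv_mem hγ) ρ hρ) (hray.act _) (hray.act _) (hmem _ hγ₀ hle₀)
          (hmem _ hγ hle) (γ⁻¹ * γ₀) (Γ.mul_mem (Γ.inv_mem hγ) hγ₀) ?_
        rw [act_mul, act_act_inv]
      have hδ : γ * γ₀⁻¹ ∈ Γ := Γ.mul_mem hγ (Γ.inv_mem hγ₀)
      refine ⟨γ * γ₀⁻¹, ⟨hΓC _ hδ, hΓΛ _ hδ, ?_⟩, ?_⟩
      · rw [map_smul, hfix _ hδ (by rw [act_mul, heq, act_act_inv])]
      · change act (γ * γ₀⁻¹) (act γ₀ τ) = act γ τ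
        rw [← act_mul, inv_mul_cancel_right]
    · refine Set.finite_empty.subset ?_
      rintro _ ⟨hle, γ, hγ, rfl⟩
      exact hne ⟨γ, hγ, hle⟩
  refine (hT.biUnion hτ).subset ?_
  rintro σ ⟨hσ, hle⟩
  obtain ⟨τ, hτT, γ, hγ, h⟩ := hTcov σ hσ
  exact Set.mem_biUnion hτT ⟨hle, γ, hγ, h⟩

/-- The boundary complex is a full subcomplex. -/
theorem IsAdmissible.mem_boundary_of_vertices (hCopen : IsOpen (C : Set U))
    (hS : IsAdmissible Λ C Γ S)
    (hSbdry : ∀ σ ∈ S, ∃ B : PointedCone ℝ U, IsRationalFace Λ C B ∧ B ≠ closedCone C ∧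
      (σ : Set U) ∩ (rationalClosure Λ C \ (C : Set U)) ⊆ Submodule.span ℝ (B : Set U))
    {s : Finset (PointedCone ℝ U)} (hs : s ∈ (projectivization S).faces)
    (hv : ∀ ρ ∈ s, {ρ} ∈ (projectivization (boundaryFan C S)).faces) :
    s ∈ (projectivization (boundaryFan C S)).faces := by
  have hρ : ∀ ρ ∈ s, ρ ∈ boundaryFan C S := fun ρ h =>
    ((hv ρ h).2.1 ρ (Finset.mem_singleton_self ρ)).1
  obtain ⟨hne, hrays, σ, hσ, hle⟩ := hs
  obtain ⟨B, hB, hBne, hBσ⟩ := hSbdry σ hσ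
  have hface : (σ ⊓ B).IsFaceOf σ := by
    have := (PointedCone.IsFaceOf.refl σ).inf hB.1
    rwa [inf_eq_left.mpr (hS.le_closedCone hσ)] at this
  -- The common boundary cone is the face `σ ⊓ B`: it misses `C` since a proper face of the closed
  -- cone does, and the rays lie in `B` since they lie in both its span and the closed cone.
  refine ⟨hne, fun ρ h => ⟨hρ ρ h, (hrays ρ h).2⟩, σ ⊓ B, ⟨hS.face_mem σ hσ _ hface, ?_⟩, ?_⟩
  · rw [Set.disjoint_left]
    exact fun x hx hxC => hBne (eq_closedCone_of_mem hCopen hB.1 hx.2 hxC)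
  · refine fun ρ h => le_inf (hle ρ h) fun x hx => ?_
    refine IsFaceOf.mem_of_mem_span hB.1 (hS.le_closedCone (hρ ρ h).1 hx) (hBσ ⟨hle ρ h hx, ?_, ?_⟩)
    · exact hS.union_eq ▸
        Set.mem_biUnion (t := fun σ : PointedCone ℝ U => (σ : Set U)) (hρ ρ h).1 hx
    · exact Set.disjoint_left.mp (hρ ρ h).2 hx

/-- By fullness some vertex of the simplex is a ray meeting `C`; finitely many cones contain it, and
each has finitely many rays. -/
theorem IsAdmissible.locallyFiniteOff [FiniteDimensional ℝ U] [DiscreteTopology Λ]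
    [IsZLattice ℝ Λ] (hCopen : IsOpen (C : Set U))
    (hCsal : ∀ x ∈ closure (C : Set U), -x ∈ closure (C : Set U) → x = 0)
    (hΓC : ∀ γ ∈ Γ, γ '' (C : Set U) = C) (hΓΛ : ∀ γ ∈ Γ, γ '' (Λ : Set U) = Λ)
    (hS : IsAdmissible Λ C Γ S)
    (hSrays : ∀ σ ∈ S, ∀ ρ₁ ∈ S, ∀ ρ₂ ∈ S, IsRay ρ₁ → IsRay ρ₂ →
      ρ₁ ≤ σ → ρ₂ ≤ σ → ∀ γ ∈ Γ, act γ ρ₁ = ρ₂ → ρ₁ = ρ₂)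
    (hSbdry : ∀ σ ∈ S, ∃ B : PointedCone ℝ U, IsRationalFace Λ C B ∧ B ≠ closedCone C ∧
      (σ : Set U) ∩ (rationalClosure Λ C \ (C : Set U)) ⊆ Submodule.span ℝ (B : Set U)) :
    LocallyFiniteOff (projectivization S) (projectivization (boundaryFan C S)) := by
  intro s hs hs0
  have hex : ∃ ρ ∈ s, {ρ} ∉ (projectivization (boundaryFan C S)).faces := by
    by_contra! hcon
    exact hs0 (hS.mem_boundary_of_vertices hCopen hSbdry hs hcon)
  obtain ⟨ρ, hρs, hρ⟩ := hex
  obtain ⟨hρS, hray⟩ := hs.2.1 ρ hρs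
  have hmeet : ¬ Disjoint (ρ : Set U) (C : Set U) := fun hd =>
    hρ ⟨Finset.singleton_nonempty ρ, by simpa using ⟨⟨hρS, hd⟩, hray⟩,
      ρ, ⟨hρS, hd⟩, by simp⟩
  have hfin := (hS.finite_cones_ge hCopen hCsal hΓC hΓΛ hSrays hρS hray hmeet).biUnion
    (t := fun σ => {t : Finset (PointedCone ℝ U) | ∀ ρ ∈ t, ρ ∈ S ∧ IsRay ρ ∧ ρ ≤ σ})
    fun σ hσ => by
      refine (hS.finite_rays_le hσ.1).toFinset.powerset.finite_toSet.subset fun t ht => ?_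
      simp only [Finset.coe_powerset, Set.mem_preimage, Set.mem_powerset_iff]
      exact fun ρ hρ => (Set.Finite.mem_toFinset _).mpr (ht ρ hρ)
  refine hfin.subset ?_
  rintro t ⟨⟨-, hrays, σ, hσ, hle⟩, hst⟩
  exact Set.mem_biUnion (show σ ∈ {σ ∈ S | ρ ≤ σ} from ⟨hσ, hle ρ (hst hρs)⟩)
    fun ρ' h' => ⟨(hrays ρ' h').1, (hrays ρ' h').2, hle ρ' h'⟩

theorem actSimplex_mem_projectivization {S : Set (PointedCone ℝ U)} {γ : U ≃ₗ[ℝ] U}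
    (hS : ∀ σ ∈ S, act γ σ ∈ S) {s : Finset (PointedCone ℝ U)}
    (hs : s ∈ (projectivization S).faces) : actSimplex γ s ∈ (projectivization S).faces := by
  classical
  obtain ⟨hne, hrays, σ, hσ, hle⟩ := hs
  refine ⟨hne.image _, ?_, act γ σ, hS σ hσ, ?_⟩
  · intro ρ hρ
    obtain ⟨ρ', hρ', rfl⟩ := Finset.mem_image.mp hρ
    exact ⟨hS _ (hrays ρ' hρ').1, (hrays ρ' hρ').2.act γ⟩
  · intro ρ hρ
    obtain ⟨ρ', hρ', rfl⟩ := Finset.mem_image.mp hρ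
    exact act_mono γ (hle ρ' hρ')

theorem actSimplex_actSimplex_inv (γ : U ≃ₗ[ℝ] U) (s : Finset (PointedCone ℝ U)) :
    actSimplex γ (actSimplex γ⁻¹ s) = s := by
  classical
  unfold actSimplex
  rw [Finset.image_image]
  have : (act γ ∘ act γ⁻¹) = id := funext fun σ => act_act_inv γ σ
  rw [this, Finset.image_id]

theorem actSimplex_inv_actSimplex (γ : U ≃ₗ[ℝ] U) (s : Finset (PointedCone ℝ U)) :
    actSimplex γ⁻¹ (actSimplex γ s) = s := by
  simpa using actSimplex_actSimplex_inv γ⁻¹ s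

theorem act_mem_boundaryFan (hS : IsAdmissible Λ C Γ S) (hΓC : ∀ γ ∈ Γ, γ '' (C : Set U) = C)
    {γ : U ≃ₗ[ℝ] U} (hγ : γ ∈ Γ) {σ : PointedCone ℝ U} (hσ : σ ∈ boundaryFan C S) :
    act γ σ ∈ boundaryFan C S := by
  refine ⟨hS.act_mem γ hγ σ hσ.1, Set.disjoint_left.mpr ?_⟩
  rintro _ ⟨x, hx, rfl⟩ hC
  rw [← hΓC γ hγ] at hC
  obtain ⟨y, hy, hyx⟩ := hC
  have : y = x := γ.injective hyx
  exact Set.disjoint_left.mp hσ.2 hx (this ▸ hy)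

end FanComplex

/-! ### The complexes `Δ⁺` and `∂Δ⁺` as complexes of flags. -/

section Retract

variable {V : Type*}

/-- The subcomplex of the barycentric subdivision of `K` formed by the flags of simplices that do
not belong to `L`. -/
def retract (K L : PreAbstractSimplicialComplex V) : PreAbstractSimplicialComplex (Finset V) where
  faces := {c | c ∈ (barycentric K).faces ∧ ∀ s ∈ c, s ∉ L.faces}
  isRelLowerSet_faces := fun _ hc => ⟨hc.1.1, fun _ hle hne =>
    ⟨((barycentric K).isRelLowerSet_faces hc.1).2 hle hne, fun s hs => hc.2 s (hle hs)⟩⟩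

/-- The subcomplex of `retract K L` formed by the flags of simplices that have a vertex in `L`. -/
def retractBoundary (K L : PreAbstractSimplicialComplex V) :
    PreAbstractSimplicialComplex (Finset V) where
  faces := {c | c ∈ (retract K L).faces ∧ ∀ s ∈ c, ∃ v ∈ s, {v} ∈ L.faces}
  isRelLowerSet_faces := fun _ hc => ⟨hc.1.1.1, fun _ hle hne =>
    ⟨((retract K L).isRelLowerSet_faces hc.1).2 hle hne, fun s hs => hc.2 s (hle hs)⟩⟩

theorem retract_le (K L : PreAbstractSimplicialComplex V) : retract K L ≤ barycentric K :=
  fun _ h => h.1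

theorem retractBoundary_le (K L : PreAbstractSimplicialComplex V) :
    retractBoundary K L ≤ retract K L :=
  fun _ h => h.1

/-- A flag through `s` consists of subsets of `s` and of simplices containing `s`; the latter are
finite in number because `s` is not in `L`. -/
theorem locallyFinite_retract {K L : PreAbstractSimplicialComplex V} (h : LocallyFiniteOff K L) :
    LocallyFinite (retract K L) := by
  classical
  intro s
  by_cases hs : s ∈ K.faces ∧ s ∉ L.faces
  · have hfin : ({t ∈ K.faces | s ⊆ t} ∪ (s.powerset : Set (Finset V))).Finite :=
      (h s hs.1 hs.2).union (Finset.finite_toSet _)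
    refine hfin.toFinset.powerset.finite_toSet.subset ?_
    rintro c ⟨⟨⟨-, hK, hch⟩, -⟩, hsc⟩
    simp only [Finset.coe_powerset, Set.mem_preimage, Set.mem_powerset_iff, Set.Finite.coe_toFinset]
    intro t ht
    by_cases hst : s ⊆ t
    · exact Or.inl ⟨hK t ht, hst⟩
    · refine Or.inr ?_
      rcases hch.total hsc ht with h1 | h1
      · exact absurd h1 hst
      · simpa using h1
  · refine Set.finite_empty.subset ?_
    rintro c ⟨⟨⟨-, hK, -⟩, hL⟩, hsc⟩
    exact hs ⟨hK s hsc, hL s hsc⟩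

end Retract

/-! ### Invariance under the group. -/

section Invariance

variable {U : Type*} [NormedAddCommGroup U] [NormedSpace ℝ U]
variable {Λ : Submodule ℤ U} {C : ConvexCone ℝ U} {Γ : Subgroup (U ≃ₗ[ℝ] U)}
  {S : Set (PointedCone ℝ U)}

theorem isInvariant_retract (hS : IsAdmissible Λ C Γ S) (hΓC : ∀ γ ∈ Γ, γ '' (C : Set U) = C) :
    IsInvariant Γ (retract (projectivization S) (projectivization (boundaryFan C S))) := by
  classical
  set K := retract (projectivization S) (projectivization (boundaryFan C S)) with hK
  have key : ∀ γ ∈ Γ, ∀ c ∈ K.faces, c.image (actSimplex γ) ∈ K.faces := by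
    rintro γ hγ c ⟨⟨hne, hcK, hch⟩, hcL⟩
    refine ⟨⟨hne.image _, ?_, ?_⟩, ?_⟩
    · intro s hs
      obtain ⟨t, ht, rfl⟩ := Finset.mem_image.mp hs
      exact actSimplex_mem_projectivization (hS.act_mem γ hγ) (hcK t ht)
    · rw [Finset.coe_image]
      rintro _ ⟨s, hs, rfl⟩ _ ⟨t, ht, rfl⟩ -
      exact (hch.total hs ht).imp Finset.image_subset_image Finset.image_subset_image
    · intro s hs hs'
      obtain ⟨t, ht, rfl⟩ := Finset.mem_image.mp hs
      refine hcL t ht ?_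
      have := actSimplex_mem_projectivization
        (fun σ hσ => act_mem_boundaryFan hS hΓC (Γ.inv_mem hγ) hσ) hs'
      rwa [actSimplex_inv_actSimplex] at this
  intro γ hγ
  refine PreAbstractSimplicialComplex.ext (Set.Subset.antisymm ?_ ?_)
  · rintro _ ⟨c, hc, rfl⟩
    convert key γ hγ c hc
  · intro c hc
    refine ⟨c.image (actSimplex γ⁻¹), key _ (Γ.inv_mem hγ) c hc, ?_⟩
    ext s
    simp [actSimplex_actSimplex_inv]

end Invariance

/-! ### Alternating functions of tuples. -/

section Tuples

variable {W : Type*} {R : Type*} [CommRing R]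

/-- The set of entries of a tuple. -/
noncomputable def entries {n : ℕ} (v : Fin n → W) : Finset W := (Set.finite_range v).toFinset

@[simp]
theorem coe_entries {n : ℕ} (v : Fin n → W) : (entries v : Set W) = Set.range v := by
  simp [entries]

@[simp]
theorem mem_entries {n : ℕ} {v : Fin n → W} {x : W} : x ∈ entries v ↔ ∃ i, v i = x := by
  simp [entries]

theorem image_eq_entries [DecidableEq W] {n : ℕ} (v : Fin n → W) :
    Finset.univ.image v = entries v := by
  ext; simp

theorem entries_nonempty {n : ℕ} (v : Fin (n + 1) → W) : (entries v).Nonempty :=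
  ⟨v 0, mem_entries.mpr ⟨0, rfl⟩⟩

theorem entries_comp_subset {m n : ℕ} (v : Fin n → W) (e : Fin m → Fin n) :
    entries (v ∘ e) ⊆ entries v := by
  intro x hx
  obtain ⟨i, rfl⟩ := mem_entries.mp hx
  exact mem_entries.mpr ⟨e i, rfl⟩

theorem entries_comp_perm {n : ℕ} (v : Fin n → W) (π : Equiv.Perm (Fin n)) :
    entries (v ∘ π) = entries v := by
  ext x
  simp only [mem_entries, Function.comp_apply]
  exact ⟨fun ⟨i, h⟩ => ⟨π i, h⟩, fun ⟨i, h⟩ => ⟨π.symm i, by simpa using h⟩⟩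

/-- A function of tuples which is multiplied by the sign under permutations. -/
def Alternating {n : ℕ} (φ : (Fin n → W) → R) : Prop :=
  ∀ (v : Fin n → W) (π : Equiv.Perm (Fin n)), φ (v ∘ π) = ((Equiv.Perm.sign π : ℤ) : R) * φ v

theorem mem_cochain {K L : PreAbstractSimplicialComplex W} {k : ℕ} {φ : (Fin (k + 1) → W) → R} :
    φ ∈ cochain R K L k ↔ Alternating φ ∧
      (∀ v, φ v ≠ 0 → Function.Injective v ∧ entries v ∈ K.faces ∧ entries v ∉ L.faces) ∧
      {v | φ v ≠ 0}.Finite := by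
  classical
  simp only [← image_eq_entries]
  constructor
  · rintro ⟨h1, h2, h3⟩
    exact ⟨h1, fun v hv => by convert h2 v hv, h3⟩
  · rintro ⟨h1, h2, h3⟩
    exact ⟨h1, fun v hv => by convert h2 v hv, h3⟩

theorem coboundaryFun_of_mem {K : PreAbstractSimplicialComplex W} {k : ℕ}
    (φ : (Fin (k + 1) → W) → R) {v : Fin (k + 2) → W} (hv : Function.Injective v)
    (hK : entries v ∈ K.faces) : coboundaryFun R K φ v = faceSum R φ v := by
  classical
  refine if_pos ⟨hv, ?_⟩
  rw [image_eq_entries]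
  exact hK

theorem coboundaryFun_of_not {K : PreAbstractSimplicialComplex W} {k : ℕ}
    (φ : (Fin (k + 1) → W) → R) {v : Fin (k + 2) → W}
    (h : ¬ (Function.Injective v ∧ entries v ∈ K.faces)) : coboundaryFun R K φ v = 0 := by
  classical
  refine if_neg ?_
  rwa [image_eq_entries]

theorem faceSum_add {k : ℕ} (φ ψ : (Fin (k + 1) → W) → R) :
    faceSum R (φ + ψ) = faceSum R φ + faceSum R ψ := by
  funext v
  simp [faceSum, mul_add, Finset.sum_add_distrib]

theorem faceSum_smul {k : ℕ} (c : R) (φ : (Fin (k + 1) → W) → R) :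
    faceSum R (c • φ) = c • faceSum R φ := by
  funext v
  simp [faceSum, Finset.mul_sum, mul_left_comm]

theorem faceSum_sub {k : ℕ} (φ ψ : (Fin (k + 1) → W) → R) :
    faceSum R (φ - ψ) = faceSum R φ - faceSum R ψ := by
  funext v
  simp [faceSum, mul_sub, Finset.sum_sub_distrib]

theorem Alternating.faceSum {k : ℕ} {φ : (Fin (k + 1) → W) → R} (h : Alternating φ) :
    Alternating (faceSum R φ) :=
  faceSum_perm h

/-- The face sum of an alternating function that vanishes on degenerate tuples vanishes on
degenerate tuples. -/
theorem faceSum_of_not_injective {k : ℕ} {φ : (Fin (k + 1) → W) → R} (h : Alternating φ)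
    (h0 : ∀ v, φ v ≠ 0 → Function.Injective v) {v : Fin (k + 2) → W}
    (hv : ¬ Function.Injective v) : faceSum R φ v = 0 := by
  -- When the first two entries agree, the first two terms cancel and every other face is still
  -- degenerate.
  have hcases : ∀ v : Fin (k + 2) → W, v 0 = v 1 → faceSum R φ v = 0 := by
    intro v h01
    unfold faceSum
    rw [Fin.sum_univ_succ, Fin.sum_univ_succ, Finset.sum_eq_zero, add_zero]
    · have : v ∘ Fin.succAbove 0 = v ∘ Fin.succAbove (Fin.succ 0) := by
        funext j
        refine Fin.cases ?_ (fun j => ?_) j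
        · simpa using h01.symm
        · simp
      rw [this]
      simp
    · intro i _
      rw [show φ (v ∘ i.succ.succ.succAbove) = 0 from ?_, mul_zero]
      by_contra hne
      have hinj := h0 _ hne
      obtain ⟨n, rfl⟩ : ∃ n, k = n + 1 := ⟨k - 1, by have := i.isLt; omega⟩
      have h01' : (0 : Fin (n + 2)) = 1 := hinj (by
        simp only [Function.comp_apply]
        rw [Fin.succAbove_of_castSucc_lt _ _ (Fin.lt_def.mpr (by simp)),
          Fin.succAbove_of_castSucc_lt _ _ (Fin.lt_def.mpr (by simp))]
        simpa using h01)
      simp at h01'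
  simp only [Function.Injective, not_forall] at hv
  obtain ⟨a, b, hab, hne⟩ := hv
  obtain ⟨π, ha, hb⟩ : ∃ π : Equiv.Perm (Fin (k + 2)), π 0 = a ∧ π 1 = b := by
    -- The inner swap sends `0` to `a`; the outer one corrects the image of `1` to `b` without
    -- moving `a`.
    refine ⟨Equiv.swap (Equiv.swap 0 a 1) b * Equiv.swap 0 a, ?_, ?_⟩
    · rw [Equiv.Perm.mul_apply, Equiv.swap_apply_left, Equiv.swap_apply_of_ne_of_ne _ hne]
      intro h
      have := (Equiv.swap (0 : Fin (k + 2)) a).injective (h.symm.trans (Equiv.swap_apply_left 0 a).symm)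
      simp at this
    · rw [Equiv.Perm.mul_apply, Equiv.swap_apply_left]
  have h1 := hcases (v ∘ π) (by simp [ha, hb, hab])
  rw [h.faceSum v π] at h1
  rcases Int.units_eq_one_or (Equiv.Perm.sign π) with hs | hs <;> simpa [hs] using h1

end Tuples

/-! ### The dual cone construction, as a formal identity. -/

section FormalHomotopy

variable {W : Type*} {R : Type*} [CommRing R]

/-- The slant product of a function of tuples with a vertex. -/
def coneAt {k : ℕ} (φ : (Fin (k + 2) → W) → R) (s : W) : (Fin (k + 1) → W) → R :=
  fun g => φ (Fin.cons s g)

/-- Dual to the boundary formula `∂(s * g) = g - s * ∂g` for a cone. -/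
theorem coneAt_faceSum {k : ℕ} (φ : (Fin (k + 2) → W) → R) (s : W) :
    coneAt (faceSum R φ) s = φ - faceSum R (coneAt φ s) := by
  funext g
  simp only [coneAt, faceSum, Pi.sub_apply]
  rw [Fin.sum_univ_succ, sub_eq_add_neg, ← Finset.sum_neg_distrib]
  congr 1
  · simp only [Fin.val_zero, pow_zero, one_mul]
    congr 1
  · refine Finset.sum_congr rfl fun i _ => ?_
    have : (Fin.cons s g : Fin (k + 3) → W) ∘ i.succ.succAbove =
        Fin.cons s (g ∘ i.succAbove) := by
      funext j
      refine Fin.cases ?_ (fun j => ?_) j <;> simp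
    rw [this, Fin.val_succ, pow_succ]
    ring

theorem coneAt_faceSum_zero (φ : (Fin 1 → W) → R) (s : W) :
    coneAt (faceSum R φ) s = φ - fun _ => φ fun _ => s := by
  funext g
  simp only [coneAt, faceSum, Pi.sub_apply]
  rw [Fin.sum_univ_two]
  have h1 : (Fin.cons s g : Fin 2 → W) ∘ (0 : Fin 2).succAbove = g := by
    funext j; simp [Fin.succAbove_zero]
  have h2 : (Fin.cons s g : Fin 2 → W) ∘ (1 : Fin 2).succAbove = fun _ => s := by
    funext j; fin_cases j; rfl
  rw [h1, h2]
  simp [sub_eq_add_neg]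

/-- A permutation of `g` extends to one of `(s, g)` fixing the first position, with the same sign.
-/
theorem Alternating.coneAt {k : ℕ} {φ : (Fin (k + 2) → W) → R} (h : Alternating φ) (s : W) :
    Alternating (coneAt φ s) := by
  intro v π
  have hcons : (Fin.cons s (v ∘ π) : Fin (k + 2) → W) =
      Fin.cons s v ∘ Equiv.Perm.decomposeFin.symm (0, π) := by
    funext j
    refine Fin.cases ?_ (fun j => ?_) j
    · simp
    · simp [Equiv.Perm.decomposeFin_symm_apply_succ]
  simp only [ConeRetraction.coneAt]
  rw [hcons, h, Equiv.Perm.decomposeFin.symm_sign]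
  simp

/-- The homotopy between a chain map `D` and zero that is obtained by coning off the tuple `f`
from the vertex `c f`. -/
def coneHomotopy (D : ∀ k, ((Fin (k + 1) → W) → R) →ₗ[R] ((Fin (k + 1) → W) → R))
    (c : ∀ k, (Fin (k + 1) → W) → W) :
    ∀ k, ((Fin (k + 2) → W) → R) → (Fin (k + 1) → W) → R
  | 0, φ, f => D 0 (coneAt φ (c 0 f)) f
  | k + 1, φ, f => D (k + 1) (coneAt φ (c (k + 1) f)) f -
      faceSum R (coneHomotopy D c k (coneAt φ (c (k + 1) f))) f

variable {D : ∀ k, ((Fin (k + 1) → W) → R) →ₗ[R] ((Fin (k + 1) → W) → R)}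
  {c : ∀ k, (Fin (k + 1) → W) → W}

theorem coneHomotopy_add (k : ℕ) (φ ψ : (Fin (k + 2) → W) → R) :
    coneHomotopy D c k (φ + ψ) = coneHomotopy D c k φ + coneHomotopy D c k ψ := by
  have hcone : ∀ {k : ℕ} (φ ψ : (Fin (k + 2) → W) → R) (s : W),
      coneAt (φ + ψ) s = coneAt φ s + coneAt ψ s := fun _ _ _ => rfl
  induction k with
  | zero =>
    funext f
    simp [coneHomotopy, hcone]
  | succ k ih =>
    funext f
    simp only [coneHomotopy, hcone, map_add, ih, faceSum_add, Pi.add_apply]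
    ring

theorem coneHomotopy_smul (k : ℕ) (a : R) (φ : (Fin (k + 2) → W) → R) :
    coneHomotopy D c k (a • φ) = a • coneHomotopy D c k φ := by
  have hcone : ∀ {k : ℕ} (φ : (Fin (k + 2) → W) → R) (s : W),
      coneAt (a • φ) s = a • coneAt φ s := fun _ _ => rfl
  induction k with
  | zero =>
    funext f
    simp [coneHomotopy, hcone]
  | succ k ih =>
    funext f
    simp only [coneHomotopy, hcone, map_smul, ih, faceSum_smul, Pi.smul_apply, smul_eq_mul]
    ring

theorem coneHomotopy_sub (k : ℕ) (φ ψ : (Fin (k + 2) → W) → R) :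
    coneHomotopy D c k (φ - ψ) = coneHomotopy D c k φ - coneHomotopy D c k ψ := by
  have h := coneHomotopy_add (D := D) (c := c) k φ ((-1 : R) • ψ)
  rw [coneHomotopy_smul] at h
  simpa [sub_eq_add_neg] using h

theorem coneHomotopy_zero_faceSum (hconst : ∀ r : R, D 0 (fun _ => r) = 0)
    (φ : (Fin 1 → W) → R) : coneHomotopy D c 0 (faceSum R φ) = D 0 φ := by
  funext f
  rw [coneHomotopy, coneAt_faceSum_zero, map_sub, hconst, sub_zero]

/-- This dualizes the recursion `h(f) = c * (D f - h ∂f)`. With `θ` the slant of `φ` at the cone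
point, the recursion and `coneAt_faceSum` leave only the comparison of `δ h δ θ` with `δ D θ`; that
is the identity one degree lower together with `δ δ = 0`. The cone point depends on the tuple at
which one evaluates, but is fixed during each such computation. -/
theorem faceSum_coneHomotopy_add (hconst : ∀ r : R, D 0 (fun _ => r) = 0)
    (hD : ∀ (k : ℕ) (φ : (Fin (k + 1) → W) → R), D (k + 1) (faceSum R φ) = faceSum R (D k φ))
    (k : ℕ) (φ : (Fin (k + 2) → W) → R) :
    faceSum R (coneHomotopy D c k φ) + coneHomotopy D c (k + 1) (faceSum R φ) =
      D (k + 1) φ := by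
  have step : ∀ (k : ℕ), (∀ θ : (Fin (k + 1) → W) → R,
      faceSum R (coneHomotopy D c k (faceSum R θ)) = faceSum R (D k θ)) →
      ∀ φ : (Fin (k + 2) → W) → R,
      faceSum R (coneHomotopy D c k φ) + coneHomotopy D c (k + 1) (faceSum R φ) =
        D (k + 1) φ := by
    intro k h φ
    funext f
    rw [Pi.add_apply, coneHomotopy, coneAt_faceSum, map_sub, hD, coneHomotopy_sub, faceSum_sub, h]
    simp only [Pi.sub_apply]
    ring
  induction k with
  | zero => exact step 0 (fun θ => by rw [coneHomotopy_zero_faceSum hconst]) φ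
  | succ k ih =>
    refine step (k + 1) (fun θ => ?_) φ
    rw [eq_sub_iff_add_eq'.mpr (ih θ), faceSum_sub]
    have : faceSum R (faceSum R (coneHomotopy D c k θ)) = 0 := funext fun v => faceSum_faceSum _ v
    rw [this, sub_zero]

theorem Alternating.coneHomotopy
    (hD : ∀ (k : ℕ) (φ : (Fin (k + 1) → W) → R), Alternating φ → Alternating (D k φ))
    (hc : ∀ (k : ℕ) (f : Fin (k + 1) → W) (π : Equiv.Perm (Fin (k + 1))), c k (f ∘ π) = c k f)
    {k : ℕ} {φ : (Fin (k + 2) → W) → R} (h : Alternating φ) :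
    Alternating (coneHomotopy D c k φ) := by
  induction k with
  | zero =>
    intro f π
    rw [ConeRetraction.coneHomotopy, hc, hD 0 _ (h.coneAt _)]
    rfl
  | succ k ih =>
    intro f π
    rw [ConeRetraction.coneHomotopy, hc, hD _ _ (h.coneAt _),
      (ih (h.coneAt (c (k + 1) f))).faceSum f π, ← mul_sub]
    rfl

end FormalHomotopy

/-! ### Carriers and control of supports. -/

section CarrierHomotopy

variable {W : Type*} {ι : Type*} {R : Type*} [CommRing R]

/-- A chain map `D` on tuples that is carried by the cones `P a` (with cone point `c f` for a tuple
`f`), compatibly with the pair `(K, L)`. -/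
structure IsCarried (K L : PreAbstractSimplicialComplex W)
    (D : ∀ k, ((Fin (k + 1) → W) → R) →ₗ[R] ((Fin (k + 1) → W) → R))
    (c : ∀ k, (Fin (k + 1) → W) → W) (P : ι → Set W → Prop) (a : Finset W → ι) : Prop where
  const : ∀ r : R, D 0 (fun _ => r) = 0
  comm : ∀ (k : ℕ) (φ : (Fin (k + 1) → W) → R), D (k + 1) (faceSum R φ) = faceSum R (D k φ)
  alternating : ∀ (k : ℕ) (φ : (Fin (k + 1) → W) → R), Alternating φ → Alternating (D k φ)
  perm : ∀ (k : ℕ) (f : Fin (k + 1) → W) (π : Equiv.Perm (Fin (k + 1))), c k (f ∘ π) = c k f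
  mono : ∀ (i : ι) (T T' : Set W), T ⊆ T' → P i T' → P i T
  eq_zero : ∀ (i : ι) (k : ℕ) (φ : (Fin (k + 1) → W) → R) (f : Fin (k + 1) → W),
    P i (Set.range f) → (∀ g : Fin (k + 1) → W, P i (Set.range g) → φ g = 0) → D k φ f = 0
  cone : ∀ (i : ι) (k : ℕ) (f : Fin (k + 1) → W), P i (Set.range f) →
    ∃ j, P j (Set.range f) ∧ ∀ T, P j T → P i (insert (c k f) T)
  carrier : ∀ t ∈ K.faces, P (a t) t
  carrier_faces : ∀ t ∈ K.faces, ∀ u : Finset W, u.Nonempty → P (a t) u →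
    u ∈ K.faces ∨ ∀ v ⊆ u, v ∈ K.faces → v ∈ L.faces
  carrier_boundary : ∀ t ∈ K.faces, t ∈ L.faces → ∃ i, P i t ∧
    ∀ u ∈ K.faces, P i u → u ∈ L.faces
  carrier_finite : ∀ u ∈ K.faces, u ∉ L.faces → {t ∈ K.faces | P (a t) u}.Finite

variable {K L : PreAbstractSimplicialComplex W}
  {D : ∀ k, ((Fin (k + 1) → W) → R) →ₗ[R] ((Fin (k + 1) → W) → R)}
  {c : ∀ k, (Fin (k + 1) → W) → W} {P : ι → Set W → Prop} {a : Finset W → ι}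

/-- Locality: at a tuple carried by `i`, the homotopy reads `φ` only on tuples carried by `i`. The
recursion passes to the smaller carrier `j`, to which the cone point can be added without leaving
`i`. -/
theorem IsCarried.coneHomotopy_eq_zero (h : IsCarried K L D c P a) (i : ι) (k : ℕ)
    (φ : (Fin (k + 2) → W) → R) (f : Fin (k + 1) → W) (hf : P i (Set.range f))
    (hφ : ∀ g : Fin (k + 2) → W, P i (Set.range g) → φ g = 0) : coneHomotopy D c k φ f = 0 := by
  induction k generalizing i with
  | zero =>
    obtain ⟨j, hj, hcone⟩ := h.cone i 0 f hf
    refine h.eq_zero j 0 _ f hj fun g hg => hφ _ ?_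
    rw [Fin.range_cons]
    exact hcone _ hg
  | succ k ih =>
    obtain ⟨j, hj, hcone⟩ := h.cone i (k + 1) f hf
    have hψ : ∀ g : Fin (k + 2) → W, P j (Set.range g) → coneAt φ (c (k + 1) f) g = 0 := by
      intro g hg
      refine hφ _ ?_
      rw [Fin.range_cons]
      exact hcone _ hg
    rw [coneHomotopy, h.eq_zero j _ _ f hj hψ, zero_sub, neg_eq_zero]
    refine Finset.sum_eq_zero fun l _ => ?_
    rw [ih j _ _ (h.mono j _ _ (Set.range_comp_subset_range _ _) hj) hψ, mul_zero]

theorem IsCarried.coneHomotopy_congr (h : IsCarried K L D c P a) (i : ι) (k : ℕ)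
    (φ ψ : (Fin (k + 2) → W) → R) (f : Fin (k + 1) → W) (hf : P i (Set.range f))
    (hφ : ∀ g : Fin (k + 2) → W, P i (Set.range g) → φ g = ψ g) :
    coneHomotopy D c k φ f = coneHomotopy D c k ψ f := by
  have := h.coneHomotopy_eq_zero i k (φ - ψ) f hf fun g hg => sub_eq_zero.mpr (hφ g hg)
  rw [coneHomotopy_sub] at this
  exact sub_eq_zero.mp this

open Classical in
/-- Restriction of a function of tuples to the nondegenerate simplices of `K`. -/
noncomputable def restrict (K : PreAbstractSimplicialComplex W) {k : ℕ}
    (φ : (Fin (k + 1) → W) → R) : (Fin (k + 1) → W) → R :=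
  fun v => if Function.Injective v ∧ entries v ∈ K.faces then φ v else 0

theorem restrict_of_mem {k : ℕ} (φ : (Fin (k + 1) → W) → R) {v : Fin (k + 1) → W}
    (hv : Function.Injective v) (hK : entries v ∈ K.faces) : restrict K φ v = φ v :=
  if_pos ⟨hv, hK⟩

theorem mem_of_restrict_ne_zero {k : ℕ} {φ : (Fin (k + 1) → W) → R} {v : Fin (k + 1) → W}
    (h : restrict K φ v ≠ 0) : (Function.Injective v ∧ entries v ∈ K.faces) ∧ φ v ≠ 0 := by
  unfold restrict at h
  split_ifs at h with hc
  · exact ⟨hc, h⟩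
  · exact absurd rfl h

theorem Alternating.restrict {k : ℕ} {φ : (Fin (k + 1) → W) → R} (h : Alternating φ) :
    Alternating (restrict K φ) := by
  intro v π
  unfold ConeRetraction.restrict
  have h1 : Function.Injective (v ∘ π) ↔ Function.Injective v :=
    Function.Injective.of_comp_iff' v π.bijective
  by_cases hv : Function.Injective v ∧ entries v ∈ K.faces
  · rw [if_pos hv, if_pos ⟨h1.mpr hv.1, by rw [entries_comp_perm]; exact hv.2⟩, h v π]
  · rw [if_neg hv, if_neg fun h2 => hv ⟨h1.mp h2.1, by rw [← entries_comp_perm v π]; exact h2.2⟩,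
      mul_zero]

theorem restrict_add {k : ℕ} (φ ψ : (Fin (k + 1) → W) → R) :
    restrict K (φ + ψ) = restrict K φ + restrict K ψ := by
  funext v
  simp only [restrict, Pi.add_apply]
  split_ifs <;> simp

theorem restrict_smul {k : ℕ} (r : R) (φ : (Fin (k + 1) → W) → R) :
    restrict K (r • φ) = r • restrict K φ := by
  funext v
  simp only [restrict, Pi.smul_apply]
  split_ifs <;> simp

theorem finite_setOf_entries_mem {k : ℕ} {A : Set (Finset W)} (hA : A.Finite) :
    {v : Fin (k + 1) → W | entries v ∈ A}.Finite := by
  have hfin : (⋃ t ∈ A, {v : Fin (k + 1) → W | ∀ j, v j ∈ t}).Finite :=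
    hA.biUnion fun t _ => Set.Finite.pi' fun _ => t.finite_toSet
  refine hfin.subset fun v hv => ?_
  exact Set.mem_biUnion (show entries v ∈ A from hv) fun j => mem_entries.mpr ⟨j, rfl⟩

/-- Both support conditions follow from locality: a simplex of `L` has a carrier whose simplices in
`K` all lie in `L`, and each simplex off `L` belongs to the carriers of only finitely many
simplices. -/
theorem IsCarried.restrict_coneHomotopy_mem (h : IsCarried K L D c P a) {k : ℕ}
    {φ : (Fin (k + 2) → W) → R} (hφ : φ ∈ cochain R K L (k + 1)) :
    restrict K (coneHomotopy D c k φ) ∈ cochain R K L k := by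
  obtain ⟨halt, hsupp, hfin⟩ := mem_cochain.mp hφ
  refine mem_cochain.mpr ⟨(halt.coneHomotopy h.alternating h.perm).restrict, fun v hv => ?_, ?_⟩
  · obtain ⟨⟨hinj, hK⟩, hne⟩ := mem_of_restrict_ne_zero hv
    refine ⟨hinj, hK, fun hL => hne ?_⟩
    obtain ⟨i, hi, hiL⟩ := h.carrier_boundary _ hK hL
    refine h.coneHomotopy_eq_zero i k φ v (by rwa [← coe_entries]) fun g hg => ?_
    by_contra hg0
    obtain ⟨-, hgK, hgL⟩ := hsupp g hg0
    exact hgL (hiL _ hgK (by rwa [coe_entries]))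
  · have hA : (⋃ u ∈ {u | φ u ≠ 0}, {t ∈ K.faces | P (a t) (entries u)}).Finite :=
      hfin.biUnion fun u hu => h.carrier_finite _ (hsupp u hu).2.1 (hsupp u hu).2.2
    refine (finite_setOf_entries_mem hA).subset fun v hv => ?_
    obtain ⟨⟨hinj, hK⟩, hne⟩ := mem_of_restrict_ne_zero hv
    by_contra hcon
    refine hne (h.coneHomotopy_eq_zero (a (entries v)) k φ v ?_ fun g hg => ?_)
    · rw [← coe_entries]
      exact h.carrier _ hK
    · by_contra hg0
      exact hcon (Set.mem_biUnion (show g ∈ {u | φ u ≠ 0} from hg0)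
        ⟨hK, by rwa [coe_entries]⟩)

/-- The cone homotopy on cochains with compact support. -/
noncomputable def IsCarried.homotopy (h : IsCarried K L D c P a) (k : ℕ) :
    cochain R K L (k + 1) →ₗ[R] cochain R K L k where
  toFun φ := ⟨restrict K (coneHomotopy D c k φ.1), h.restrict_coneHomotopy_mem φ.2⟩
  map_add' φ ψ := Subtype.ext (by
    simp only [Submodule.coe_add, coneHomotopy_add, restrict_add])
  map_smul' r φ := Subtype.ext (by
    simp only [Submodule.coe_smul, coneHomotopy_smul, restrict_smul, RingHom.id_apply])

/-- The truncated coboundary and the formal face sum may differ off `K`, but the homotopy sees only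
carried tuples. On these `carrier_faces` gives either a simplex of `K`, where they agree, or a set
whose faces in `K` lie in `L`, where both vanish; degenerate tuples also give zero for both. -/
theorem IsCarried.coneHomotopy_coboundaryFun (h : IsCarried K L D c P a) {k : ℕ}
    {φ : (Fin (k + 1) → W) → R} (hφ : φ ∈ cochain R K L k) {v : Fin (k + 1) → W}
    (hK : entries v ∈ K.faces) :
    coneHomotopy D c k (coboundaryFun R K φ) v = coneHomotopy D c k (faceSum R φ) v := by
  obtain ⟨halt, hsupp, -⟩ := mem_cochain.mp hφ
  refine h.coneHomotopy_congr (a (entries v)) k _ _ v ?_ fun g hg => ?_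
  · rw [← coe_entries]
    exact h.carrier _ hK
  · by_cases hinj : Function.Injective g
    · rw [← coe_entries] at hg
      rcases h.carrier_faces _ hK _ (entries_nonempty g) hg with hgK | hgL
      · exact coboundaryFun_of_mem φ hinj hgK
      · have hzero : ∀ i : Fin (k + 2), φ (g ∘ i.succAbove) = 0 := by
          intro i
          by_contra hne
          obtain ⟨-, h1, h2⟩ := hsupp _ hne
          exact h2 (hgL _ (entries_comp_subset g _) h1)
        have hface : faceSum R φ g = 0 := Finset.sum_eq_zero fun i _ => by rw [hzero, mul_zero]
        rw [hface]
        by_cases hgK : entries g ∈ K.faces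
        · rw [coboundaryFun_of_mem φ hinj hgK, hface]
        · exact coboundaryFun_of_not φ fun hh => hgK hh.2
    · rw [coboundaryFun_of_not φ fun hh => hinj hh.1,
        faceSum_of_not_injective halt (fun v hv => (hsupp v hv).1) hinj]

theorem IsCarried.homotopy_coboundary_zero (h : IsCarried K L D c P a)
    (hKL : LocallyFiniteOff K L) (φ : cochain R K L 0) {v : Fin 1 → W}
    (hv : Function.Injective v) (hK : entries v ∈ K.faces) :
    (h.homotopy 0 (coboundary R hKL 0 φ)).1 v = D 0 φ.1 v := by
  change restrict K (coneHomotopy D c 0 (coboundaryFun R K φ.1)) v = _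
  rw [restrict_of_mem _ hv hK, h.coneHomotopy_coboundaryFun φ.2 hK,
    coneHomotopy_zero_faceSum h.const]

theorem IsCarried.coboundary_homotopy_add (h : IsCarried K L D c P a)
    (hKL : LocallyFiniteOff K L) {k : ℕ} (φ : cochain R K L (k + 1)) {v : Fin (k + 2) → W}
    (hv : Function.Injective v) (hK : entries v ∈ K.faces) :
    (coboundary R hKL k (h.homotopy k φ)).1 v +
      (h.homotopy (k + 1) (coboundary R hKL (k + 1) φ)).1 v = D (k + 1) φ.1 v := by
  change coboundaryFun R K (restrict K (coneHomotopy D c k φ.1)) v +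
    restrict K (coneHomotopy D c (k + 1) (coboundaryFun R K φ.1)) v = _
  rw [restrict_of_mem _ hv hK, h.coneHomotopy_coboundaryFun φ.2 hK, coboundaryFun_of_mem _ hv hK,
    ← faceSum_coneHomotopy_add h.const h.comm k φ.1, Pi.add_apply]
  congr 1
  refine Finset.sum_congr rfl fun i _ => ?_
  rw [restrict_of_mem _ (hv.comp Fin.succAbove_right_injective)]
  exact (K.isRelLowerSet_faces hK).2 (entries_comp_subset v _) (entries_nonempty _)

end CarrierHomotopy

/-! ### From linear homotopies to a quasi-isomorphism. -/

section Homological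

open CategoryTheory

variable {R : Type*} [CommRing R]

theorem quasiIso_of_linear_homotopies.{v} {X Y : ℕ → Type v}
    [∀ n, AddCommGroup (X n)] [∀ n, Module R (X n)]
    [∀ n, AddCommGroup (Y n)] [∀ n, Module R (Y n)]
    (dX : ∀ n, X n →ₗ[R] X (n + 1)) (dY : ∀ n, Y n →ₗ[R] Y (n + 1))
    (hX : ∀ n x, dX (n + 1) (dX n x) = 0) (hY : ∀ n x, dY (n + 1) (dY n x) = 0)
    (α : ∀ n, X n →ₗ[R] Y n) (β : ∀ n, Y n →ₗ[R] X n)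
    (hα : ∀ n x, α (n + 1) (dX n x) = dY n (α n x))
    (hβ : ∀ n x, β (n + 1) (dY n x) = dX n (β n x))
    (s : ∀ n, X (n + 1) →ₗ[R] X n) (t : ∀ n, Y (n + 1) →ₗ[R] Y n)
    (hs0 : ∀ x, s 0 (dX 0 x) = β 0 (α 0 x) - x)
    (hs : ∀ n x, dX n (s n x) + s (n + 1) (dX (n + 1) x) = β (n + 1) (α (n + 1) x) - x)
    (ht0 : ∀ y, t 0 (dY 0 y) = α 0 (β 0 y) - y)
    (ht : ∀ n y, dY n (t n y) + t (n + 1) (dY (n + 1) y) = α (n + 1) (β (n + 1) y) - y) :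
    ∃ f : CochainComplex.of (fun n => ModuleCat.of R (X n)) (fun n => ModuleCat.ofHom (dX n))
        (fun n => by ext x; exact hX n x) ⟶
      CochainComplex.of (fun n => ModuleCat.of R (Y n)) (fun n => ModuleCat.ofHom (dY n))
        (fun n => by ext x; exact hY n x), QuasiIso f := by
  set K := CochainComplex.of (fun n => ModuleCat.of R (X n)) (fun n => ModuleCat.ofHom (dX n))
    (fun n => by ext x; exact hX n x) with hK
  set L := CochainComplex.of (fun n => ModuleCat.of R (Y n)) (fun n => ModuleCat.ofHom (dY n))
    (fun n => by ext x; exact hY n x) with hL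
  have dK : ∀ n, K.d n (n + 1) = ModuleCat.ofHom (dX n) := fun n =>
    CochainComplex.of_d (fun n => ModuleCat.of R (X n)) (fun n => ModuleCat.ofHom (dX n)) n
  have dL : ∀ n, L.d n (n + 1) = ModuleCat.ofHom (dY n) := fun n =>
    CochainComplex.of_d (fun n => ModuleCat.of R (Y n)) (fun n => ModuleCat.ofHom (dY n)) n
  let f : K ⟶ L := CochainComplex.ofHom (fun n => ModuleCat.ofHom (α n)) (fun n => by
    rw [dK, dL]; ext x; exact (hα n x).symm)
  let g : L ⟶ K := CochainComplex.ofHom (fun n => ModuleCat.ofHom (β n)) (fun n => by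
    rw [dK, dL]; ext x; exact (hβ n x).symm)
  let hs' : ∀ i j, (ComplexShape.up ℕ).Rel j i → (K.X i ⟶ K.X j) := fun i j hij => by
    obtain rfl : j + 1 = i := hij
    exact ModuleCat.ofHom (s j)
  let ht' : ∀ i j, (ComplexShape.up ℕ).Rel j i → (L.X i ⟶ L.X j) := fun i j hij => by
    obtain rfl : j + 1 = i := hij
    exact ModuleCat.ofHom (t j)
  have rel : ∀ n, (ComplexShape.up ℕ).Rel n (n + 1) := fun n => rfl
  have notrel : ∀ l, ¬ (ComplexShape.up ℕ).Rel l 0 := fun l h => Nat.succ_ne_zero l h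
  have e1 : f ≫ g - 𝟙 K = Homotopy.nullHomotopicMap' hs' := by
    ext n x
    cases n with
    | zero =>
      rw [Homotopy.nullHomotopicMap'_f_of_not_rel_right (rel 0) notrel, dK]
      exact (hs0 x).symm
    | succ n =>
      rw [Homotopy.nullHomotopicMap'_f (rel n) (rel (n + 1)), dK, dK]
      exact (hs n x).symm.trans (add_comm _ _)
  have e2 : g ≫ f - 𝟙 L = Homotopy.nullHomotopicMap' ht' := by
    ext n x
    cases n with
    | zero =>
      rw [Homotopy.nullHomotopicMap'_f_of_not_rel_right (rel 0) notrel, dL]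
      exact (ht0 x).symm
    | succ n =>
      rw [Homotopy.nullHomotopicMap'_f (rel n) (rel (n + 1)), dL, dL]
      exact (ht n x).symm.trans (add_comm _ _)
  let e : HomotopyEquiv K L :=
    { hom := f
      inv := g
      homotopyHomInvId := (Homotopy.equivSubZero).symm
        ((Homotopy.ofEq e1).trans (Homotopy.nullHomotopy' hs'))
      homotopyInvHomId := (Homotopy.equivSubZero).symm
        ((Homotopy.ofEq e2).trans (Homotopy.nullHomotopy' ht')) }
  exact ⟨f, e.quasiIso_hom⟩

end Homological

/-! ### Barycentric subdivision of cochains. -/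

section Subdivision

variable {V : Type*} {R : Type*} [CommRing R]

/-- The flag of initial segments of a tuple of vertices. -/
noncomputable def flag {n : ℕ} (v : Fin n → V) (j : Fin n) : Finset V :=
  entries (fun i : Fin (j.1 + 1) => v (Fin.castLE j.2 i))

theorem mem_flag {n : ℕ} {v : Fin n → V} {j : Fin n} {x : V} :
    x ∈ flag v j ↔ ∃ i ≤ j, v i = x := by
  rw [flag, mem_entries]
  constructor
  · rintro ⟨i, rfl⟩
    exact ⟨_, Fin.le_def.mpr (Nat.lt_succ_iff.mp i.2), rfl⟩
  · rintro ⟨i, hi, rfl⟩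
    exact ⟨⟨i.1, Nat.lt_succ_of_le hi⟩, rfl⟩

theorem flag_nonempty {n : ℕ} (v : Fin n → V) (j : Fin n) : (flag v j).Nonempty :=
  entries_nonempty _

theorem flag_mono {n : ℕ} (v : Fin n → V) {i j : Fin n} (h : i ≤ j) : flag v i ⊆ flag v j := by
  intro x hx
  obtain ⟨l, hl, rfl⟩ := mem_flag.mp hx
  exact mem_flag.mpr ⟨l, hl.trans h, rfl⟩

theorem flag_subset_entries {n : ℕ} (v : Fin n → V) (j : Fin n) : flag v j ⊆ entries v := by
  intro x hx
  obtain ⟨l, -, rfl⟩ := mem_flag.mp hx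
  exact mem_entries.mpr ⟨l, rfl⟩

theorem flag_last {n : ℕ} (v : Fin (n + 1) → V) : flag v (Fin.last n) = entries v := by
  ext x
  rw [mem_flag, mem_entries]
  exact ⟨fun ⟨i, _, h⟩ => ⟨i, h⟩, fun ⟨i, h⟩ => ⟨i, Fin.le_last i, h⟩⟩

theorem flag_injective_iff {n : ℕ} {v : Fin (n + 1) → V} :
    Function.Injective (flag v) ↔ Function.Injective v := by
  constructor
  · intro h
    have key : ∀ a b, a < b → v a ≠ v b := by
      intro a b hab hv
      obtain ⟨b, rfl⟩ := Fin.exists_succ_eq.mpr (Fin.ne_zero_of_lt hab)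
      have hab' : a ≤ b.castSucc := Fin.le_castSucc_iff.mpr hab
      refine (Fin.castSucc_lt_succ (i := b)).ne
        (h ((flag_mono v Fin.castSucc_lt_succ.le).antisymm ?_))
      intro x hx
      obtain ⟨l, hl, rfl⟩ := mem_flag.mp hx
      rcases hl.lt_or_eq with hlt | rfl
      · exact mem_flag.mpr ⟨l, Fin.le_castSucc_iff.mpr hlt, rfl⟩
      · exact mem_flag.mpr ⟨a, hab', hv⟩
    intro a b hab
    by_contra hne
    rcases lt_or_gt_of_ne hne with hlt | hlt
    · exact key a b hlt hab
    · exact key b a hlt hab.symm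
  · intro h
    have key : ∀ a b, a < b → flag v a ≠ flag v b := by
      intro a b hab he
      have : v b ∈ flag v a := he ▸ mem_flag.mpr ⟨b, le_rfl, rfl⟩
      obtain ⟨l, hl, hlb⟩ := mem_flag.mp this
      exact (hl.trans_lt hab).ne (h hlb)
    intro a b hab
    by_contra hne
    rcases lt_or_gt_of_ne hne with hlt | hlt
    · exact key a b hlt hab
    · exact key b a hlt hab.symm

theorem isChain_range_flag {n : ℕ} (v : Fin n → V) :
    IsChain (fun s t : Finset V => s ⊆ t) (Set.range (flag v)) := by
  rintro _ ⟨i, rfl⟩ _ ⟨j, rfl⟩ -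
  exact (le_total i j).imp (flag_mono v) (flag_mono v)

/-- The transpose of the barycentric subdivision of ordered simplices. -/
noncomputable def subdivide (k : ℕ) :
    ((Fin (k + 1) → Finset V) → R) →ₗ[R] ((Fin (k + 1) → V) → R) where
  toFun φ v := ∑ π : Equiv.Perm (Fin (k + 1)), ((Equiv.Perm.sign π : ℤ) : R) * φ (flag (v ∘ π))
  map_add' φ ψ := by
    funext v
    simp [mul_add, Finset.sum_add_distrib]
  map_smul' r φ := by
    funext v
    simp [Finset.mul_sum, mul_left_comm]

theorem subdivide_apply {k : ℕ} (φ : (Fin (k + 1) → Finset V) → R) (v : Fin (k + 1) → V) :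
    subdivide k φ v =
      ∑ π : Equiv.Perm (Fin (k + 1)), ((Equiv.Perm.sign π : ℤ) : R) * φ (flag (v ∘ π)) :=
  rfl

theorem alternating_subdivide {k : ℕ} (φ : (Fin (k + 1) → Finset V) → R) :
    Alternating (subdivide k φ) := by
  intro v τ
  rw [subdivide_apply, subdivide_apply, Finset.mul_sum,
    ← Equiv.sum_comp (Equiv.mulLeft τ) (fun π => ((Equiv.Perm.sign τ : ℤ) : R) *
      (((Equiv.Perm.sign π : ℤ) : R) * φ (flag (v ∘ π))))]
  refine Finset.sum_congr rfl fun π _ => ?_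
  rw [Equiv.coe_mulLeft, Equiv.Perm.sign_mul, ← mul_assoc]
  have h2 : ((Equiv.Perm.sign τ : ℤ) : R) * ((Equiv.Perm.sign τ : ℤ) : R) = 1 := by
    rw [← Int.cast_mul, ← Units.val_mul, Int.units_mul_self]
    simp
  congr 1
  push_cast
  linear_combination (-((Equiv.Perm.sign π : ℤ) : R)) * h2

/-- Exchanging two adjacent entries changes only the initial segment that ends between them. -/
theorem flag_comp_swap {n : ℕ} (v : Fin (n + 2) → V) (i : Fin (n + 1)) {j : Fin (n + 2)}
    (hj : j ≠ i.castSucc) : flag (v ∘ Equiv.swap i.castSucc i.succ) j = flag v j := by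
  have key : ∀ v : Fin (n + 2) → V,
      flag (v ∘ Equiv.swap i.castSucc i.succ) j ⊆ flag v j := by
    intro v x hx
    obtain ⟨l, hl, rfl⟩ := mem_flag.mp hx
    refine mem_flag.mpr ⟨Equiv.swap i.castSucc i.succ l, ?_, rfl⟩
    have hji : j.1 ≠ i.1 := fun h => hj (Fin.ext h)
    have hl' : l.1 ≤ j.1 := hl
    rw [Equiv.swap_apply_def]
    split_ifs with h1 h2
    · subst h1
      rw [Fin.le_def, Fin.val_succ]
      rw [Fin.val_castSucc] at hl'
      omega
    · subst h2
      rw [Fin.le_def, Fin.val_castSucc]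
      rw [Fin.val_succ] at hl'
      omega
    · exact hl
  refine (key v).antisymm ?_
  have := key (v ∘ Equiv.swap i.castSucc i.succ)
  rwa [Function.comp_assoc, ← Equiv.coe_trans, Equiv.swap_swap, Equiv.coe_refl,
    Function.comp_id] at this

theorem flag_comp_castSucc {n : ℕ} (v : Fin (n + 1) → V) :
    flag v ∘ Fin.castSucc = flag (v ∘ Fin.castSucc) := by
  funext j
  ext x
  simp only [Function.comp_apply, mem_flag]
  constructor
  · rintro ⟨i, hi, rfl⟩
    have hi' : i.1 ≤ j.1 := hi
    exact ⟨⟨i.1, by omega⟩, hi', rfl⟩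
  · rintro ⟨i, hi, rfl⟩
    exact ⟨i.castSucc, hi, rfl⟩

/-- Dual to subdivision being a chain map. Faces of a flag omitting a member other than the top
cancel in pairs `π`, `π * swap`; omitting the top leaves the flags of the codimension one faces,
indexed by the omitted vertex `π (last)` and an ordering of the remaining ones. -/
theorem subdivide_faceSum (k : ℕ) (φ : (Fin (k + 1) → Finset V) → R) :
    subdivide (k + 1) (faceSum R φ) = faceSum R (subdivide k φ) := by
  funext v
  have hinner : ∀ i : Fin (k + 1), ∑ π : Equiv.Perm (Fin (k + 2)),
      ((Equiv.Perm.sign π : ℤ) : R) * φ (flag (v ∘ π) ∘ i.castSucc.succAbove) = 0 := by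
    intro i
    have hne : i.castSucc ≠ i.succ := Fin.castSucc_lt_succ.ne
    refine Finset.sum_involution (fun π _ => π * Equiv.swap i.castSucc i.succ) ?_ ?_ ?_ ?_
    · intro π _
      have : flag (v ∘ ⇑(π * Equiv.swap i.castSucc i.succ)) ∘ i.castSucc.succAbove =
          flag (v ∘ π) ∘ i.castSucc.succAbove := by
        funext j
        simp only [Function.comp_apply]
        rw [Equiv.Perm.coe_mul, ← Function.comp_assoc,
          flag_comp_swap _ _ (Fin.succAbove_ne i.castSucc j)]
      rw [this, Equiv.Perm.sign_mul, Equiv.Perm.sign_swap hne]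
      simp
    · intro π _ _ h
      have h' := congrArg (fun τ : Equiv.Perm (Fin (k + 2)) => τ i.succ) h
      simp only [Equiv.Perm.mul_apply, Equiv.swap_apply_right] at h'
      exact hne (π.injective h')
    · exact fun _ _ => Finset.mem_univ _
    · intro π _
      simp [mul_assoc]
  have hL : subdivide (k + 1) (faceSum R φ) v = ∑ π : Equiv.Perm (Fin (k + 2)),
      ((Equiv.Perm.sign π : ℤ) : R) * ((-1) ^ (k + 1) * φ (flag (v ∘ π ∘ Fin.castSucc))) := by
    simp only [subdivide_apply, faceSum]
    simp_rw [Fin.sum_univ_castSucc (n := k + 1), mul_add]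
    rw [Finset.sum_add_distrib]
    have h0 : ∑ π : Equiv.Perm (Fin (k + 2)), ((Equiv.Perm.sign π : ℤ) : R) *
        ∑ i : Fin (k + 1), (-1 : R) ^ (i.castSucc : ℕ) *
          φ (flag (v ∘ π) ∘ i.castSucc.succAbove) = 0 := by
      simp_rw [Finset.mul_sum]
      rw [Finset.sum_comm]
      refine Finset.sum_eq_zero fun i _ => ?_
      simp_rw [mul_left_comm _ ((-1 : R) ^ _) _]
      rw [← Finset.mul_sum, hinner, mul_zero]
    rw [h0, zero_add]
    refine Finset.sum_congr rfl fun π _ => ?_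
    rw [Fin.succAbove_last, flag_comp_castSucc, Fin.val_last, Function.comp_assoc]
  rw [hL]
  choose e he hsgn using fun π : Equiv.Perm (Fin (k + 2)) =>
    exists_perm_succAbove π (Fin.last (k + 1))
  have hinj : Function.Injective (fun π : Equiv.Perm (Fin (k + 2)) => (π (Fin.last (k + 1)), e π)) := by
    intro π τ h
    simp only [Prod.mk.injEq] at h
    ext1 j
    rcases Fin.eq_castSucc_or_eq_last j with ⟨j, rfl⟩ | rfl
    · have h1 := he π j
      have h2 := he τ j
      rw [Fin.succAbove_last] at h1 h2
      rw [h1, h2, h.1, h.2]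
    · exact h.1
  -- Injectivity suffices, since `(k + 2)! = (k + 2) * (k + 1)!`.
  have hbij : Function.Bijective
      (fun π : Equiv.Perm (Fin (k + 2)) => (π (Fin.last (k + 1)), e π)) := by
    refine (Fintype.bijective_iff_injective_and_card _).mpr ⟨hinj, ?_⟩
    rw [Fintype.card_prod, Fintype.card_perm, Fintype.card_perm, Fintype.card_fin, Fintype.card_fin,
      Nat.factorial_succ]
  simp only [faceSum, subdivide_apply, Finset.mul_sum]
  rw [← Finset.sum_product', Finset.univ_product_univ]
  refine Fintype.sum_bijective _ hbij _ _ fun π => ?_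
  have h1 : (v ∘ (π (Fin.last (k + 1))).succAbove) ∘ (e π) = v ∘ π ∘ Fin.castSucc := by
    funext j
    have := he π j
    rw [Fin.succAbove_last] at this
    simp [this]
  have h2 := congrArg (Int.cast : ℤ → R) (hsgn π)
  rw [Fin.val_last] at h2
  push_cast at h2
  have h3 : ((-1 : R) ^ (k + 1)) * ((-1 : R) ^ (k + 1)) = 1 := by
    rw [← mul_pow]; simp
  have h4 : (((-1 : R) ^ ((π (Fin.last (k + 1)) : Fin (k + 2)) : ℕ))) *
      ((-1 : R) ^ ((π (Fin.last (k + 1)) : Fin (k + 2)) : ℕ)) = 1 := by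
    rw [← mul_pow]; simp
  rw [h1, ← mul_assoc, ← mul_assoc]
  congr 1
  set x := (-1 : R) ^ (k + 1)
  set y := (-1 : R) ^ ((π (Fin.last (k + 1)) : Fin (k + 2)) : ℕ)
  linear_combination (-(x * y)) * h2 - (((Equiv.Perm.sign π : ℤ) : R) * x) * h4 +
    (y * ((Equiv.Perm.sign (e π) : ℤ) : R)) * h3

/-- Pullback of functions of tuples along a map of vertices. -/
def pullback {W : Type*} (g : W → V) (k : ℕ) :
    ((Fin (k + 1) → V) → R) →ₗ[R] ((Fin (k + 1) → W) → R) where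
  toFun φ f := φ (g ∘ f)
  map_add' _ _ := rfl
  map_smul' _ _ := rfl

theorem pullback_apply {W : Type*} (g : W → V) {k : ℕ} (φ : (Fin (k + 1) → V) → R)
    (f : Fin (k + 1) → W) : pullback g k φ f = φ (g ∘ f) := rfl

theorem Alternating.pullback {W : Type*} (g : W → V) {k : ℕ} {φ : (Fin (k + 1) → V) → R}
    (h : Alternating φ) : Alternating (pullback g k φ) :=
  fun f π => h (g ∘ f) π

theorem Alternating.sub {n : ℕ} {φ ψ : (Fin n → V) → R} (h : Alternating φ) (h' : Alternating ψ) :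
    Alternating (φ - ψ) := fun v π => by
  rw [Pi.sub_apply, h, h', ← mul_sub, Pi.sub_apply]

theorem exists_top_of_isChain {c : Finset (Finset V)} (hne : c.Nonempty)
    (hc : IsChain (fun s t : Finset V => s ⊆ t) (c : Set (Finset V))) :
    ∃ s ∈ c, ∀ t ∈ c, t ⊆ s := by
  obtain ⟨s, hs, hmax⟩ := c.exists_max_image Finset.card hne
  refine ⟨s, hs, fun t ht => ?_⟩
  rcases hc.total ht hs with h | h
  · exact h
  · exact (Finset.eq_of_subset_of_card_le h (hmax t ht)).symm.subset

end Subdivision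

/-! ### Subdivision and vertex map as homotopy inverses. -/

section Carriers

variable {V : Type*} {R : Type*} [CommRing R] {K L : PreAbstractSimplicialComplex V}
  {g : Finset V → V}

/-- The union of the entries of a tuple of finite sets. -/
noncomputable def unionEntries {n : ℕ} (f : Fin n → Finset V) : Finset V :=
  (Set.finite_iUnion fun j => (f j).finite_toSet).toFinset

theorem mem_unionEntries {n : ℕ} {f : Fin n → Finset V} {x : V} :
    x ∈ unionEntries f ↔ ∃ j, x ∈ f j := by
  simp [unionEntries]

/-- The union of a finite family of finite sets. -/
noncomputable def unionFinset (c : Finset (Finset V)) : Finset V :=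
  (c.finite_toSet.biUnion fun s _ => s.finite_toSet).toFinset

theorem mem_unionFinset {c : Finset (Finset V)} {x : V} :
    x ∈ unionFinset c ↔ ∃ s ∈ c, x ∈ s := by
  simp [unionFinset]

theorem subset_unionFinset {c : Finset (Finset V)} {s : Finset V} (hs : s ∈ c) :
    s ⊆ unionFinset c := fun _ hx => mem_unionFinset.mpr ⟨s, hs, hx⟩

theorem unionEntries_eq {n : ℕ} (f : Fin n → Finset V) : unionEntries f = unionFinset (entries f) := by
  ext x
  rw [mem_unionEntries, mem_unionFinset]
  constructor
  · rintro ⟨j, hj⟩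
    exact ⟨f j, mem_entries.mpr ⟨j, rfl⟩, hj⟩
  · rintro ⟨s, hs, hx⟩
    obtain ⟨j, rfl⟩ := mem_entries.mp hs
    exact ⟨j, hx⟩

theorem unionFinset_mem {c : Finset (Finset V)} (hne : c.Nonempty)
    (hc : IsChain (fun s t : Finset V => s ⊆ t) (c : Set (Finset V))) : unionFinset c ∈ c := by
  obtain ⟨s, hs, hs'⟩ := exists_top_of_isChain hne hc
  convert hs
  refine Finset.Subset.antisymm (fun x hx => ?_) (subset_unionFinset hs)
  obtain ⟨t, ht, hx⟩ := mem_unionFinset.mp hx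
  exact hs' t ht hx

theorem exists_vertex_of_mem {s : Finset V} (hs : s ∈ L.faces) : ∃ v ∈ s, {v} ∈ L.faces := by
  obtain ⟨v, hv⟩ := (L.isRelLowerSet_faces hs).1
  exact ⟨v, hv, (L.isRelLowerSet_faces hs).2 (by simpa using hv) (Finset.singleton_nonempty v)⟩

/-- A flag of simplices of `K` either lies in `retract K L`, or all its faces lying in
`retract K L` lie in `retractBoundary K L`. -/
theorem mem_retract_or {c : Finset (Finset V)} (hc : c ∈ (barycentric K).faces) :
    c ∈ (retract K L).faces ∨
      ∀ u ⊆ c, u ∈ (retract K L).faces → u ∈ (retractBoundary K L).faces := by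
  by_cases h : ∀ s ∈ c, s ∉ L.faces
  · exact Or.inl ⟨hc, h⟩
  · push Not at h
    obtain ⟨s, hs, hsL⟩ := h
    refine Or.inr fun u hu huK => ⟨huK, fun t ht => ?_⟩
    rcases hc.2.2.total hs (hu ht) with hst | hts
    · obtain ⟨v, hv, hvL⟩ := exists_vertex_of_mem hsL
      exact ⟨v, hst hv, hvL⟩
    · exact absurd ((L.isRelLowerSet_faces hsL).2 hts (K.isRelLowerSet_faces (huK.1.2.1 t ht)).1)
        (huK.2 t ht)

/-- The chains in a set of nonempty finite sets which is closed under the vertex map `g`. -/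
def ChainCarrier (g : Finset V → V) (A : Set (Finset V)) (T : Set (Finset V)) : Prop :=
  (∀ t ∈ A, t.Nonempty) ∧
    (∀ (n : ℕ) (f : Fin (n + 1) → Finset V), (∀ j, f j ∈ A) → entries (g ∘ f) ∈ A) ∧
    T ⊆ A ∧ IsChain (fun s t : Finset V => s ⊆ t) T

theorem flag_comp_mem {A : Set (Finset V)}
    (hA : ∀ (n : ℕ) (f : Fin (n + 1) → Finset V), (∀ j, f j ∈ A) → entries (g ∘ f) ∈ A)
    {n : ℕ} {f : Fin n → Finset V} (hf : ∀ j, f j ∈ A) (j : Fin n) : flag (g ∘ f) j ∈ A :=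
  hA j.1 (fun i => f (Fin.castLE j.2 i)) fun _ => hf _

/-- The carrier of a flag consists of the chains of nonempty subsets of its top simplex. Subsets in
`L` have to be allowed, because `g` may send a flag to vertices of `L`; `mem_retract_or` makes the
resulting flags outside `retract K L` harmless. Coning is from the union of the tuple, which is its
top simplex. -/
theorem isCarried_retract (hg : ∀ t : Finset V, t.Nonempty → g t ∈ t)
    (hgL : ∀ t : Finset V, (∃ v ∈ t, {v} ∈ L.faces) → {g t} ∈ L.faces)
    (hfin : LocallyFiniteOff K L) :
    IsCarried (R := R) (retract K L) (retractBoundary K L)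
      (fun k => pullback g k ∘ₗ subdivide k - LinearMap.id) (fun _ f => unionEntries f)
      (ChainCarrier g) (fun c => {s | s.Nonempty ∧ s ⊆ unionFinset c}) where
  const r := by
    funext f
    simp [pullback_apply, subdivide_apply]
  comm k φ := by
    simp only [LinearMap.sub_apply, LinearMap.comp_apply, LinearMap.id_apply, subdivide_faceSum,
      faceSum_sub]
    rfl
  alternating k φ h := ((alternating_subdivide φ).pullback g).sub h
  perm k f π := by rw [unionEntries_eq, unionEntries_eq, entries_comp_perm]
  mono A T T' hT h := ⟨h.1, h.2.1, hT.trans h.2.2.1, h.2.2.2.mono hT⟩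
  eq_zero A k φ f hf hφ := by
    obtain ⟨hA1, hA2, hfA, hch⟩ := hf
    have hfA' : ∀ j, f j ∈ A := fun j => hfA ⟨j, rfl⟩
    have h1 : subdivide k φ (g ∘ f) = 0 := by
      refine Finset.sum_eq_zero fun π _ => ?_
      rw [hφ, mul_zero]
      refine ⟨hA1, hA2, ?_, isChain_range_flag _⟩
      rintro _ ⟨j, rfl⟩
      exact flag_comp_mem (f := f ∘ π) hA2 (fun j => hfA' (π j)) j
    change subdivide k φ (g ∘ f) - φ f = 0
    rw [h1, hφ f ⟨hA1, hA2, hfA, hch⟩, sub_zero]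
  cone A k f hf := by
    obtain ⟨hA1, hA2, hfA, hch⟩ := hf
    have hmem : unionEntries f ∈ A := by
      rw [unionEntries_eq]
      have hmem' := unionFinset_mem (c := entries f) (entries_nonempty f) (by rwa [coe_entries])
      obtain ⟨j, hj⟩ := mem_entries.mp hmem'
      rw [← hj]
      exact hfA ⟨j, rfl⟩
    -- Restricting to subsets of the top simplex keeps the family stable under `g`, since `g t ∈ t`,
    -- and makes any chain in it remain a chain once the top is added.
    refine ⟨A ∩ {t | t ⊆ unionEntries f}, ⟨fun t ht => hA1 t ht.1, ?_, ?_, hch⟩, ?_⟩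
    · refine fun n f' hf' => ⟨hA2 n f' fun j => (hf' j).1, fun x hx => ?_⟩
      obtain ⟨j, rfl⟩ := mem_entries.mp hx
      exact (hf' j).2 (hg _ (hA1 _ (hf' j).1))
    · rintro _ ⟨j, rfl⟩
      exact ⟨hfA ⟨j, rfl⟩, fun x hx => mem_unionEntries.mpr ⟨j, hx⟩⟩
    · rintro T ⟨-, -, hTA, hTch⟩
      refine ⟨hA1, hA2, Set.insert_subset hmem fun t ht => (hTA ht).1, ?_⟩
      exact hTch.insert fun t ht _ => Or.inr (hTA ht).2
  carrier t ht := by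
    refine ⟨fun s hs => hs.1, fun n f hf => ⟨entries_nonempty _, fun x hx => ?_⟩,
      fun s hs => ⟨(K.isRelLowerSet_faces (ht.1.2.1 s hs)).1, subset_unionFinset hs⟩, ht.1.2.2⟩
    obtain ⟨j, rfl⟩ := mem_entries.mp hx
    exact (hf j).2 (hg _ (hf j).1)
  carrier_faces t ht u hu hP := by
    obtain ⟨-, -, huA, hch⟩ := hP
    have htop : unionFinset t ∈ K.faces := ht.1.2.1 _ (unionFinset_mem ht.1.1 ht.1.2.2)
    exact mem_retract_or ⟨hu, fun s hs => (K.isRelLowerSet_faces htop).2 (huA hs).2 (huA hs).1, hch⟩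
  carrier_boundary t ht htL := by
    -- Sets with a vertex in `L` form a stable family precisely because `g` prefers vertices in `L`.
    refine ⟨{s | ∃ v ∈ s, ({v} : Finset V) ∈ L.faces}, ⟨?_, ?_, fun s hs => htL.2 s hs, ht.1.2.2⟩, ?_⟩
    · rintro s ⟨v, hv, -⟩
      exact ⟨v, hv⟩
    · exact fun n f hf => ⟨g (f 0), mem_entries.mpr ⟨0, rfl⟩, hgL _ (hf 0)⟩
    · rintro u hu ⟨-, -, huA, -⟩
      exact ⟨hu, fun s hs => huA hs⟩
  carrier_finite u hu huL := by
    -- Any flag whose carrier contains `u` has a top simplex containing this `s`; there are finitely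
    -- many such simplices, as `s` is not in `L`.
    have hex : ∃ s ∈ u, ¬ ∃ v ∈ s, {v} ∈ L.faces := by
      by_contra! hcon
      exact huL ⟨hu, hcon⟩
    obtain ⟨s, hs, hsL⟩ := hex
    have hA := hfin s (hu.1.2.1 s hs) (hu.2 s hs)
    refine (hA.biUnion (t := fun t' => (t'.powerset.powerset : Set (Finset (Finset V))))
      fun t' _ => Finset.finite_toSet _).subset ?_
    rintro t ⟨ht, -, -, huA, -⟩
    have htop : unionFinset t ∈ K.faces := ht.1.2.1 _ (unionFinset_mem ht.1.1 ht.1.2.2)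
    refine Set.mem_biUnion (show unionFinset t ∈ {t | t ∈ K.faces ∧ s ⊆ t} from
      ⟨htop, (huA hs).2⟩) ?_
    rw [Finset.mem_coe, Finset.mem_powerset]
    exact fun s' hs' => Finset.mem_powerset.mpr (subset_unionFinset hs')

/-- The carrier of a simplex is the simplex itself, and any of its vertices can serve as cone point.
-/
theorem isCarried_original (hg : ∀ t : Finset V, t.Nonempty → g t ∈ t)
    (hfin : LocallyFiniteOff K L) :
    IsCarried (R := R) K L
      (fun k => subdivide k ∘ₗ pullback g k - LinearMap.id) (fun _ f => g (entries f))
      (fun (A T : Set V) => T ⊆ A) (fun c => (c : Set V)) where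
  const r := by
    funext f
    simp [pullback_apply, subdivide_apply]
  comm k φ := by
    simp only [LinearMap.sub_apply, LinearMap.comp_apply, LinearMap.id_apply, faceSum_sub]
    rw [← subdivide_faceSum]
    rfl
  alternating k φ h := (alternating_subdivide _).sub h
  perm k f π := by rw [entries_comp_perm]
  mono A T T' hT h := hT.trans h
  eq_zero A k φ f hf hφ := by
    have h1 : subdivide k (pullback g k φ) f = 0 := by
      refine Finset.sum_eq_zero fun π _ => ?_
      rw [pullback_apply, hφ, mul_zero]
      rintro _ ⟨j, rfl⟩
      have h2 := flag_subset_entries _ j (hg _ (flag_nonempty (f ∘ π) j))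
      rw [entries_comp_perm, mem_entries] at h2
      exact hf h2
    change subdivide k (pullback g k φ) f - φ f = 0
    rw [h1, hφ f hf, sub_zero]
  cone A k f hf := by
    refine ⟨A, hf, fun T hT => Set.insert_subset ?_ hT⟩
    exact hf (mem_entries.mp (hg _ (entries_nonempty f)))
  carrier t _ := subset_rfl
  carrier_faces t ht u hu hP := Or.inl ((K.isRelLowerSet_faces ht).2 (Finset.coe_subset.mp hP) hu)
  carrier_boundary t _ htL := ⟨(t : Set V), subset_rfl, fun u hu hut =>
    (L.isRelLowerSet_faces htL).2 (Finset.coe_subset.mp hut) (K.isRelLowerSet_faces hu).1⟩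
  carrier_finite u hu huL := by
    refine (hfin u hu huL).subset ?_
    rintro t ⟨ht, hut⟩
    exact ⟨ht, Finset.coe_subset.mp hut⟩

/-- The simplex spanned by `v` is the top of each of the flags of `v`, so the support conditions on
flags pass to it. -/
theorem subdivide_mem {k : ℕ} {φ : (Fin (k + 1) → Finset V) → R}
    (hφ : φ ∈ cochain R (retract K L) (retractBoundary K L) k) :
    subdivide k φ ∈ cochain R K L k := by
  obtain ⟨-, hsupp, hfin⟩ := mem_cochain.mp hφ
  have hex : ∀ v, subdivide k φ v ≠ 0 → ∃ π : Equiv.Perm (Fin (k + 1)), φ (flag (v ∘ π)) ≠ 0 := by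
    intro v hv
    by_contra! hcon
    exact hv (Finset.sum_eq_zero fun π _ => by rw [hcon, mul_zero])
  have hlast : ∀ (v : Fin (k + 1) → V) (π : Equiv.Perm (Fin (k + 1))),
      entries v ∈ entries (flag (v ∘ π)) := fun v π =>
    mem_entries.mpr ⟨Fin.last k, by rw [flag_last, entries_comp_perm]⟩
  refine mem_cochain.mpr ⟨alternating_subdivide φ, fun v hv => ?_, ?_⟩
  · obtain ⟨π, hπ⟩ := hex v hv
    obtain ⟨hinj, hK, -⟩ := hsupp _ hπ
    exact ⟨(Function.Injective.of_comp_iff' v π.bijective).mp (flag_injective_iff.mp hinj),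
      hK.1.2.1 _ (hlast v π), hK.2 _ (hlast v π)⟩
  · have hA : (⋃ f ∈ {f | φ f ≠ 0}, (entries f : Set (Finset V))).Finite :=
      hfin.biUnion fun f _ => Finset.finite_toSet _
    refine (finite_setOf_entries_mem hA).subset fun v hv => ?_
    obtain ⟨π, hπ⟩ := hex v hv
    exact Set.mem_biUnion (show flag (v ∘ π) ∈ {f | φ f ≠ 0} from hπ) (hlast v π)

/-- On `retractBoundary K L` the map `g` takes values in vertices of `L`, so fullness puts the image
in `L`. For finiteness, the image simplex is contained in the top of the flag, and a simplex off `L`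
is contained in only finitely many simplices. -/
theorem restrict_pullback_mem (hg : ∀ t : Finset V, t.Nonempty → g t ∈ t)
    (hgL : ∀ t : Finset V, (∃ v ∈ t, {v} ∈ L.faces) → {g t} ∈ L.faces)
    (hfull : ∀ s ∈ K.faces, (∀ v ∈ s, {v} ∈ L.faces) → s ∈ L.faces)
    (hfin : LocallyFiniteOff K L) {k : ℕ} {φ : (Fin (k + 1) → V) → R}
    (hφ : φ ∈ cochain R K L k) :
    restrict (retract K L) (pullback g k φ) ∈
      cochain R (retract K L) (retractBoundary K L) k := by
  obtain ⟨halt, hsupp, hfs⟩ := mem_cochain.mp hφ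
  refine mem_cochain.mpr ⟨(halt.pullback g).restrict, fun f hf => ?_, ?_⟩
  · obtain ⟨⟨hinj, hK⟩, hne⟩ := mem_of_restrict_ne_zero hf
    refine ⟨hinj, hK, fun hL => ?_⟩
    obtain ⟨-, hgK, hgL'⟩ := hsupp _ hne
    refine hgL' (hfull _ hgK fun v hv => ?_)
    obtain ⟨j, rfl⟩ := mem_entries.mp hv
    exact hgL _ (hL.2 _ (mem_entries.mpr ⟨j, rfl⟩))
  · have hA : (⋃ u ∈ {u | φ u ≠ 0}, ⋃ t ∈ {t ∈ K.faces | entries u ⊆ t},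
        (t.powerset.powerset : Set (Finset (Finset V)))).Finite :=
      hfs.biUnion fun u hu => (hfin _ (hsupp u hu).2.1 (hsupp u hu).2.2).biUnion
        fun t _ => Finset.finite_toSet _
    refine (finite_setOf_entries_mem hA).subset fun f hf => ?_
    obtain ⟨⟨hinj, hK⟩, hne⟩ := mem_of_restrict_ne_zero hf
    have htop := hK.1.2.1 _ (unionFinset_mem hK.1.1 hK.1.2.2)
    refine Set.mem_biUnion (show g ∘ f ∈ {u | φ u ≠ 0} from hne)
      (Set.mem_biUnion (show unionFinset (entries f) ∈ {t | t ∈ K.faces ∧ _} from ⟨htop, ?_⟩) ?_)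
    · intro x hx
      obtain ⟨j, rfl⟩ := mem_entries.mp hx
      have hj : f j ∈ entries f := mem_entries.mpr ⟨j, rfl⟩
      exact subset_unionFinset hj (hg _ (K.isRelLowerSet_faces (hK.1.2.1 _ hj)).1)
    · rw [Finset.mem_coe, Finset.mem_powerset]
      exact fun s' hs' => Finset.mem_powerset.mpr (subset_unionFinset hs')

theorem cochain_ext {W : Type*} {K L : PreAbstractSimplicialComplex W} {k : ℕ}
    {φ ψ : cochain R K L k}
    (h : ∀ v, Function.Injective v → entries v ∈ K.faces → φ.1 v = ψ.1 v) : φ = ψ := by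
  refine Subtype.ext (funext fun v => ?_)
  by_cases hv : Function.Injective v ∧ entries v ∈ K.faces
  · exact h v hv.1 hv.2
  · have hz : ∀ φ : cochain R K L k, φ.1 v = 0 := fun φ => by
      by_contra hne
      have := (mem_cochain.mp φ.2).2.1 v hne
      exact hv ⟨this.1, this.2.1⟩
    rw [hz, hz]

/-- The subdivision map `C_c(Δ⁺, ∂Δ⁺) → C_c(Δ, ∂Δ)`. -/
noncomputable def subdivideCochain (K L : PreAbstractSimplicialComplex V) (k : ℕ) :
    cochain R (retract K L) (retractBoundary K L) k →ₗ[R] cochain R K L k :=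
  (subdivide k).restrict fun _ h => subdivide_mem h

theorem subdivideCochain_coboundary (hfin : LocallyFiniteOff K L) (k : ℕ)
    (φ : cochain R (retract K L) (retractBoundary K L) k) :
    subdivideCochain K L (k + 1)
        (coboundary R ((locallyFinite_retract hfin).off (retractBoundary K L)) k φ) =
      coboundary R hfin k (subdivideCochain K L k φ) := by
  obtain ⟨-, hsupp, -⟩ := mem_cochain.mp φ.2
  refine cochain_ext fun v hv hK => ?_
  change subdivide (k + 1) (coboundaryFun R (retract K L) φ.1) v =
    coboundaryFun R K (subdivide k φ.1) v
  rw [coboundaryFun_of_mem _ hv hK, ← subdivide_faceSum, subdivide_apply, subdivide_apply]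
  refine Finset.sum_congr rfl fun π _ => ?_
  congr 1
  have hinj : Function.Injective (flag (v ∘ π)) :=
    flag_injective_iff.mpr (hv.comp π.injective)
  have hbar : entries (flag (v ∘ π)) ∈ (barycentric K).faces := by
    refine ⟨entries_nonempty _, fun s hs => ?_, by rw [coe_entries]; exact isChain_range_flag _⟩
    obtain ⟨j, rfl⟩ := mem_entries.mp hs
    refine (K.isRelLowerSet_faces hK).2 ?_ (flag_nonempty _ j)
    have := flag_subset_entries (v ∘ π) j
    rwa [entries_comp_perm] at this
  -- A flag of `v` outside `retract K L` contributes zero to both sides: its faces in `retract K L`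
  -- are in `retractBoundary K L`, where `φ` vanishes.
  by_cases hmem : entries (flag (v ∘ π)) ∈ (retract K L).faces
  · exact coboundaryFun_of_mem _ hinj hmem
  · rw [coboundaryFun_of_not _ fun h => hmem h.2]
    refine (Finset.sum_eq_zero fun i _ => ?_).symm
    rw [show φ.1 (flag (v ∘ π) ∘ i.succAbove) = 0 from ?_, mul_zero]
    by_contra hne
    obtain ⟨-, h1, h2⟩ := hsupp _ hne
    exact h2 ((mem_retract_or hbar).resolve_left hmem _ (entries_comp_subset _ _) h1)

/-- The pullback of cochains along the simplicial map `Δ⁺ → Δ` given by `g`. -/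
noncomputable def pullbackCochain (hg : ∀ t : Finset V, t.Nonempty → g t ∈ t)
    (hgL : ∀ t : Finset V, (∃ v ∈ t, {v} ∈ L.faces) → {g t} ∈ L.faces)
    (hfull : ∀ s ∈ K.faces, (∀ v ∈ s, {v} ∈ L.faces) → s ∈ L.faces)
    (hfin : LocallyFiniteOff K L) (k : ℕ) :
    cochain R K L k →ₗ[R] cochain R (retract K L) (retractBoundary K L) k where
  toFun φ := ⟨restrict (retract K L) (pullback g k φ.1),
    restrict_pullback_mem hg hgL hfull hfin φ.2⟩
  map_add' φ ψ := Subtype.ext (by simp only [Submodule.coe_add, map_add, restrict_add])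
  map_smul' r φ := Subtype.ext (by
    simp only [Submodule.coe_smul, map_smul, restrict_smul, RingHom.id_apply])

theorem pullbackCochain_coboundary (hg : ∀ t : Finset V, t.Nonempty → g t ∈ t)
    (hgL : ∀ t : Finset V, (∃ v ∈ t, {v} ∈ L.faces) → {g t} ∈ L.faces)
    (hfull : ∀ s ∈ K.faces, (∀ v ∈ s, {v} ∈ L.faces) → s ∈ L.faces)
    (hfin : LocallyFiniteOff K L) (k : ℕ) (φ : cochain R K L k) :
    pullbackCochain hg hgL hfull hfin (k + 1) (coboundary R hfin k φ) =
      coboundary R ((locallyFinite_retract hfin).off (retractBoundary K L)) k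
        (pullbackCochain hg hgL hfull hfin k φ) := by
  obtain ⟨halt, hsupp, -⟩ := mem_cochain.mp φ.2
  refine cochain_ext fun f hf hK => ?_
  change restrict (retract K L) (pullback g (k + 1) (coboundaryFun R K φ.1)) f =
    coboundaryFun R (retract K L) (restrict (retract K L) (pullback g k φ.1)) f
  rw [restrict_of_mem _ hf hK, coboundaryFun_of_mem _ hf hK, pullback_apply]
  have hface : faceSum R (restrict (retract K L) (pullback g k φ.1)) f =
      faceSum R φ.1 (g ∘ f) := by
    refine Finset.sum_congr rfl fun i _ => ?_
    rw [restrict_of_mem _ (hf.comp Fin.succAbove_right_injective)]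
    · rfl
    · exact ((retract K L).isRelLowerSet_faces hK).2 (entries_comp_subset f _) (entries_nonempty _)
  rw [hface]
  have htop := hK.1.2.1 _ (unionFinset_mem hK.1.1 hK.1.2.2)
  have hgK : entries (g ∘ f) ∈ K.faces := by
    refine (K.isRelLowerSet_faces htop).2 (fun x hx => ?_) (entries_nonempty _)
    obtain ⟨j, rfl⟩ := mem_entries.mp hx
    have hj : f j ∈ entries f := mem_entries.mpr ⟨j, rfl⟩
    exact subset_unionFinset hj (hg _ (K.isRelLowerSet_faces (hK.1.2.1 _ hj)).1)
  by_cases hinj : Function.Injective (g ∘ f)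
  · exact coboundaryFun_of_mem _ hinj hgK
  · rw [coboundaryFun_of_not _ fun h => hinj h.1,
      faceSum_of_not_injective halt (fun v hv => (hsupp v hv).1) hinj]

theorem exists_vertexChoice [Nonempty V] (L : PreAbstractSimplicialComplex V) :
    ∃ g : Finset V → V, (∀ t : Finset V, t.Nonempty → g t ∈ t) ∧
      ∀ t : Finset V, (∃ v ∈ t, {v} ∈ L.faces) → {g t} ∈ L.faces := by
  have h : ∀ t : Finset V, ∃ x : V, (t.Nonempty → x ∈ t) ∧
      ((∃ v ∈ t, {v} ∈ L.faces) → {x} ∈ L.faces) := by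
    intro t
    by_cases h1 : ∃ v ∈ t, {v} ∈ L.faces
    · obtain ⟨v, hv, hvL⟩ := h1
      exact ⟨v, fun _ => hv, fun _ => hvL⟩
    · by_cases h2 : t.Nonempty
      · exact ⟨h2.choose, fun _ => h2.choose_spec, fun h => absurd h h1⟩
      · exact ⟨Classical.arbitrary V, fun h => absurd h h2, fun h => absurd h h1⟩
  choose g hg using h
  exact ⟨g, fun t => (hg t).1, fun t => (hg t).2⟩

theorem exists_quasiIso_retract [Nonempty V]
    (hfull : ∀ s ∈ K.faces, (∀ v ∈ s, {v} ∈ L.faces) → s ∈ L.faces)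
    (hfin : LocallyFiniteOff K L) :
    ∃ f : cochainComplex R ((locallyFinite_retract hfin).off (retractBoundary K L)) ⟶
      cochainComplex R hfin, QuasiIso f := by
  obtain ⟨g, hg, hgL⟩ := exists_vertexChoice L
  have h1 := isCarried_retract (R := R) hg hgL hfin
  have h2 := isCarried_original (R := R) hg hfin
  have hfin' := (locallyFinite_retract hfin).off (retractBoundary K L)
  have hD1 : ∀ (k : ℕ) (φ : cochain R (retract K L) (retractBoundary K L) k)
      (v : Fin (k + 1) → Finset V), Function.Injective v → entries v ∈ (retract K L).faces →
      (pullback g k ∘ₗ subdivide k - LinearMap.id :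
        ((Fin (k + 1) → Finset V) → R) →ₗ[R] ((Fin (k + 1) → Finset V) → R)) φ.1 v =
        (pullbackCochain hg hgL hfull hfin k (subdivideCochain K L k φ) - φ).1 v := by
    intro k φ v hv hK
    change subdivide k φ.1 (g ∘ v) - φ.1 v =
      restrict (retract K L) (pullback g k (subdivide k φ.1)) v - φ.1 v
    rw [restrict_of_mem _ hv hK, pullback_apply]
  have hD2 : ∀ (k : ℕ) (φ : cochain R K L k)
      (v : Fin (k + 1) → V), Function.Injective v → entries v ∈ K.faces →
      (subdivide k ∘ₗ pullback g k - LinearMap.id :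
        ((Fin (k + 1) → V) → R) →ₗ[R] ((Fin (k + 1) → V) → R)) φ.1 v =
        (subdivideCochain K L k (pullbackCochain hg hgL hfull hfin k φ) - φ).1 v := by
    intro k φ v hv hK
    change subdivide k (pullback g k φ.1) v - φ.1 v =
      subdivide k (restrict (retract K L) (pullback g k φ.1)) v - φ.1 v
    congr 1
    refine Finset.sum_congr rfl fun π _ => ?_
    congr 1
    have hinj : Function.Injective (flag (v ∘ π)) :=
      flag_injective_iff.mpr (hv.comp π.injective)
    have hbar : entries (flag (v ∘ π)) ∈ (barycentric K).faces := by
      refine ⟨entries_nonempty _, fun s hs => ?_, by rw [coe_entries]; exact isChain_range_flag _⟩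
      obtain ⟨j, rfl⟩ := mem_entries.mp hs
      refine (K.isRelLowerSet_faces hK).2 ?_ (flag_nonempty _ j)
      have := flag_subset_entries (v ∘ π) j
      rwa [entries_comp_perm] at this
    by_cases hall : ∀ s ∈ entries (flag (v ∘ π)), s ∉ L.faces
    · exact (restrict_of_mem (K := retract K L) _ hinj ⟨hbar, hall⟩).symm
    · push Not at hall
      obtain ⟨s, hs, hsL⟩ := hall
      obtain ⟨j, rfl⟩ := mem_entries.mp hs
      -- Once one flag member is in `L`, the first vertex is in `L` and belongs to all members, so
      -- `g` maps the whole flag to vertices of `L`. Hence restricting to `retract K L` loses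
      -- nothing.
      have hzero : φ.1 (g ∘ flag (v ∘ π)) = 0 := by
        by_contra hne
        obtain ⟨-, hgK, hgL'⟩ := (mem_cochain.mp φ.2).2.1 _ hne
        refine hgL' (hfull _ hgK fun x hx => ?_)
        obtain ⟨i, rfl⟩ := mem_entries.mp hx
        refine hgL _ ⟨(v ∘ π) 0, mem_flag.mpr ⟨0, Fin.zero_le i, rfl⟩, ?_⟩
        refine (L.isRelLowerSet_faces hsL).2 ?_ (Finset.singleton_nonempty _)
        rw [Finset.singleton_subset_iff]
        exact mem_flag.mpr ⟨0, Fin.zero_le j, rfl⟩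
      rw [pullback_apply, hzero]
      symm
      by_contra hne
      exact (mem_of_restrict_ne_zero hne).2 hzero
  refine quasiIso_of_linear_homotopies (coboundary R hfin') (coboundary R hfin)
    (fun k φ => Subtype.ext (coboundaryFun_coboundaryFun _ φ.1))
    (fun k φ => Subtype.ext (coboundaryFun_coboundaryFun _ φ.1))
    (subdivideCochain K L) (pullbackCochain hg hgL hfull hfin)
    (subdivideCochain_coboundary hfin) (pullbackCochain_coboundary hg hgL hfull hfin)
    h1.homotopy h2.homotopy ?_ ?_ ?_ ?_
  · exact fun φ => cochain_ext fun v hv hK =>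
      (h1.homotopy_coboundary_zero hfin' φ hv hK).trans (hD1 0 φ v hv hK)
  · exact fun k φ => cochain_ext fun v hv hK =>
      (h1.coboundary_homotopy_add hfin' φ hv hK).trans (hD1 (k + 1) φ v hv hK)
  · exact fun φ => cochain_ext fun v hv hK =>
      (h2.homotopy_coboundary_zero hfin φ hv hK).trans (hD2 0 φ v hv hK)
  · exact fun k φ => cochain_ext fun v hv hK =>
      (h2.coboundary_homotopy_add hfin φ hv hK).trans (hD2 (k + 1) φ v hv hK)

end Carriers

/-! ### Flag coordinates with maximum normalization. -/

section Coordinates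

variable {V : Type*}

/-- The sum of the coordinates of `y` over the simplices in `p`. -/
noncomputable def mass (y : Finset V →₀ ℝ) (p : Set (Finset V)) : ℝ :=
  ∑ s ∈ y.support, p.indicator y s

theorem mass_eq_sum {y : Finset V →₀ ℝ} {T : Finset (Finset V)} (h : y.support ⊆ T)
    (p : Set (Finset V)) : mass y p = ∑ s ∈ T, p.indicator y s :=
  Finset.sum_subset h fun s _ hs => by
    rw [Finsupp.notMem_support_iff] at hs
    exact Set.indicator_apply_eq_zero.mpr fun _ => hs

theorem mass_congr {y : Finset V →₀ ℝ} {p p' : Set (Finset V)}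
    (h : ∀ s ∈ y.support, s ∈ p ↔ s ∈ p') : mass y p = mass y p' := by
  classical
  refine Finset.sum_congr rfl fun s hs => ?_
  simp only [Set.indicator_apply, h s hs]

theorem mass_le {y : Finset V →₀ ℝ} (hy : ∀ s, 0 ≤ y s) {p p' : Set (Finset V)}
    (h : ∀ s ∈ y.support, s ∈ p → s ∈ p') : mass y p ≤ mass y p' := by
  classical
  refine Finset.sum_le_sum fun s hs => ?_
  by_cases h1 : s ∈ p
  · rw [Set.indicator_of_mem h1, Set.indicator_of_mem (h s hs h1)]
  · rw [Set.indicator_of_notMem h1]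
    exact Set.indicator_nonneg (fun s _ => hy s) s

theorem mass_nonneg {y : Finset V →₀ ℝ} (hy : ∀ s, 0 ≤ y s) (p : Set (Finset V)) :
    0 ≤ mass y p :=
  Finset.sum_nonneg fun s _ => Set.indicator_nonneg (fun s _ => hy s) s

theorem mass_eq_zero {y : Finset V →₀ ℝ} {p : Set (Finset V)} (h : ∀ s ∈ y.support, s ∉ p) :
    mass y p = 0 :=
  Finset.sum_eq_zero fun s hs => Set.indicator_of_notMem (h s hs) _

theorem mass_pos {y : Finset V →₀ ℝ} (hy : ∀ s, 0 ≤ y s) {p : Set (Finset V)} {s : Finset V}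
    (hs : s ∈ y.support) (hp : s ∈ p) : 0 < mass y p := by
  refine Finset.sum_pos' (fun s _ => Set.indicator_nonneg (fun s _ => hy s) s) ⟨s, hs, ?_⟩
  rw [Set.indicator_of_mem hp]
  exact lt_of_le_of_ne (hy s) (Finsupp.mem_support_iff.mp hs).symm

theorem exists_of_mass_ne_zero {y : Finset V →₀ ℝ} {p : Set (Finset V)} (h : mass y p ≠ 0) :
    ∃ s ∈ y.support, s ∈ p := by
  by_contra! hcon
  exact h (mass_eq_zero hcon)

theorem mass_add_mass {y : Finset V →₀ ℝ} {p p₁ p₂ : Set (Finset V)}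
    (h : ∀ s ∈ y.support, s ∈ p ↔ s ∈ p₁ ∨ s ∈ p₂)
    (h' : ∀ s ∈ y.support, s ∈ p₁ → s ∉ p₂) : mass y p = mass y p₁ + mass y p₂ := by
  unfold mass
  rw [← Finset.sum_add_distrib]
  refine Finset.sum_congr rfl fun s hs => ?_
  by_cases h1 : s ∈ p₁
  · rw [Set.indicator_of_mem ((h s hs).mpr (Or.inl h1)), Set.indicator_of_mem h1,
      Set.indicator_of_notMem (h' s hs h1), add_zero]
  · by_cases h2 : s ∈ p₂
    · rw [Set.indicator_of_mem ((h s hs).mpr (Or.inr h2)), Set.indicator_of_notMem h1,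
        Set.indicator_of_mem h2, zero_add]
    · rw [Set.indicator_of_notMem fun hp => ((h s hs).mp hp).elim h1 h2,
        Set.indicator_of_notMem h1, Set.indicator_of_notMem h2, zero_add]

theorem mass_singleton (y : Finset V →₀ ℝ) (s : Finset V) : mass y {s} = y s := by
  by_cases hs : s ∈ y.support
  · rw [mass, Finset.sum_eq_single_of_mem s hs, Set.indicator_of_mem (Set.mem_singleton s)]
    exact fun t _ ht => Set.indicator_of_notMem (by simpa using ht) _
  · rw [Finsupp.notMem_support_iff.mp hs]
    refine mass_eq_zero fun t ht hts => hs ?_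
    rw [Set.mem_singleton_iff] at hts
    exact hts ▸ ht

theorem mass_univ (y : Finset V →₀ ℝ) : mass y Set.univ = y.sum fun _ a => a := by
  simp [mass, Finsupp.sum]

/-- The largest coordinate of `x` on `P` (zero if there is none). -/
noncomputable def maxOn (P : Set V) (x : V →₀ ℝ) : ℝ :=
  ((x.support.sup fun v => P.indicator (fun v => (x v).toNNReal) v : NNReal) : ℝ)

theorem maxOn_eq_sup {x : V →₀ ℝ} {T : Finset V} (h : x.support ⊆ T) (P : Set V) :
    maxOn P x = ((T.sup fun v => P.indicator (fun v => (x v).toNNReal) v : NNReal) : ℝ) := by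
  unfold maxOn
  congr 1
  refine le_antisymm (Finset.sup_mono h) (Finset.sup_le fun v hv => ?_)
  by_cases hvx : v ∈ x.support
  · exact Finset.le_sup (f := fun v => P.indicator (fun v => (x v).toNNReal) v) hvx
  · rw [Finsupp.notMem_support_iff] at hvx
    rw [Set.indicator_apply_eq_zero.mpr fun _ => by rw [hvx, Real.toNNReal_zero]]
    exact zero_le

theorem maxOn_nonneg (P : Set V) (x : V →₀ ℝ) : 0 ≤ maxOn P x := NNReal.coe_nonneg _

theorem le_maxOn {P : Set V} {x : V →₀ ℝ} {v : V} (hv : v ∈ P) : x v ≤ maxOn P x := by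
  by_cases hvx : v ∈ x.support
  · have h := Finset.le_sup (f := fun v => P.indicator (fun v => (x v).toNNReal) v) hvx
    simp only [Set.indicator_of_mem hv] at h
    exact (Real.le_coe_toNNReal _).trans (NNReal.coe_le_coe.mpr h)
  · rw [Finsupp.notMem_support_iff.mp hvx]
    exact maxOn_nonneg P x

theorem maxOn_le {P : Set V} {x : V →₀ ℝ} {M : ℝ} (h0 : 0 ≤ M) (h : ∀ v ∈ P, x v ≤ M) :
    maxOn P x ≤ M := by
  rw [← Real.coe_toNNReal M h0]
  refine NNReal.coe_le_coe.mpr (Finset.sup_le fun v _ => ?_)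
  by_cases hv : v ∈ P
  · rw [Set.indicator_of_mem hv]
    exact Real.toNNReal_le_toNNReal (h v hv)
  · rw [Set.indicator_of_notMem hv]
    exact zero_le

theorem maxOn_scale {P : Set V} {x x' : V →₀ ℝ} {c : ℝ} (hc : 0 < c)
    (h : ∀ v ∈ P, x' v = c * x v) : maxOn P x' = c * maxOn P x := by
  refine le_antisymm (maxOn_le (mul_nonneg hc.le (maxOn_nonneg P x)) fun v hv => ?_) ?_
  · rw [h v hv]
    exact mul_le_mul_of_nonneg_left (le_maxOn hv) hc.le
  · rw [← le_div_iff₀' hc]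
    refine maxOn_le (div_nonneg (maxOn_nonneg P x') hc.le) fun v hv => ?_
    rw [le_div_iff₀' hc, ← h v hv]
    exact le_maxOn hv

open Classical in
/-- The smallest coordinate of `x` on `s` (zero if `s` is empty). -/
noncomputable def minOn (s : Finset V) (x : V →₀ ℝ) : ℝ :=
  if h : s.Nonempty then s.inf' h x else 0

theorem minOn_le {s : Finset V} {x : V →₀ ℝ} {v : V} (hv : v ∈ s) : minOn s x ≤ x v := by
  rw [minOn, dif_pos ⟨v, hv⟩]
  exact Finset.inf'_le _ hv

theorem le_minOn {s : Finset V} {x : V →₀ ℝ} {M : ℝ} (hs : s.Nonempty) (h : ∀ v ∈ s, M ≤ x v) :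
    M ≤ minOn s x := by
  rw [minOn, dif_pos hs]
  exact Finset.le_inf' _ _ h

/-- The point `∑ y_s e_s`, where `e_s` is the sum of the vertices of `s`. -/
noncomputable def expand (y : Finset V →₀ ℝ) : V →₀ ℝ :=
  Finsupp.onFinset (unionFinset y.support) (fun v => mass y {s | v ∈ s}) fun v hv => by
    obtain ⟨s, hs, hvs⟩ := exists_of_mass_ne_zero hv
    exact mem_unionFinset.mpr ⟨s, hs, hvs⟩

theorem expand_apply (y : Finset V →₀ ℝ) (v : V) : expand y v = mass y {s | v ∈ s} := rfl

/-- The coordinates of a point with respect to the vectors `e_s` along a flag. -/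
noncomputable def levels (x : V →₀ ℝ) : Finset V →₀ ℝ :=
  Finsupp.onFinset x.support.powerset
    (fun s => max 0 (minOn s x - maxOn {v | v ∉ s} x)) fun s hs => by
      rw [Finset.mem_powerset]
      intro v hv
      rw [Finsupp.mem_support_iff]
      intro h0
      refine hs (max_eq_left ?_)
      have h1 := minOn_le (x := x) hv
      have h2 := maxOn_nonneg {v | v ∉ s} x
      linarith

theorem levels_apply (x : V →₀ ℝ) (s : Finset V) :
    levels x s = max 0 (minOn s x - maxOn {v | v ∉ s} x) := rfl

/-- The points that are supported on a flag of nonempty sets. -/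
structure IsFlagPoint (y : Finset V →₀ ℝ) : Prop where
  nonneg : ∀ s, 0 ≤ y s
  nonempty : ∀ s ∈ y.support, s.Nonempty
  chain : IsChain (fun s t : Finset V => s ⊆ t) (y.support : Set (Finset V))

theorem IsFlagPoint.support_expand {y : Finset V →₀ ℝ} (hy : IsFlagPoint y) :
    (expand y).support = unionFinset y.support := by
  refine Finset.Subset.antisymm Finsupp.support_onFinset_subset fun v hv => ?_
  obtain ⟨s, hs, hvs⟩ := mem_unionFinset.mp hv
  rw [Finsupp.mem_support_iff, expand_apply]
  exact (mass_pos hy.nonneg hs hvs).ne'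

/-- The maximum is attained at a vertex in `P` of the smallest flag member meeting `P`: that vertex
belongs to every member meeting `P`. -/
theorem IsFlagPoint.maxOn_expand {y : Finset V →₀ ℝ} (hy : IsFlagPoint y) (P : Set V) :
    maxOn P (expand y) = mass y {s | ∃ v ∈ s, v ∈ P} := by
  classical
  refine le_antisymm (maxOn_le (mass_nonneg hy.nonneg _) fun v hv =>
    mass_le hy.nonneg fun s _ hvs => ⟨v, hvs, hv⟩) ?_
  by_cases h : ∃ s ∈ y.support, ∃ v ∈ s, v ∈ P
  · obtain ⟨s, hs, hmin⟩ := (y.support.filter fun s => ∃ v ∈ s, v ∈ P).exists_min_image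
      Finset.card (by obtain ⟨s, hs, h⟩ := h; exact ⟨s, Finset.mem_filter.mpr ⟨hs, h⟩⟩)
    obtain ⟨hs, v, hv, hvP⟩ := Finset.mem_filter.mp hs
    have : mass y {s | ∃ v ∈ s, v ∈ P} = expand y v := by
      refine mass_congr fun t ht => ⟨fun htP => ?_, fun hvt => ⟨v, hvt, hvP⟩⟩
      rcases hy.chain.total hs ht with hst | hts
      · exact hst hv
      · have := Finset.eq_of_subset_of_card_le hts (hmin t (Finset.mem_filter.mpr ⟨ht, htP⟩))
        exact this ▸ hv
    rw [this]
    exact le_maxOn hvP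
  · push Not at h
    rw [mass_eq_zero fun s hs => by
      rintro ⟨v, hv, hvP⟩
      exact h s hs v hv hvP]
    exact maxOn_nonneg _ _

/-- The minimum is attained at a vertex of `s` missing from the largest flag member not containing
`s`, and so from all the members not containing `s`. -/
theorem IsFlagPoint.minOn_expand {y : Finset V →₀ ℝ} (hy : IsFlagPoint y) {s : Finset V}
    (hs : s.Nonempty) : minOn s (expand y) = mass y {t | s ⊆ t} := by
  classical
  refine le_antisymm ?_ (le_minOn hs fun v hv => mass_le hy.nonneg fun t _ hst => hst hv)
  have key : ∃ v ∈ s, expand y v = mass y {t | s ⊆ t} := by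
    by_cases h : ∃ t ∈ y.support, ¬ s ⊆ t
    · obtain ⟨t, ht, hmax⟩ := (y.support.filter fun t => ¬ s ⊆ t).exists_max_image
        Finset.card (by obtain ⟨t, ht, h⟩ := h; exact ⟨t, Finset.mem_filter.mpr ⟨ht, h⟩⟩)
      obtain ⟨ht, hst⟩ := Finset.mem_filter.mp ht
      obtain ⟨v, hv, hvt⟩ := Finset.not_subset.mp hst
      refine ⟨v, hv, mass_congr fun t' ht' => ⟨fun hvt' => ?_, fun hst' => hst' hv⟩⟩
      by_contra hst'
      rcases hy.chain.total ht' ht with h1 | h1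
      · exact hvt (h1 hvt')
      · have := Finset.eq_of_subset_of_card_le h1 (hmax t' (Finset.mem_filter.mpr ⟨ht', hst'⟩))
        exact hvt (this ▸ hvt')
    · push Not at h
      obtain ⟨v, hv⟩ := hs
      exact ⟨v, hv, mass_congr fun t ht => ⟨fun _ => h t ht, fun hst => hst hv⟩⟩
  obtain ⟨v, hv, he⟩ := key
  exact he ▸ minOn_le hv

/-- The gap is the weight of members containing `s` minus that of members not contained in `s`. For
`s` in the flag these differ by `y s`; otherwise every member containing `s` is also counted in the
second weight, and the truncation at zero gives `0`. -/
theorem IsFlagPoint.levels_expand {y : Finset V →₀ ℝ} (hy : IsFlagPoint y) :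
    levels (expand y) = y := by
  ext s
  rw [levels_apply]
  rcases s.eq_empty_or_nonempty with rfl | hs
  · have h0 : y ∅ = 0 := by
      by_contra h
      exact Finset.not_nonempty_empty (hy.nonempty ∅ (Finsupp.mem_support_iff.mpr h))
    rw [h0, minOn, dif_neg Finset.not_nonempty_empty, zero_sub]
    exact max_eq_left (neg_nonpos.mpr (maxOn_nonneg _ _))
  · rw [hy.minOn_expand hs, hy.maxOn_expand]
    have hset : {t : Finset V | ∃ v ∈ t, v ∈ {v | v ∉ s}} = {t | ¬ t ⊆ s} := by
      ext t
      exact Finset.not_subset.symm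
    rw [hset]
    by_cases hsy : s ∈ y.support
    · have : mass y {t | s ⊆ t} = mass y {s} + mass y {t | ¬ t ⊆ s} := by
        refine mass_add_mass (fun t ht => ⟨fun hst => ?_, ?_⟩) ?_
        · by_cases hts : t ⊆ s
          · exact Or.inl (hts.antisymm hst)
          · exact Or.inr hts
        · rintro (rfl | hts)
          · exact Finset.Subset.refl _
          · exact (hy.chain.total hsy ht).resolve_right hts
        · rintro t - rfl h
          exact h (Finset.Subset.refl _)
      rw [this, mass_singleton, add_sub_cancel_right]
      exact max_eq_right (hy.nonneg s)
    · rw [Finsupp.notMem_support_iff.mp hsy]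
      refine max_eq_left (sub_nonpos.mpr (mass_le hy.nonneg fun t ht hst hts => hsy ?_))
      exact (Finset.Subset.antisymm hst hts) ▸ ht

theorem mass_add (y z : Finset V →₀ ℝ) (p : Set (Finset V)) :
    mass (y + z) p = mass y p + mass z p := by
  classical
  rw [mass_eq_sum (T := y.support ∪ z.support) Finsupp.support_add,
    mass_eq_sum (T := y.support ∪ z.support) Finset.subset_union_left,
    mass_eq_sum (T := y.support ∪ z.support) (y := z) Finset.subset_union_right,
    ← Finset.sum_add_distrib]
  refine Finset.sum_congr rfl fun s _ => ?_
  rw [Finsupp.coe_add, Set.indicator_add']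
  rfl

theorem mass_single (s : Finset V) (a : ℝ) (p : Set (Finset V)) :
    mass (Finsupp.single s a) p = p.indicator (fun _ => a) s := by
  classical
  rw [mass_eq_sum Finsupp.support_single_subset, Finset.sum_singleton]
  simp [Set.indicator_apply]

/-- Layer-cake decomposition: subtract the smallest positive coordinate from all coordinates of the
support, give the whole support that weight, and continue on the smaller support that is left. -/
theorem exists_expand_eq (x : V →₀ ℝ) (hx : ∀ v, 0 ≤ x v) :
    ∃ y : Finset V →₀ ℝ, IsFlagPoint y ∧ expand y = x := by
  classical
  induction hn : x.support.card using Nat.strong_induction_on generalizing x with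
  | _ n ih =>
    rcases x.support.eq_empty_or_nonempty with h0 | hne
    · refine ⟨0, ⟨fun _ => le_rfl, by simp, by simp⟩, ?_⟩
      rw [Finsupp.support_eq_empty.mp h0]
      ext v
      simp [expand_apply, mass]
    · set S := x.support with hS
      obtain ⟨w, hw, hmin⟩ := S.exists_min_image x hne
      have ha : 0 < x w := lt_of_le_of_ne (hx w) (Finsupp.mem_support_iff.mp hw).symm
      set x' : V →₀ ℝ := x - Finsupp.indicator S (fun _ _ => x w) with hx'
      have hin : ∀ v ∈ S, x' v = x v - x w := fun v hv => by
        simp [hx', Finsupp.indicator_apply, hv]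
      have hout : ∀ v ∉ S, x' v = 0 := fun v hv => by
        have : x v = 0 := Finsupp.notMem_support_iff.mp hv
        simp [hx', Finsupp.indicator_apply, hv, this]
      have hsub : x'.support ⊆ S.erase w := by
        intro v hv
        rw [Finsupp.mem_support_iff] at hv
        have hvS : v ∈ S := by
          by_contra h
          exact hv (hout v h)
        refine Finset.mem_erase.mpr ⟨?_, hvS⟩
        rintro rfl
        exact hv (by rw [hin v hvS, sub_self])
      have hx'0 : ∀ v, 0 ≤ x' v := fun v => by
        by_cases hv : v ∈ S
        · rw [hin v hv]
          exact sub_nonneg.mpr (hmin v hv)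
        · rw [hout v hv]
      obtain ⟨y, hy, hyx⟩ := ih x'.support.card
        (by rw [← hn]
            exact (Finset.card_le_card hsub).trans_lt (Finset.card_erase_lt_of_mem hw))
        x' hx'0 rfl
      have hyS : ∀ t ∈ y.support, t ⊆ S := fun t ht v hv => by
        have : v ∈ (expand y).support := by
          rw [hy.support_expand]
          exact mem_unionFinset.mpr ⟨t, ht, hv⟩
        rw [hyx] at this
        exact Finset.mem_of_mem_erase (hsub this)
      have hsupp : ∀ t ∈ (y + Finsupp.single S (x w)).support, t ∈ y.support ∨ t = S := by
        intro t ht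
        rcases Finset.mem_union.mp (Finsupp.support_add ht) with h | h
        · exact Or.inl h
        · exact Or.inr (Finset.mem_singleton.mp (Finsupp.support_single_subset h))
      refine ⟨y + Finsupp.single S (x w), ⟨fun s => ?_, fun t ht => ?_, ?_⟩, ?_⟩
      · rw [Finsupp.add_apply]
        refine add_nonneg (hy.nonneg s) ?_
        rw [Finsupp.single_apply]
        split_ifs
        exacts [ha.le, le_rfl]
      · rcases hsupp t ht with h | rfl
        · exact hy.nonempty t h
        · exact hne
      · intro s hs t ht hst
        rcases hsupp s hs with h1 | rfl
        · rcases hsupp t ht with h2 | rfl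
          · exact hy.chain h1 h2 hst
          · exact Or.inl (hyS s h1)
        · rcases hsupp t ht with h2 | h2
          · exact Or.inr (hyS t h2)
          · exact absurd h2.symm hst
      · ext v
        rw [expand_apply, mass_add, mass_single, ← expand_apply, hyx]
        by_cases hv : v ∈ S
        · rw [Set.indicator_of_mem (show S ∈ {s | v ∈ s} from hv), hin v hv, sub_add_cancel]
        · rw [Set.indicator_of_notMem (show S ∉ {s | v ∈ s} from hv), hout v hv, add_zero]
          exact (Finsupp.notMem_support_iff.mp hv).symm

theorem isFlagPoint_levels {x : V →₀ ℝ} (hx : ∀ v, 0 ≤ x v) : IsFlagPoint (levels x) := by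
  obtain ⟨y, hy, rfl⟩ := exists_expand_eq x hx
  rwa [hy.levels_expand]

theorem expand_levels {x : V →₀ ℝ} (hx : ∀ v, 0 ≤ x v) : expand (levels x) = x := by
  obtain ⟨y, hy, rfl⟩ := exists_expand_eq x hx
  rw [hy.levels_expand]

theorem IsFlagPoint.sum_eq {y : Finset V →₀ ℝ} (hy : IsFlagPoint y) :
    (y.sum fun _ a => a) = maxOn Set.univ (expand y) := by
  rw [← mass_univ, hy.maxOn_expand]
  refine mass_congr fun s hs => ⟨fun _ => ?_, fun _ => trivial⟩
  obtain ⟨v, hv⟩ := hy.nonempty s hs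
  exact ⟨v, hv, trivial⟩

/-- Division of the coordinates in `P` by `a` and of the other coordinates by `b`. -/
noncomputable def divOn (P : Set V) (a b : ℝ) (x : V →₀ ℝ) : V →₀ ℝ :=
  Finsupp.onFinset x.support (fun v => P.indicator (fun v => x v / a) v +
    Pᶜ.indicator (fun v => x v / b) v) fun v hv => by
      rw [Finsupp.mem_support_iff]
      intro h0
      refine hv ?_
      rw [Set.indicator_apply_eq_zero.mpr fun _ => by rw [h0, zero_div],
        Set.indicator_apply_eq_zero.mpr fun _ => by rw [h0, zero_div], add_zero]

theorem divOn_of_mem {P : Set V} {a b : ℝ} {x : V →₀ ℝ} {v : V} (hv : v ∈ P) :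
    divOn P a b x v = x v / a := by
  simp [divOn, hv]

theorem divOn_of_notMem {P : Set V} {a b : ℝ} {x : V →₀ ℝ} {v : V} (hv : v ∉ P) :
    divOn P a b x v = x v / b := by
  simp [divOn, hv]

theorem divOn_apply_of_nonneg {P : Set V} {a b : ℝ} {x : V →₀ ℝ} (ha : 0 < a) (hb : 0 < b)
    (hx : ∀ v, 0 ≤ x v) (v : V) : 0 ≤ divOn P a b x v := by
  by_cases hv : v ∈ P
  · rw [divOn_of_mem hv]
    exact div_nonneg (hx v) ha.le
  · rw [divOn_of_notMem hv]
    exact div_nonneg (hx v) hb.le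

theorem support_divOn {P : Set V} {a b : ℝ} (x : V →₀ ℝ) (ha : a ≠ 0) (hb : b ≠ 0) :
    (divOn P a b x).support = x.support := by
  ext v
  rw [Finsupp.mem_support_iff, Finsupp.mem_support_iff]
  by_cases hv : v ∈ P
  · rw [divOn_of_mem hv]
    simp [ha]
  · rw [divOn_of_notMem hv]
    simp [hb]

theorem maxOn_divOn {P : Set V} {a b : ℝ} (x : V →₀ ℝ) (ha : 0 < a) :
    maxOn P (divOn P a b x) = maxOn P x / a := by
  rw [maxOn_scale (c := a⁻¹) (x := x) (inv_pos.mpr ha) fun v hv => by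
    rw [divOn_of_mem hv, div_eq_inv_mul], div_eq_inv_mul]

theorem maxOn_compl_divOn {P : Set V} {a b : ℝ} (x : V →₀ ℝ) (hb : 0 < b) :
    maxOn Pᶜ (divOn P a b x) = maxOn Pᶜ x / b := by
  rw [maxOn_scale (c := b⁻¹) (x := x) (inv_pos.mpr hb) fun v hv => by
    rw [divOn_of_notMem hv, div_eq_inv_mul], div_eq_inv_mul]

theorem maxOn_univ (P : Set V) (x : V →₀ ℝ) :
    maxOn Set.univ x = max (maxOn P x) (maxOn Pᶜ x) := by
  refine le_antisymm (maxOn_le (le_max_of_le_left (maxOn_nonneg P x)) fun v _ => ?_)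
    (max_le (maxOn_le (maxOn_nonneg _ _) fun v _ => le_maxOn trivial)
      (maxOn_le (maxOn_nonneg _ _) fun v _ => le_maxOn trivial))
  by_cases hv : v ∈ P
  · exact le_max_of_le_left (le_maxOn hv)
  · exact le_max_of_le_right (le_maxOn hv)

/-- Rescaling to coordinate sum one. -/
noncomputable def normalize (x : V →₀ ℝ) : V →₀ ℝ := (x.sum fun _ a => a)⁻¹ • x

theorem sum_pos_of_nonneg {x : V →₀ ℝ} (hx : ∀ v, 0 ≤ x v) (h0 : x.support.Nonempty) :
    0 < x.sum fun _ a => a :=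
  Finset.sum_pos (fun v hv => lt_of_le_of_ne (hx v) (Finsupp.mem_support_iff.mp hv).symm) h0

theorem sum_normalize {x : V →₀ ℝ} (h : 0 < x.sum fun _ a => a) :
    ((normalize x).sum fun _ a => a) = 1 := by
  rw [normalize, Finsupp.sum_smul_index (fun _ => rfl), ← Finsupp.mul_sum, inv_mul_cancel₀ h.ne']

theorem support_normalize {x : V →₀ ℝ} (h : 0 < x.sum fun _ a => a) :
    (normalize x).support = x.support :=
  Finsupp.support_smul_eq (inv_ne_zero h.ne')

end Coordinates

/-! ### Continuity of the coordinate formulas on finite supports. -/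

section Continuity

variable {V : Type*} {X : Type*} [TopologicalSpace X] {φ : X → V →₀ ℝ}

theorem continuous_maxOn (hφ : ∀ v, Continuous fun z => φ z v) {T : Finset V}
    (hT : ∀ z, (φ z).support ⊆ T) (P : Set V) : Continuous fun z => maxOn P (φ z) := by
  simp only [fun z => maxOn_eq_sup (hT z) P]
  refine NNReal.continuous_coe.comp (Continuous.finset_sup_apply fun v _ => ?_)
  by_cases hv : v ∈ P
  · simp only [Set.indicator_of_mem hv]
    exact continuous_real_toNNReal.comp (hφ v)
  · simp only [Set.indicator_of_notMem hv]
    exact continuous_const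

theorem continuous_minOn (hφ : ∀ v, Continuous fun z => φ z v) (s : Finset V) :
    Continuous fun z => minOn s (φ z) := by
  by_cases hs : s.Nonempty
  · simp only [minOn, dif_pos hs]
    exact Continuous.finset_inf'_apply hs fun v _ => hφ v
  · simp only [minOn, dif_neg hs]
    exact continuous_const

theorem continuous_levels (hφ : ∀ v, Continuous fun z => φ z v) {T : Finset V}
    (hT : ∀ z, (φ z).support ⊆ T) (s : Finset V) : Continuous fun z => levels (φ z) s := by
  simp only [levels_apply]
  exact continuous_const.max ((continuous_minOn hφ s).sub (continuous_maxOn hφ hT _))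

theorem continuous_mass {ψ : X → Finset V →₀ ℝ} (hψ : ∀ s, Continuous fun z => ψ z s)
    {T : Finset (Finset V)} (hT : ∀ z, (ψ z).support ⊆ T) (p : Set (Finset V)) :
    Continuous fun z => mass (ψ z) p := by
  simp only [fun z => mass_eq_sum (hT z) p]
  refine continuous_finsetSum _ fun s _ => ?_
  by_cases hs : s ∈ p
  · simp only [Set.indicator_of_mem hs]
    exact hψ s
  · simp only [Set.indicator_of_notMem hs]
    exact continuous_const

theorem continuous_divOn {a b : X → ℝ} (hφ : ∀ v, Continuous fun z => φ z v)
    (ha : Continuous a) (hb : Continuous b) (ha0 : ∀ z, a z ≠ 0) (hb0 : ∀ z, b z ≠ 0)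
    (P : Set V) (v : V) : Continuous fun z => divOn P (a z) (b z) (φ z) v := by
  by_cases hv : v ∈ P
  · simp only [divOn_of_mem hv]
    exact (hφ v).div ha ha0
  · simp only [divOn_of_notMem hv]
    exact (hφ v).div hb hb0

theorem continuous_normalize (hφ : ∀ v, Continuous fun z => φ z v) {T : Finset V}
    (hT : ∀ z, (φ z).support ⊆ T) (h0 : ∀ z, 0 < (φ z).sum fun _ a => a) (v : V) :
    Continuous fun z => normalize (φ z) v := by
  simp only [normalize, Finsupp.smul_apply, smul_eq_mul]
  refine Continuous.mul (Continuous.inv₀ ?_ fun z => (h0 z).ne') (hφ v)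
  have : ∀ z, ((φ z).sum fun _ a => a) = ∑ v ∈ T, φ z v := fun z =>
    Finsupp.sum_of_support_subset _ (hT z) _ fun _ _ => rfl
  simp only [this]
  exact continuous_finsetSum _ fun v _ => hφ v

end Continuity

/-! ### Maps between complements in the weak topology. -/

section WeakTopology

variable {V : Type*} {V' : Type*}

/-- A point of a closed simplex, from a point of the realization. -/
def cellMk {K : PreAbstractSimplicialComplex V} {s : Finset V} (x : Realization K)
    (h : x.1.support ⊆ s) : Cell K s := ⟨x, h⟩

theorem continuous_cell_val {K : PreAbstractSimplicialComplex V} {s : Finset V}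
    (hs : s ∈ K.faces) : Continuous fun x : Cell K s => x.1 :=
  continuous_iff_coinduced_le.mpr
    (le_iSup (fun s : K.faces => TopologicalSpace.coinduced (fun x : Cell K s.1 => x.1)
      inferInstance) ⟨s, hs⟩)

theorem continuous_cell_coord {K : PreAbstractSimplicialComplex V} {s : Finset V} (v : V) :
    Continuous fun x : Cell K s => x.1.1 v :=
  (continuous_apply v).comp continuous_induced_dom

theorem continuous_cell_of_coord {K : PreAbstractSimplicialComplex V} {s : Finset V}
    {X : Type*} [TopologicalSpace X] {f : X → Cell K s}
    (h : ∀ v, Continuous fun z => (f z).1.1 v) : Continuous f :=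
  continuous_induced_rng.mpr (continuous_pi h)

theorem isClosed_support_subset {K : PreAbstractSimplicialComplex V} (T s : Finset V) :
    IsClosed {x : Cell K T | x.1.1.support ⊆ s} := by
  have : {x : Cell K T | x.1.1.support ⊆ s} = ⋂ v ∈ (s : Set V)ᶜ, {x | x.1.1 v = 0} := by
    ext x
    simp only [Set.mem_ofPred_eq, Set.mem_iInter, Set.mem_compl_iff, Finset.mem_coe]
    refine ⟨fun h v hv => Finsupp.notMem_support_iff.mp fun hv' => hv (h hv'), fun h v hv => ?_⟩
    by_contra hvs
    exact (Finsupp.mem_support_iff.mp hv) (h v hvs)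
  rw [this]
  exact isClosed_biInter fun v _ => isClosed_eq (continuous_cell_coord v) continuous_const

/-- The weak topology is coarser than the coordinate topology on any finite subcomplex. -/
theorem continuous_finite_val (K : PreAbstractSimplicialComplex V) (T : Finset V) :
    Continuous fun x : Cell K T => x.1 := by
  have hfin : Finite {s : Finset V // s ⊆ T ∧ s ∈ K.faces} :=
    (Set.Finite.subset (s := (T.powerset : Set (Finset V))) (t := {s | s ⊆ T ∧ s ∈ K.faces})
      T.powerset.finite_toSet fun s hs => by simpa using hs.1).to_subtype
  -- The finite set `T` contains finitely many simplices; their closed faces cover, so continuity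
  -- glues even when `T` is not itself a simplex.
  refine (locallyFinite_of_finite (fun s : {s : Finset V // s ⊆ T ∧ s ∈ K.faces} =>
    {x : Cell K T | x.1.1.support ⊆ s.1})).continuous ?_ (fun s => isClosed_support_subset T s.1) ?_
  · refine Set.eq_univ_of_forall fun x => Set.mem_iUnion.mpr ?_
    exact ⟨⟨x.1.1.support, x.2, x.1.2.2.1⟩, Finset.Subset.refl _⟩
  · intro s
    rw [continuousOn_iff_continuous_domRestrict]
    have h1 : Continuous fun x : {x : Cell K T | x.1.1.support ⊆ s.1} =>
        cellMk x.1.1 x.2 :=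
      continuous_cell_of_coord fun v =>
        (continuous_cell_coord (K := K) (s := T) v).comp continuous_subtype_val
    exact (continuous_cell_val s.2.2).comp h1

theorem isOpen_support_notMem (K L : PreAbstractSimplicialComplex V) (T : Finset V) :
    IsOpen {x : Cell K T | x.1.1.support ∉ L.faces} := by
  rw [← isClosed_compl_iff]
  have : {x : Cell K T | x.1.1.support ∉ L.faces}ᶜ =
      ⋃ s ∈ {s | s ⊆ T ∧ s ∈ L.faces}, {x : Cell K T | x.1.1.support ⊆ s} := by
    ext x
    simp only [Set.mem_compl_iff, Set.mem_ofPred_eq, not_not, Set.mem_iUnion]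
    constructor
    · exact fun h => ⟨x.1.1.support, ⟨x.2, h⟩, Finset.Subset.refl _⟩
    · rintro ⟨s, ⟨-, hs⟩, h⟩
      exact (L.isRelLowerSet_faces hs).2 h (K.isRelLowerSet_faces x.1.2.2.1).1
  rw [this]
  refine Set.Finite.isClosed_biUnion ?_ fun s _ => isClosed_support_subset T s
  exact T.powerset.finite_toSet.subset fun s hs => by simpa using hs.1

/-- A map between complements of subcomplexes is continuous if on each closed simplex it takes
values in a finite subcomplex and has continuous coordinates. -/
theorem continuous_complement {K L : PreAbstractSimplicialComplex V}
    {K' L' : PreAbstractSimplicialComplex V'} (F : Complement K L → Complement K' L')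
    (T : Finset V → Finset V')
    (hT : ∀ s ∈ K.faces, ∀ p : Complement K L, p.1.1.support ⊆ s → (F p).1.1.support ⊆ T s)
    (hF : ∀ s ∈ K.faces, ∀ v', Continuous
      fun z : {x : Cell K s // x.1.1.support ∉ L.faces} => (F ⟨z.1.1, z.2⟩).1.1 v') :
    Continuous F := by
  refine continuous_induced_rng.mpr ⟨fun W hW => ?_⟩
  -- The preimage is viewed as a subset of the whole realization and tested on each closed simplex,
  -- where the complement of `L` is open.
  refine isOpen_induced_iff.mpr
    ⟨{x : Realization K | ∃ h : x.1.support ∉ L.faces, (F ⟨x, h⟩).1 ∈ W}, ?_, ?_⟩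
  · refine isOpen_iSup_iff.mpr fun s => isOpen_coinduced.mpr ?_
    have h1 : Continuous fun z : {x : Cell K s.1 // x.1.1.support ∉ L.faces} =>
        cellMk (F ⟨z.1.1, z.2⟩).1 (hT s.1 s.2 _ z.1.2) :=
      continuous_cell_of_coord (hF s.1 s.2)
    have h2 := hW.preimage ((continuous_finite_val K' (T s.1)).comp h1)
    have h3 := (isOpen_support_notMem K L s.1).isOpenMap_subtype_val _ h2
    convert h3 using 1
    ext x
    constructor
    · rintro ⟨h, hx⟩
      exact ⟨⟨x, h⟩, hx, rfl⟩
    · rintro ⟨⟨x, h⟩, hx, rfl⟩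
      exact ⟨h, hx⟩
  · ext p
    exact ⟨fun ⟨_, h⟩ => h, fun h => ⟨p.2, h⟩⟩

end WeakTopology

/-! ### The homeomorphism of complements. -/

section Homeomorphism

variable {V : Type*} {K L : PreAbstractSimplicialComplex V}

/-- The vertices of a complex. -/
def vertexSet (L : PreAbstractSimplicialComplex V) : Set V := {v | {v} ∈ L.faces}

/-- The total weight of the simplices of a flag without vertices in `L`. -/
noncomputable def innerMass (L : PreAbstractSimplicialComplex V) (y : Finset V →₀ ℝ) : ℝ :=
  mass y {s | ¬ ∃ v ∈ s, v ∈ vertexSet L}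

/-- The map from the complement of `∂Δ⁺` in `Δ⁺` to the complement of `∂Δ` in `Δ`. -/
noncomputable def outward (L : PreAbstractSimplicialComplex V) (y : Finset V →₀ ℝ) : V →₀ ℝ :=
  normalize (divOn (vertexSet L) (innerMass L y) 1 (expand y))

/-- The coordinates with maximum one outside `L` and less than one on `L`. -/
noncomputable def pushInward (L : PreAbstractSimplicialComplex V) (x : V →₀ ℝ) : V →₀ ℝ :=
  divOn (vertexSet L) (maxOn (vertexSet L)ᶜ x + maxOn (vertexSet L) x)
    (maxOn (vertexSet L)ᶜ x) x

/-- The map from the complement of `∂Δ` in `Δ` to the complement of `∂Δ⁺` in `Δ⁺`. -/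
noncomputable def inward (L : PreAbstractSimplicialComplex V) (x : V →₀ ℝ) : Finset V →₀ ℝ :=
  levels (pushInward L x)

theorem isFlagPoint_of_realization (y : Realization (retract K L)) : IsFlagPoint y.1 :=
  ⟨y.2.1, fun _ hs => (K.isRelLowerSet_faces (y.2.2.1.1.2.1 _ hs)).1, y.2.2.1.1.2.2⟩

theorem innerMass_pos (y : Complement (retract K L) (retractBoundary K L)) :
    0 < innerMass L y.1.1 := by
  have : ∃ s ∈ y.1.1.support, ¬ ∃ v ∈ s, {v} ∈ L.faces := by
    by_contra! h
    exact y.2 ⟨y.1.2.2.1, h⟩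
  obtain ⟨s, hs, hsL⟩ := this
  exact mass_pos y.1.2.1 hs hsL

theorem mass_univ_realization (y : Realization (retract K L)) : mass y.1 Set.univ = 1 :=
  (mass_univ y.1).trans y.2.2.2

theorem maxOn_vertexSet_expand (y : Realization (retract K L)) :
    maxOn (vertexSet L) (expand y.1) = 1 - innerMass L y.1 := by
  rw [(isFlagPoint_of_realization y).maxOn_expand, eq_sub_iff_add_eq]
  refine Eq.trans (Eq.symm ?_) (mass_univ_realization y)
  exact mass_add_mass (fun s _ => ⟨fun _ => Classical.em _, fun _ => trivial⟩)
    fun s _ h h' => h' h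

/-- Fullness gives every simplex outside `L` a vertex outside `L`, so the entire weight 1 is
counted. -/
theorem maxOn_compl_vertexSet_expand
    (hfull : ∀ s ∈ K.faces, (∀ v ∈ s, {v} ∈ L.faces) → s ∈ L.faces)
    (y : Realization (retract K L)) : maxOn (vertexSet L)ᶜ (expand y.1) = 1 := by
  rw [(isFlagPoint_of_realization y).maxOn_expand]
  refine Eq.trans (mass_congr fun s hs => ?_) (mass_univ_realization y)
  refine ⟨fun _ => trivial, fun _ => ?_⟩
  by_contra hcon
  simp only [Set.mem_ofPred_eq, not_exists, not_and, Set.mem_compl_iff, not_not] at hcon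
  exact y.2.2.1.2 s hs (hfull s (y.2.2.1.1.2.1 s hs) hcon)

theorem support_divOn_expand (y : Complement (retract K L) (retractBoundary K L)) :
    (divOn (vertexSet L) (innerMass L y.1.1) 1 (expand y.1.1)).support =
      unionFinset y.1.1.support := by
  rw [support_divOn _ (innerMass_pos y).ne' one_ne_zero,
    (isFlagPoint_of_realization y.1).support_expand]

theorem unionFinset_support_mem (y : Realization (retract K L)) :
    unionFinset y.1.support ∈ y.1.support :=
  unionFinset_mem y.2.2.1.1.1 y.2.2.1.1.2.2

theorem divOn_expand_nonneg (y : Complement (retract K L) (retractBoundary K L)) (v : V) :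
    0 ≤ divOn (vertexSet L) (innerMass L y.1.1) 1 (expand y.1.1) v :=
  divOn_apply_of_nonneg (innerMass_pos y) one_pos
    (fun _ => mass_nonneg y.1.2.1 _) v

theorem sum_divOn_expand_pos (y : Complement (retract K L) (retractBoundary K L)) :
    0 < (divOn (vertexSet L) (innerMass L y.1.1) 1 (expand y.1.1)).sum fun _ a => a := by
  refine sum_pos_of_nonneg (divOn_expand_nonneg y) ?_
  rw [support_divOn_expand]
  exact (isFlagPoint_of_realization y.1).nonempty _ (unionFinset_support_mem y.1)

theorem support_outward (y : Complement (retract K L) (retractBoundary K L)) :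
    (outward L y.1.1).support = unionFinset y.1.1.support := by
  rw [outward, support_normalize (sum_divOn_expand_pos y), support_divOn_expand]

/-- The map `outward` between complements. -/
noncomputable def outwardMap (y : Complement (retract K L) (retractBoundary K L)) :
    Complement K L :=
  ⟨⟨outward L y.1.1, fun v => mul_nonneg (inv_nonneg.mpr (sum_divOn_expand_pos y).le)
      (divOn_expand_nonneg y v), by
      rw [support_outward]
      exact y.1.2.2.1.1.2.1 _ (unionFinset_support_mem y.1),
      sum_normalize (sum_divOn_expand_pos y)⟩, by
      change (outward L y.1.1).support ∉ L.faces
      rw [support_outward]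
      exact y.1.2.2.1.2 _ (unionFinset_support_mem y.1)⟩

theorem maxOn_compl_vertexSet_pos
    (hfull : ∀ s ∈ K.faces, (∀ v ∈ s, {v} ∈ L.faces) → s ∈ L.faces) (x : Complement K L) :
    0 < maxOn (vertexSet L)ᶜ x.1.1 := by
  have : ∃ v ∈ x.1.1.support, {v} ∉ L.faces := by
    by_contra! h
    exact x.2 (hfull _ x.1.2.2.1 h)
  obtain ⟨v, hv, hvL⟩ := this
  exact (lt_of_le_of_ne (x.1.2.1 v) (Finsupp.mem_support_iff.mp hv).symm).trans_le (le_maxOn hvL)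

theorem add_maxOn_pos
    (hfull : ∀ s ∈ K.faces, (∀ v ∈ s, {v} ∈ L.faces) → s ∈ L.faces) (x : Complement K L) :
    0 < maxOn (vertexSet L)ᶜ x.1.1 + maxOn (vertexSet L) x.1.1 :=
  add_pos_of_pos_of_nonneg (maxOn_compl_vertexSet_pos hfull x) (maxOn_nonneg _ _)

theorem pushInward_nonneg
    (hfull : ∀ s ∈ K.faces, (∀ v ∈ s, {v} ∈ L.faces) → s ∈ L.faces) (x : Complement K L) (v : V) :
    0 ≤ pushInward L x.1.1 v :=
  divOn_apply_of_nonneg (add_maxOn_pos hfull x) (maxOn_compl_vertexSet_pos hfull x) x.1.2.1 v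

theorem support_pushInward
    (hfull : ∀ s ∈ K.faces, (∀ v ∈ s, {v} ∈ L.faces) → s ∈ L.faces) (x : Complement K L) :
    (pushInward L x.1.1).support = x.1.1.support :=
  support_divOn _ (add_maxOn_pos hfull x).ne' (maxOn_compl_vertexSet_pos hfull x).ne'

theorem isFlagPoint_inward
    (hfull : ∀ s ∈ K.faces, (∀ v ∈ s, {v} ∈ L.faces) → s ∈ L.faces) (x : Complement K L) :
    IsFlagPoint (inward L x.1.1) :=
  isFlagPoint_levels (pushInward_nonneg hfull x)

theorem expand_inward
    (hfull : ∀ s ∈ K.faces, (∀ v ∈ s, {v} ∈ L.faces) → s ∈ L.faces) (x : Complement K L) :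
    expand (inward L x.1.1) = pushInward L x.1.1 :=
  expand_levels (pushInward_nonneg hfull x)

theorem unionFinset_support_inward
    (hfull : ∀ s ∈ K.faces, (∀ v ∈ s, {v} ∈ L.faces) → s ∈ L.faces) (x : Complement K L) :
    unionFinset (inward L x.1.1).support = x.1.1.support := by
  rw [← (isFlagPoint_inward hfull x).support_expand, expand_inward hfull, support_pushInward hfull]

theorem maxOn_compl_pushInward
    (hfull : ∀ s ∈ K.faces, (∀ v ∈ s, {v} ∈ L.faces) → s ∈ L.faces) (x : Complement K L) :
    maxOn (vertexSet L)ᶜ (pushInward L x.1.1) = 1 := by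
  rw [pushInward, maxOn_compl_divOn _ (maxOn_compl_vertexSet_pos hfull x)]
  exact div_self (maxOn_compl_vertexSet_pos hfull x).ne'

theorem maxOn_pushInward
    (hfull : ∀ s ∈ K.faces, (∀ v ∈ s, {v} ∈ L.faces) → s ∈ L.faces) (x : Complement K L) :
    maxOn (vertexSet L) (pushInward L x.1.1) = maxOn (vertexSet L) x.1.1 /
      (maxOn (vertexSet L)ᶜ x.1.1 + maxOn (vertexSet L) x.1.1) := by
  rw [pushInward, maxOn_divOn _ (add_maxOn_pos hfull x)]

theorem maxOn_pushInward_lt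
    (hfull : ∀ s ∈ K.faces, (∀ v ∈ s, {v} ∈ L.faces) → s ∈ L.faces) (x : Complement K L) :
    maxOn (vertexSet L) (pushInward L x.1.1) < 1 := by
  rw [maxOn_pushInward hfull, div_lt_one (add_maxOn_pos hfull x)]
  exact lt_add_of_pos_left _ (maxOn_compl_vertexSet_pos hfull x)

theorem sum_inward
    (hfull : ∀ s ∈ K.faces, (∀ v ∈ s, {v} ∈ L.faces) → s ∈ L.faces) (x : Complement K L) :
    ((inward L x.1.1).sum fun _ a => a) = 1 := by
  rw [(isFlagPoint_inward hfull x).sum_eq, expand_inward hfull, maxOn_univ (vertexSet L),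
    maxOn_compl_pushInward hfull, max_eq_right (maxOn_pushInward_lt hfull x).le]

/-- The total weight is 1, and the flag members meeting `L` carry the largest `L`-coordinate `m / (M
+ m)`, where `M` and `m` are the maxima of `x` off and on `L`. -/
theorem innerMass_inward
    (hfull : ∀ s ∈ K.faces, (∀ v ∈ s, {v} ∈ L.faces) → s ∈ L.faces) (x : Complement K L) :
    innerMass L (inward L x.1.1) = maxOn (vertexSet L)ᶜ x.1.1 /
      (maxOn (vertexSet L)ᶜ x.1.1 + maxOn (vertexSet L) x.1.1) := by
  have h1 := (isFlagPoint_inward hfull x).maxOn_expand (vertexSet L)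
  rw [expand_inward hfull, maxOn_pushInward hfull] at h1
  have h2 : mass (inward L x.1.1) Set.univ =
      mass (inward L x.1.1) {s | ∃ v ∈ s, v ∈ vertexSet L} + innerMass L (inward L x.1.1) :=
    mass_add_mass (fun s _ => ⟨fun _ => Classical.em _, fun _ => trivial⟩) fun s _ h h' => h' h
  rw [mass_univ, sum_inward hfull, ← h1] at h2
  have h3 := (add_maxOn_pos hfull x).ne'
  field_simp at h2 ⊢
  linarith

theorem support_inward_mem
    (hfull : ∀ s ∈ K.faces, (∀ v ∈ s, {v} ∈ L.faces) → s ∈ L.faces) (x : Complement K L) :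
    (inward L x.1.1).support ∈ (retract K L).faces := by
  have hflag := isFlagPoint_inward hfull x
  refine ⟨⟨?_, fun s hs => ?_, hflag.chain⟩, fun s hs hsL => ?_⟩
  · by_contra h
    have h1 := sum_inward hfull x
    rw [Finset.not_nonempty_iff_eq_empty.mp h |> Finsupp.support_eq_empty.mp] at h1
    simp at h1
  · refine (K.isRelLowerSet_faces x.1.2.2.1).2 ?_ (hflag.nonempty s hs)
    rw [← unionFinset_support_inward hfull x]
    exact subset_unionFinset hs
  -- The flag members with a vertex off `L` already carry the total weight 1, so a member in `L`
  -- would be excess weight.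
  · have h1 := hflag.maxOn_expand (vertexSet L)ᶜ
    rw [expand_inward hfull, maxOn_compl_pushInward hfull] at h1
    have h2 : mass (inward L x.1.1) Set.univ =
        mass (inward L x.1.1) {s | ∃ v ∈ s, v ∈ (vertexSet L)ᶜ} +
          mass (inward L x.1.1) {s | ¬ ∃ v ∈ s, v ∈ (vertexSet L)ᶜ} :=
      mass_add_mass (fun s _ => ⟨fun _ => Classical.em _, fun _ => trivial⟩) fun s _ h h' => h' h
    rw [mass_univ, sum_inward hfull, ← h1] at h2
    have h3 : 0 < mass (inward L x.1.1) {s | ¬ ∃ v ∈ s, v ∈ (vertexSet L)ᶜ} := by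
      refine mass_pos hflag.nonneg hs ?_
      rintro ⟨v, hv, hvL⟩
      exact hvL ((L.isRelLowerSet_faces hsL).2 (by simpa using hv) (Finset.singleton_nonempty v))
    linarith

/-- The map `inward` between complements. -/
noncomputable def inwardMap
    (hfull : ∀ s ∈ K.faces, (∀ v ∈ s, {v} ∈ L.faces) → s ∈ L.faces) (x : Complement K L) :
    Complement (retract K L) (retractBoundary K L) :=
  ⟨⟨inward L x.1.1, (isFlagPoint_inward hfull x).nonneg, support_inward_mem hfull x,
    sum_inward hfull x⟩, fun h => by
      have h1 : 0 < innerMass L (inward L x.1.1) := by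
        rw [innerMass_inward hfull]
        exact div_pos (maxOn_compl_vertexSet_pos hfull x) (add_maxOn_pos hfull x)
      obtain ⟨s, hs, hsL⟩ := exists_of_mass_ne_zero h1.ne'
      exact hsL (h.2 s hs)⟩

theorem outwardMap_inwardMap
    (hfull : ∀ s ∈ K.faces, (∀ v ∈ s, {v} ∈ L.faces) → s ∈ L.faces) (x : Complement K L) :
    outwardMap (inwardMap hfull x) = x := by
  refine Subtype.ext (Subtype.ext ?_)
  change outward L (inward L x.1.1) = x.1.1
  have hM := maxOn_compl_vertexSet_pos hfull x
  have hMm := add_maxOn_pos hfull x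
  -- Dividing the `L`-coordinates `x v / (M + m)` by the inner mass `M / (M + m)` gives `x v / M`,
  -- the same scaling as off `L`.
  have h1 : divOn (vertexSet L) (innerMass L (inward L x.1.1)) 1 (expand (inward L x.1.1)) =
      (maxOn (vertexSet L)ᶜ x.1.1)⁻¹ • x.1.1 := by
    rw [innerMass_inward hfull, expand_inward hfull]
    ext v
    rw [Finsupp.smul_apply, smul_eq_mul]
    by_cases hv : v ∈ vertexSet L
    · rw [divOn_of_mem hv, pushInward, divOn_of_mem hv]
      field_simp
    · rw [divOn_of_notMem hv, pushInward, divOn_of_notMem hv, div_one, div_eq_inv_mul]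
  rw [outward, h1, normalize, Finsupp.sum_smul_index (fun _ => rfl), ← Finsupp.mul_sum, x.1.2.2.2,
    mul_one, inv_inv, smul_smul, mul_inv_cancel₀ hM.ne', one_smul]

theorem pushInward_smul (x : V →₀ ℝ) {c : ℝ} (hc : 0 < c) :
    pushInward L (c • x) = pushInward L x := by
  have h : ∀ P : Set V, maxOn P (c • x) = c * maxOn P x := fun P =>
    maxOn_scale hc fun v _ => rfl
  unfold pushInward
  rw [h, h, ← mul_add]
  ext v
  by_cases hv : v ∈ vertexSet L
  · rw [divOn_of_mem hv, divOn_of_mem hv, Finsupp.smul_apply, smul_eq_mul,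
      mul_div_mul_left _ _ hc.ne']
  · rw [divOn_of_notMem hv, divOn_of_notMem hv, Finsupp.smul_apply, smul_eq_mul,
      mul_div_mul_left _ _ hc.ne']

/-- Normalization is invisible to the scale-invariant `pushInward`. After division by `q` the maxima
off and on `L` are `1` and `(1 - q) / q`, with sum `1 / q`, so `pushInward` multiplies the
`L`-coordinates by `q` again. -/
theorem inwardMap_outwardMap
    (hfull : ∀ s ∈ K.faces, (∀ v ∈ s, {v} ∈ L.faces) → s ∈ L.faces)
    (y : Complement (retract K L) (retractBoundary K L)) :
    inwardMap hfull (outwardMap y) = y := by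
  refine Subtype.ext (Subtype.ext ?_)
  change levels (pushInward L (outward L y.1.1)) = y.1.1
  have hq := innerMass_pos y
  have h1 : pushInward L (outward L y.1.1) = expand y.1.1 := by
    rw [outward, normalize, pushInward_smul _ (inv_pos.mpr (sum_divOn_expand_pos y))]
    unfold pushInward
    rw [maxOn_divOn _ hq, maxOn_compl_divOn _ one_pos, maxOn_vertexSet_expand y.1,
      maxOn_compl_vertexSet_expand hfull y.1]
    ext v
    by_cases hv : v ∈ vertexSet L
    · rw [divOn_of_mem hv, divOn_of_mem hv]
      field_simp
      ring
    · rw [divOn_of_notMem hv, divOn_of_notMem hv]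
      simp
  rw [h1, (isFlagPoint_of_realization y.1).levels_expand]

theorem continuous_outwardMap :
    Continuous (outwardMap : Complement (retract K L) (retractBoundary K L) → Complement K L) := by
  refine continuous_complement _ (fun c => unionFinset c) (fun c _ p hp => ?_) fun c _ v => ?_
  · change (outward L p.1.1).support ⊆ _
    rw [support_outward]
    intro v hv
    obtain ⟨s, hs, hvs⟩ := mem_unionFinset.mp hv
    exact mem_unionFinset.mpr ⟨s, hp hs, hvs⟩
  · let p : {x : Cell (retract K L) c // x.1.1.support ∉ (retractBoundary K L).faces} →
      Complement (retract K L) (retractBoundary K L) := fun z => ⟨z.1.1, z.2⟩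
    change Continuous fun z => normalize (divOn (vertexSet L) (innerMass L (p z).1.1) 1
      (expand (p z).1.1)) v
    have hcoord : ∀ s, Continuous fun z => (p z).1.1 s := fun s =>
      (continuous_cell_coord (K := retract K L) (s := c) s).comp continuous_subtype_val
    have hmass : ∀ P, Continuous fun z => mass (p z).1.1 P := fun P =>
      continuous_mass hcoord (T := c) (fun z => z.1.2) P
    refine continuous_normalize (T := unionFinset c) (fun v => ?_) (fun z => ?_)
      (fun z => sum_divOn_expand_pos (p z)) v
    · exact continuous_divOn (fun v => hmass {s | v ∈ s}) (hmass _) continuous_const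
        (fun z => (innerMass_pos (p z)).ne') (fun _ => one_ne_zero) _ v
    · rw [support_divOn_expand]
      intro v hv
      obtain ⟨s, hs, hvs⟩ := mem_unionFinset.mp hv
      exact mem_unionFinset.mpr ⟨s, z.1.2 hs, hvs⟩

theorem continuous_inwardMap
    (hfull : ∀ s ∈ K.faces, (∀ v ∈ s, {v} ∈ L.faces) → s ∈ L.faces) :
    Continuous (inwardMap hfull) := by
  refine continuous_complement _ (fun s => s.powerset) (fun s _ p hp => ?_) fun s _ t => ?_
  · change (inward L p.1.1).support ⊆ _
    intro t ht
    rw [Finset.mem_powerset]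
    have := subset_unionFinset ht
    rw [unionFinset_support_inward hfull] at this
    exact this.trans hp
  · let p : {x : Cell K s // x.1.1.support ∉ L.faces} → Complement K L := fun z => ⟨z.1.1, z.2⟩
    change Continuous fun z => levels (pushInward L (p z).1.1) t
    have hcoord : ∀ v, Continuous fun z => (p z).1.1 v := fun v =>
      (continuous_cell_coord (K := K) (s := s) v).comp continuous_subtype_val
    have hmax : ∀ P, Continuous fun z => maxOn P (p z).1.1 := fun P =>
      continuous_maxOn hcoord (T := s) (fun z => z.1.2) P
    refine continuous_levels (T := s) (fun v => ?_) (fun z => ?_) t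
    · exact continuous_divOn hcoord ((hmax _).add (hmax _)) (hmax _)
        (fun z => (add_maxOn_pos hfull (p z)).ne')
        (fun z => (maxOn_compl_vertexSet_pos hfull (p z)).ne') _ v
    · rw [support_pushInward hfull (p z)]
      exact z.1.2

/-- `Δ⁺ - ∂Δ⁺` is homeomorphic to `Δ - ∂Δ`. -/
noncomputable def complementHomeomorph
    (hfull : ∀ s ∈ K.faces, (∀ v ∈ s, {v} ∈ L.faces) → s ∈ L.faces) :
    Complement (retract K L) (retractBoundary K L) ≃ₜ Complement K L where
  toFun := outwardMap
  invFun := inwardMap hfull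
  left_inv := inwardMap_outwardMap hfull
  right_inv := outwardMap_inwardMap hfull
  continuous_toFun := continuous_outwardMap
  continuous_invFun := continuous_inwardMap hfull

end Homeomorphism

end ConeRetraction

theorem mainTheorem12 {U : Type*} [NormedAddCommGroup U] [NormedSpace ℝ U]
    [FiniteDimensional ℝ U]
    -- the lattice `Λ` in `U` and the open cone `C`, containing no line in its closure
    (Λ : Submodule ℤ U) [DiscreteTopology Λ] [IsZLattice ℝ Λ]
    (C : ConvexCone ℝ U) (hCopen : IsOpen (C : Set U)) (hCne : (C : Set U).Nonempty)
    (hCsal : ∀ x ∈ closure (C : Set U), -x ∈ closure (C : Set U) → x = 0)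
    -- the neat group `Γ` of automorphisms of `C` preserving the lattice
    (Γ : Subgroup (U ≃ₗ[ℝ] U)) (hΓneat : ConeRetraction.IsNeat Γ)
    (hΓC : ∀ γ ∈ Γ, γ '' (C : Set U) = C) (hΓΛ : ∀ γ ∈ Γ, γ '' (Λ : Set U) = Λ)
    -- the simplicial `Γ`-admissible cone decomposition `S` of `C^*`
    (S : Set (PointedCone ℝ U)) (hS : ConeRetraction.IsAdmissible Λ C Γ S)
    (hSsimp : ∀ σ ∈ S, σ.IsSimplicial)
    -- two different rays of a cone are not `Γ`-equivalent
    (hSrays : ∀ σ ∈ S, ∀ ρ₁ ∈ S, ∀ ρ₂ ∈ S, ConeRetraction.IsRay ρ₁ → ConeRetraction.IsRay ρ₂ →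
      ρ₁ ≤ σ → ρ₂ ≤ σ → ∀ γ ∈ Γ, ConeRetraction.act γ ρ₁ = ρ₂ → ρ₁ = ρ₂)
    -- each cone meets the boundary inside the span of a single proper rational face
    (hSbdry : ∀ σ ∈ S, ∃ B : PointedCone ℝ U, ConeRetraction.IsRationalFace Λ C B ∧
      B ≠ ConeRetraction.closedCone C ∧
      (σ : Set U) ∩ (ConeRetraction.rationalClosure Λ C \ (C : Set U)) ⊆
        Submodule.span ℝ (B : Set U)) :
    let Δ := ConeRetraction.projectivization S
    let Δ₀ := ConeRetraction.projectivization (ConeRetraction.boundaryFan C S)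
    ∃ (hΔ : ConeRetraction.LocallyFiniteOff Δ Δ₀)
      (Δp Δp₀ : PreAbstractSimplicialComplex (Finset (PointedCone ℝ U)))
      (hΔp : ConeRetraction.LocallyFinite Δp),
      Δp ≤ ConeRetraction.barycentric Δ ∧ Δp₀ ≤ Δp ∧
      ConeRetraction.IsInvariant Γ Δp ∧
      Nonempty (ConeRetraction.Complement Δp Δp₀ ≃ₜ ConeRetraction.Complement Δ Δ₀) ∧
      ∀ (R : Type*) [CommRing R],
        ∃ f : ConeRetraction.cochainComplex R (hΔp.off Δp₀) ⟶ ConeRetraction.cochainComplex R hΔ,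
          QuasiIso f := by
  intro Δ Δ₀
  have hfin : ConeRetraction.LocallyFiniteOff Δ Δ₀ :=
    hS.locallyFiniteOff hCopen hCsal hΓC hΓΛ hSrays hSbdry
  have hfull : ∀ s ∈ Δ.faces, (∀ v ∈ s, {v} ∈ Δ₀.faces) → s ∈ Δ₀.faces :=
    fun _ hs hv => hS.mem_boundary_of_vertices hCopen hSbdry hs hv
  exact ⟨hfin, ConeRetraction.retract Δ Δ₀, ConeRetraction.retractBoundary Δ Δ₀,
    ConeRetraction.locallyFinite_retract hfin, ConeRetraction.retract_le Δ Δ₀,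
    ConeRetraction.retractBoundary_le Δ Δ₀, ConeRetraction.isInvariant_retract hS hΓC,
    ⟨ConeRetraction.complementHomeomorph hfull⟩,
    fun R _ => ConeRetraction.exists_quasiIso_retract hfull hfin⟩
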